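/- **Setting.** There are $N$ players with states $x^i_t$, controls $u^i_t$, an environment state $x^0_t$ and environment variables $y_t\in\mathbb R^{n_y}$, $t\in\mathbb N_0$ (all vectors finite-dimensional), with $$x^i_{t+1}=A^ix^i_t+B^iu^i_t+C^iy_t+w^i_t,\qquad x^0_{t+1}=A^0x^0_t+\sum_i(B^{1,i}u^i_t+B^{2,i}x^i_t)+w^0_t,\qquad y_t=Dx^0_t+\sum_i(E^{1,i}u^i_t+E^{2,i}x^i_t)+\xi_t .$$ Put $X_t=(x^0_t,\dots,x^N_t)$ and $W_t=(w^0_t,\dots,w^N_t)$. Player $i$ has stage cost $c^i(x,u,y)=x'Q^ix+u'R^iu+2y'(K^iu+L^ix)$ with $Q^i\succ0$, $R^i\succ0$, and discount factor $\beta^i\in[0,1)$. A pure strategy $s^i$ is a sequence of measurable maps giving $u^i_t=s^i_t\big((x^i_k)_{k\le t},(u^i_k)_{k<t},(y_k)_{k<t}\big)$. For a deterministic sequence $z=(z_t)$, $J^i(s^i,z)=E\big[\sum_t(\beta^i)^tc^i(x^i_t,u^i_t,z_t)\big]$, where $y_t$ is replaced by $z_t$ in player $i$'s dynamics and observations. A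 joint strategy $s$ is an SEBEU (subjective equilibrium under beliefs of exogenous uncertainty) if there are probability measures $\zeta^i$ on $(\mathbb R^{n_y})^{\mathbb N_0}$ such that, for every $i$, $s^i$ minimizes $E^{\zeta^i}[J^i(\cdot,\cdot)]$ over all pure strategies of player $i$, and $\zeta^i$ is the distribution of $(y_t)_{t}$ generated by $s$. **Best-response coefficients.** Dropping the index $i$, let $M\succeq0$ be the positive semidefinite solution of $M=Q+\beta A'(M-\beta MBS^{-1}B'M)A$, $S=R+\beta B'MB$, and let $$F=-\beta S^{-1}B'MA,\quad \Phi=\beta(A+BF)',\quad G_0=-S^{-1}(K'+\beta B'MC),$$ $$G_n=-\beta S^{-1}B'\Phi^{\,n-1}(F'K'+L'+\Phi MC)\ (n\ge1),\quad H=-\beta S^{-1}B'(I-\Phi)^{-1}M\,E[w_0].$$ If every player uses $u^i_t=F^ix^i_t+\sum_nG^i_n\hat y_{t+n}+H^i$ for given vectors $(\hat y_{t+n})_{n\ge0}$, the system reads $y_t=\mathcal DX_t+\sum_n\mathcal G^p_n\hat y_{t+n}+\mathcal H^p+\xi_t$, $X_{t+1}=\mathcal AX_t+\sum_n\mathcal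 G^X_n\hat y_{t+n}+\mathcal H^X+\mathcal Cy_t+W_t$; this defines $\mathcal D,\mathcal G^p_n,\mathcal H^p,\mathcal A,\mathcal G^X_n,\mathcal H^X,\mathcal C$. **Theorem.** Assume: 1. all eigenvalues of $A^0$ lie in the open unit disc, and each $(A^i,B^i)$ is stabilizable; 2. $X_0,W_0,W_1,\dots,\xi_0,\xi_1,\dots$ are mutually independent with finite second moments, and $(W_t)_t$ and $(\xi_t)_t$ are each identically distributed; 3. for every vector $\hat X_0$ the infinite linear system, $t\in\mathbb N_0$, $$\hat y_t=\mathcal D\hat X_t+\sum_{n\ge0}\mathcal G^p_n\hat y_{t+n}+\mathcal H^p+E[\xi_0],\qquad \hat X_{t+1}=\mathcal A\hat X_t+\sum_{n\ge0}\mathcal G^X_n\hat y_{t+n}+\mathcal H^X+\mathcal C\hat y_t+E[W_0]$$ has exactly one bounded solution $(\hat y_t)_t$; write it as $\hat y_t=a_t\hat X_0+b_t$. Let $(\bar X_0,(\bar\xi_t)_t,(\bar W_t)_t)$ have the same joint distribution as $(X_0,(\xi_t)_t,(W_t)_t)$ and define the replica process by $$\bar y_t=\mathcal D\bar X_t+\Big(\sum_n\mathcal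 G^p_na_n\Big)E[\bar X_t|\bar Y_{t-1}]+\sum_n\mathcal G^p_nb_n+\mathcal H^p+\bar\xi_t,$$ $$\bar X_{t+1}=\mathcal A\bar X_t+\Big(\sum_n\mathcal G^X_na_n\Big)E[\bar X_t|\bar Y_{t-1}]+\sum_n\mathcal G^X_nb_n+\mathcal H^X+\mathcal C\bar y_t+\bar W_t,$$ with $\bar Y_{t-1}=(\bar y_k)_{k<t}$, and suppose $\sup_tE|\bar y_t|^2<\infty$. Then there are measurable maps $\hat{\bar X}_{t|t-1}(\cdot)$ with $\hat{\bar X}_{t|t-1}(\bar Y_{t-1})=E[\bar X_t|\bar Y_{t-1}]$ almost surely for all $t$, and for every choice of such maps the joint strategy $$s^i_t=F^ix^i_t+G^i\,\hat{\bar X}_{t|t-1}\big((y_k)_{k<t}\big)+\check H^i,\qquad G^i=\sum_nG^i_na_n,\quad \check H^i=\sum_nG^i_nb_n+H^i,$$ is an SEBEU, at which every player's expected cost under its belief is finite. -/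

import Mathlib

open MeasureTheory ProbabilityTheory Matrix
open scoped ENNReal

noncomputable section

namespace LQ

/-- Vectors of length `n`. -/
abbrev Vec (n : ℕ) : Type := Fin n → ℝ

/-- Index set of the joint state `X = (x⁰, x¹, …, xᴺ)`. -/
abbrev StateIdx {N : ℕ} (n0 : ℕ) (nx : Fin N → ℕ) : Type := Fin n0 ⊕ (Σ i : Fin N, Fin (nx i))

/-- Joint states (and joint state disturbances `W = (w⁰, w¹, …, wᴺ)`). -/
abbrev StateVec {N : ℕ} (n0 : ℕ) (nx : Fin N → ℕ) : Type := StateIdx n0 nx → ℝ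

/-- The environment component `x⁰` of a joint state. -/
def envPart {N n0 : ℕ} {nx : Fin N → ℕ} (X : StateVec n0 nx) : Vec n0 := fun r => X (Sum.inl r)

/-- The component `xⁱ` of a joint state. -/
def own {N n0 : ℕ} {nx : Fin N → ℕ} (i : Fin N) (X : StateVec n0 nx) : Vec (nx i) :=
  fun r => X (Sum.inr ⟨i, r⟩)

/-- A real square matrix is stable if all its complex eigenvalues lie in the open unit disc. -/
def IsStable {m : ℕ} (A : Matrix (Fin m) (Fin m) ℝ) : Prop :=
  ∀ z ∈ spectrum ℂ (A.map (algebraMap ℝ ℂ)), ‖z‖ < 1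

/-- `(A, B)` is stabilizable if some linear state feedback makes it stable. -/
def IsStabilizable {m k : ℕ} (A : Matrix (Fin m) (Fin m) ℝ) (B : Matrix (Fin m) (Fin k) ℝ) : Prop :=
  ∃ F : Matrix (Fin k) (Fin m) ℝ, IsStable (A + B * F)

/-- The data of a time-invariant, discounted linear-quadratic game with `N` players. -/
structure Game (N n0 ny : ℕ) (nx nu : Fin N → ℕ) where
  A : ∀ i, Matrix (Fin (nx i)) (Fin (nx i)) ℝ
  B : ∀ i, Matrix (Fin (nx i)) (Fin (nu i)) ℝ
  C : ∀ i, Matrix (Fin (nx i)) (Fin ny) ℝ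
  Q : ∀ i, Matrix (Fin (nx i)) (Fin (nx i)) ℝ
  R : ∀ i, Matrix (Fin (nu i)) (Fin (nu i)) ℝ
  K : ∀ i, Matrix (Fin ny) (Fin (nu i)) ℝ
  L : ∀ i, Matrix (Fin ny) (Fin (nx i)) ℝ
  β : Fin N → ℝ
  A0 : Matrix (Fin n0) (Fin n0) ℝ
  B1 : ∀ i, Matrix (Fin n0) (Fin (nu i)) ℝ
  B2 : ∀ i, Matrix (Fin n0) (Fin (nx i)) ℝ
  D : Matrix (Fin ny) (Fin n0) ℝ
  E1 : ∀ i, Matrix (Fin ny) (Fin (nu i)) ℝ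
  E2 : ∀ i, Matrix (Fin ny) (Fin (nx i)) ℝ
  Q_posDef : ∀ i, (Q i).PosDef
  R_posDef : ∀ i, (R i).PosDef
  β_nonneg : ∀ i, 0 ≤ β i
  β_lt_one : ∀ i, β i < 1

/-- A pure strategy: at time `t` the decision is a measurable function of
`((x_0, …, x_t), (u_0, …, u_{t-1}), (y_0, …, y_{t-1}))`. -/
structure Strategy (n k ny : ℕ) where
  act : ∀ t : ℕ, (Fin (t + 1) → Vec n) × (Fin t → Vec k) × (Fin t → Vec ny) → Vec k
  measurable_act : ∀ t, Measurable (act t)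

/-- Sum of a real series in the extended reals (sum of positive parts minus sum of negative
parts). -/
def esum (f : ℕ → ℝ) : EReal :=
  ((∑' t, ENNReal.ofReal (f t) : ℝ≥0∞) : EReal) - ((∑' t, ENNReal.ofReal (-(f t)) : ℝ≥0∞) : EReal)

/-- Expectation of an extended-real random variable (integral of the positive part minus integral
of the negative part). -/
def eexp {Ω : Type*} [MeasurableSpace Ω] (μ : Measure Ω) (f : Ω → EReal) : EReal :=
  ((∫⁻ ω, (f ω).toENNReal ∂μ : ℝ≥0∞) : EReal) - ((∫⁻ ω, (-(f ω)).toENNReal ∂μ : ℝ≥0∞) : EReal)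

namespace Game

variable {N n0 ny : ℕ} {nx nu : Fin N → ℕ} (g : Game N n0 ny nx nu)

/-- One-stage cost of player `i`. -/
def cost (i : Fin N) (x : Vec (nx i)) (u : Vec (nu i)) (y : Vec ny) : ℝ :=
  x ⬝ᵥ (g.Q i *ᵥ x) + u ⬝ᵥ (g.R i *ᵥ u) + 2 * (y ⬝ᵥ (g.K i *ᵥ u + g.L i *ᵥ x))

/-- Joint pure strategies. -/
abbrev Profile (_g : Game N n0 ny nx nu) : Type := ∀ i : Fin N, Strategy (nx i) (nu i) ny

/-! ### Endogenous dynamics under a joint strategy -/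

/-- History `((X_0, …, X_t), (u_0, …, u_{t-1}), (y_0, …, y_{t-1}))` generated by a joint strategy
from the initial state `X0`, the state disturbances `W` and the observation disturbances `ξ`. -/
def closedLoop (s : g.Profile) (X0 : StateVec n0 nx) (W : ℕ → StateVec n0 nx) (ξ : ℕ → Vec ny) :
    (t : ℕ) → (Fin (t + 1) → StateVec n0 nx) × (Fin t → ∀ i, Vec (nu i)) × (Fin t → Vec ny)
  | 0 => (fun _ => X0, Fin.elim0, Fin.elim0)
  | t + 1 =>
    let h := closedLoop s X0 W ξ t
    let X := h.1 (Fin.last t)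
    let u : ∀ i, Vec (nu i) := fun i =>
      (s i).act t (fun k => own i (h.1 k), fun k => h.2.1 k i, h.2.2)
    let y : Vec ny :=
      g.D *ᵥ envPart X + ∑ i, (g.E1 i *ᵥ u i + g.E2 i *ᵥ own i X) + ξ t
    let x0' : Vec n0 := g.A0 *ᵥ envPart X + ∑ i, (g.B1 i *ᵥ u i + g.B2 i *ᵥ own i X)
    let x' : ∀ i, Vec (nx i) := fun i => g.A i *ᵥ own i X + g.B i *ᵥ u i + g.C i *ᵥ y
    let X' : StateVec n0 nx := Sum.elim x0' (fun p => x' p.1 p.2) + W t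
    (Fin.snoc (α := fun _ => StateVec n0 nx) h.1 X',
      Fin.snoc (α := fun _ => ∀ i, Vec (nu i)) h.2.1 u,
      Fin.snoc (α := fun _ => Vec ny) h.2.2 y)

/-- The environment variables generated by a joint strategy. -/
def envPath (s : g.Profile) (X0 : StateVec n0 nx) (W : ℕ → StateVec n0 nx) (ξ : ℕ → Vec ny) :
    ℕ → Vec ny :=
  fun t => (g.closedLoop s X0 W ξ (t + 1)).2.2 (Fin.last t)

/-- The objective distribution `ζ_s` of the environment variables. -/
def envLaw {Ω : Type*} [MeasurableSpace Ω] (μ : Measure Ω) (X0 : Ω → StateVec n0 nx)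
    (W : ℕ → Ω → StateVec n0 nx) (ξ : ℕ → Ω → Vec ny) (s : g.Profile) : Measure (ℕ → Vec ny) :=
  μ.map (fun ω => g.envPath s (X0 ω) (fun t => W t ω) (fun t => ξ t ω))

/-! ### A single player facing exogenous environment variables -/

/-- History `((x_0, …, x_t), (u_0, …, u_{t-1}))` of player `i` for a given sequence `z` of
environment variables. -/
def playerHist (i : Fin N) (s : Strategy (nx i) (nu i) ny) (x0 : Vec (nx i))
    (w : ℕ → Vec (nx i)) (z : ℕ → Vec ny) :
    (t : ℕ) → (Fin (t + 1) → Vec (nx i)) × (Fin t → Vec (nu i))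
  | 0 => (fun _ => x0, Fin.elim0)
  | t + 1 =>
    let h := playerHist i s x0 w z t
    let u : Vec (nu i) := s.act t (h.1, h.2, fun k => z k)
    (Fin.snoc (α := fun _ => Vec (nx i)) h.1
        (g.A i *ᵥ h.1 (Fin.last t) + g.B i *ᵥ u + g.C i *ᵥ z t + w t),
      Fin.snoc (α := fun _ => Vec (nu i)) h.2 u)

/-- Cost of player `i` incurred at time `t` along the generated path. -/
def stageCost (i : Fin N) (s : Strategy (nx i) (nu i) ny) (x0 : Vec (nx i))
    (w : ℕ → Vec (nx i)) (z : ℕ → Vec ny) (t : ℕ) : ℝ :=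
  let h := g.playerHist i s x0 w z t
  g.cost i (h.1 (Fin.last t)) (s.act t (h.1, h.2, fun k => z k)) (z t)

/-- `Jⁱ(sⁱ, z)`: expected discounted cost for a deterministic sequence `z`. -/
def J {Ω : Type*} [MeasurableSpace Ω] (μ : Measure Ω) (X0 : Ω → StateVec n0 nx)
    (W : ℕ → Ω → StateVec n0 nx) (i : Fin N) (s : Strategy (nx i) (nu i) ny)
    (z : ℕ → Vec ny) : EReal :=
  eexp μ fun ω => esum fun t =>
    g.β i ^ t * g.stageCost i s (own i (X0 ω)) (fun k => own i (W k ω)) z t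

/-- `E^ζ[Jⁱ(sⁱ, ·)]`. -/
def beliefCost {Ω : Type*} [MeasurableSpace Ω] (μ : Measure Ω) (X0 : Ω → StateVec n0 nx)
    (W : ℕ → Ω → StateVec n0 nx) (i : Fin N) (ζ : Measure (ℕ → Vec ny))
    (s : Strategy (nx i) (nu i) ny) : EReal :=
  eexp ζ fun z => g.J μ X0 W i s z

/-- Subjective equilibrium under beliefs of exogenous uncertainty in pure strategies. -/
def IsSEBEU {Ω : Type*} [MeasurableSpace Ω] (μ : Measure Ω) (X0 : Ω → StateVec n0 nx)
    (W : ℕ → Ω → StateVec n0 nx) (ξ : ℕ → Ω → Vec ny) (s : g.Profile) : Prop :=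
  ∃ ζ : Fin N → Measure (ℕ → Vec ny), (∀ i, IsProbabilityMeasure (ζ i)) ∧
    (∀ i, ∀ s' : Strategy (nx i) (nu i) ny,
      g.beliefCost μ X0 W i (ζ i) (s i) ≤ g.beliefCost μ X0 W i (ζ i) s') ∧
    ∀ i, ζ i = g.envLaw μ X0 W ξ s

/-! ### Coefficients of a player's best response -/

/-- `S = R + β B' M B`. -/
def SOf (i : Fin N) (M : Matrix (Fin (nx i)) (Fin (nx i)) ℝ) : Matrix (Fin (nu i)) (Fin (nu i)) ℝ :=
  g.R i + g.β i • ((g.B i)ᵀ * M * g.B i)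

/-- `M` is a positive semidefinite solution of the algebraic Riccati equation of player `i`. -/
def IsRiccatiSolution (i : Fin N) (M : Matrix (Fin (nx i)) (Fin (nx i)) ℝ) : Prop :=
  M.PosSemidef ∧
    M = g.Q i + g.β i • ((g.A i)ᵀ *
      (M - g.β i • (M * g.B i * (g.SOf i M)⁻¹ * (g.B i)ᵀ * M)) * g.A i)

/-- The positive semidefinite solution of the algebraic Riccati equation. -/
def M (i : Fin N) : Matrix (Fin (nx i)) (Fin (nx i)) ℝ := Classical.epsilon (g.IsRiccatiSolution i)

def S (i : Fin N) : Matrix (Fin (nu i)) (Fin (nu i)) ℝ := g.SOf i (g.M i)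

def F (i : Fin N) : Matrix (Fin (nu i)) (Fin (nx i)) ℝ :=
  -(g.β i • ((g.S i)⁻¹ * (g.B i)ᵀ * g.M i * g.A i))

/-- `β (A + B F)'`. -/
def Φ (i : Fin N) : Matrix (Fin (nx i)) (Fin (nx i)) ℝ := g.β i • (g.A i + g.B i * g.F i)ᵀ

/-- The weight of the player's forecast of the environment variable `n` steps ahead. -/
def Gn (i : Fin N) : ℕ → Matrix (Fin (nu i)) (Fin ny) ℝ
  | 0 => -((g.S i)⁻¹ * ((g.K i)ᵀ + g.β i • ((g.B i)ᵀ * g.M i * g.C i)))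
  | n + 1 => -(g.β i • ((g.S i)⁻¹ * (g.B i)ᵀ * g.Φ i ^ n *
      (((g.F i)ᵀ * (g.K i)ᵀ + (g.L i)ᵀ) + g.Φ i * g.M i * g.C i)))

/-- The constant term; `what` is the mean of the joint state disturbance. -/
def H (what : StateVec n0 nx) (i : Fin N) : Vec (nu i) :=
  -(g.β i • (((g.S i)⁻¹ * (g.B i)ᵀ * (1 - g.Φ i)⁻¹ * g.M i) *ᵥ own i what))

/-! ### Joint system in vector form -/

def calD : Matrix (Fin ny) (StateIdx n0 nx) ℝ :=
  Matrix.fromCols g.D (Matrix.of fun r p => (g.E1 p.1 * g.F p.1 + g.E2 p.1) r p.2)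

def calA : Matrix (StateIdx n0 nx) (StateIdx n0 nx) ℝ :=
  Matrix.fromBlocks g.A0 (Matrix.of fun r p => (g.B1 p.1 * g.F p.1 + g.B2 p.1) r p.2)
    0 (Matrix.blockDiagonal' fun i => g.A i + g.B i * g.F i)

def calC : Matrix (StateIdx n0 nx) (Fin ny) ℝ :=
  Matrix.fromRows 0 (Matrix.of fun p c => g.C p.1 p.2 c)

def calGp (n : ℕ) : Matrix (Fin ny) (Fin ny) ℝ := ∑ i, g.E1 i * g.Gn i n

def calGX (n : ℕ) : Matrix (StateIdx n0 nx) (Fin ny) ℝ :=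
  Matrix.fromRows (∑ i, g.B1 i * g.Gn i n) (Matrix.of fun p c => (g.B p.1 * g.Gn p.1 n) p.2 c)

def calHp (what : StateVec n0 nx) : Vec ny := ∑ i, g.E1 i *ᵥ g.H what i

def calHX (what : StateVec n0 nx) : StateVec n0 nx :=
  Sum.elim (∑ i, g.B1 i *ᵥ g.H what i) (fun p => (g.B p.1 *ᵥ g.H what p.1) p.2)

/-! ### The mean system; `what`, `ξhat` are the means of the disturbances -/

/-- `y` solves the infinite linear system of the means started at `X0`. -/
def IsMeanSolution (what : StateVec n0 nx) (ξhat : Vec ny) (X0 : StateVec n0 nx)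
    (y : ℕ → Vec ny) : Prop :=
  ∃ X : ℕ → StateVec n0 nx, X 0 = X0 ∧ ∀ t,
    Summable (fun n => g.calGp n *ᵥ y (t + n)) ∧
    Summable (fun n => g.calGX n *ᵥ y (t + n)) ∧
    y t = g.calD *ᵥ X t + ∑' n, g.calGp n *ᵥ y (t + n) + g.calHp what + ξhat ∧
    X (t + 1) = g.calA *ᵥ X t + ∑' n, g.calGX n *ᵥ y (t + n) + g.calHX what
      + g.calC *ᵥ y t + what

/-- `y` is a uniformly bounded solution of the mean system. -/
def IsBoundedMeanSolution (what : StateVec n0 nx) (ξhat : Vec ny) (X0 : StateVec n0 nx)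
    (y : ℕ → Vec ny) : Prop :=
  (∃ c : ℝ, ∀ t, ‖y t‖ ≤ c) ∧ g.IsMeanSolution what ξhat X0 y

/-- The bounded solution of the mean system started at `X0`. -/
def meanSolution (what : StateVec n0 nx) (ξhat : Vec ny) (X0 : StateVec n0 nx) : ℕ → Vec ny :=
  Classical.epsilon (g.IsBoundedMeanSolution what ξhat X0)

/-- The constant part `b_t` of the affine map `X0 ↦ y_t = a_t X0 + b_t`. -/
def b (what : StateVec n0 nx) (ξhat : Vec ny) (t : ℕ) : Vec ny :=
  g.meanSolution what ξhat 0 t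

/-- The linear part `a_t` of the affine map `X0 ↦ y_t = a_t X0 + b_t`, column by column. -/
def a (what : StateVec n0 nx) (ξhat : Vec ny) (t : ℕ) : Matrix (Fin ny) (StateIdx n0 nx) ℝ :=
  Matrix.of fun r c => g.meanSolution what ξhat (Pi.single c 1) t r - g.meanSolution what ξhat 0 t r

/-- `Gⁱ = ∑ₙ Gⁱₙ aₙ`. -/
def G (what : StateVec n0 nx) (ξhat : Vec ny) (i : Fin N) : Matrix (Fin (nu i)) (StateIdx n0 nx) ℝ :=
  ∑' n, g.Gn i n * g.a what ξhat n

/-- `Ȟⁱ = ∑ₙ Gⁱₙ bₙ + Hⁱ`. -/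
def checkH (what : StateVec n0 nx) (ξhat : Vec ny) (i : Fin N) : Vec (nu i) :=
  ∑' n, g.Gn i n *ᵥ g.b what ξhat n + g.H what i

/-! ### The replica process -/

/-- The replica state `X̄_t` and environment variables `(ȳ_0, …, ȳ_{t-1})`, driven by
`(X0, W, ξ)` on the probability space `(Ω, P)`. -/
def replica {Ω : Type*} [MeasurableSpace Ω] (P : Measure Ω) (what : StateVec n0 nx) (ξhat : Vec ny)
    (X0 : Ω → StateVec n0 nx) (W : ℕ → Ω → StateVec n0 nx) (ξ : ℕ → Ω → Vec ny) :
    (t : ℕ) → (Ω → StateVec n0 nx) × (Ω → Fin t → Vec ny)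
  | 0 => (X0, fun _ => Fin.elim0)
  | t + 1 =>
    let h := replica P what ξhat X0 W ξ t
    let Xhat : Ω → StateVec n0 nx := P[h.1 | MeasurableSpace.comap h.2 inferInstance]
    let y : Ω → Vec ny := fun ω =>
      g.calD *ᵥ h.1 ω + (∑' n, g.calGp n * g.a what ξhat n) *ᵥ Xhat ω
        + (∑' n, g.calGp n *ᵥ g.b what ξhat n + g.calHp what) + ξ t ω
    let X' : Ω → StateVec n0 nx := fun ω =>
      g.calA *ᵥ h.1 ω + (∑' n, g.calGX n * g.a what ξhat n) *ᵥ Xhat ω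
        + (∑' n, g.calGX n *ᵥ g.b what ξhat n + g.calHX what) + g.calC *ᵥ y ω + W t ω
    (X', fun ω => Fin.snoc (α := fun _ => Vec ny) (h.2 ω) (y ω))

/-- The replica environment variable `ȳ_t`. -/
def replicaEnv {Ω : Type*} [MeasurableSpace Ω] (P : Measure Ω) (what : StateVec n0 nx)
    (ξhat : Vec ny) (X0 : Ω → StateVec n0 nx) (W : ℕ → Ω → StateVec n0 nx) (ξ : ℕ → Ω → Vec ny)
    (t : ℕ) (ω : Ω) : Vec ny :=
  (g.replica P what ξhat X0 W ξ (t + 1)).2 ω (Fin.last t)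

/-- `est` is a state estimator: each `est t` is a measurable map sending `(ȳ_0, …, ȳ_{t-1})` to
(a version of) the conditional expectation of `X̄_t` given `(ȳ_0, …, ȳ_{t-1})`. -/
structure IsEstimator {Ω : Type*} [MeasurableSpace Ω] (P : Measure Ω) (what : StateVec n0 nx)
    (ξhat : Vec ny) (X0 : Ω → StateVec n0 nx) (W : ℕ → Ω → StateVec n0 nx) (ξ : ℕ → Ω → Vec ny)
    (est : ∀ t : ℕ, (Fin t → Vec ny) → StateVec n0 nx) : Prop where
  measurable_est : ∀ t, Measurable (est t)
  ae_eq : ∀ t, (fun ω => est t ((g.replica P what ξhat X0 W ξ t).2 ω)) =ᵐ[P]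
    P[(g.replica P what ξhat X0 W ξ t).1 |
      MeasurableSpace.comap (g.replica P what ξhat X0 W ξ t).2 inferInstance]

/-- The joint strategy `sⁱ_t = Fⁱ xⁱ_t + Gⁱ est_t(y_0, …, y_{t-1}) + Ȟⁱ`. -/
def affineProfile (what : StateVec n0 nx) (ξhat : Vec ny)
    (est : ∀ t : ℕ, (Fin t → Vec ny) → StateVec n0 nx) (hest : ∀ t, Measurable (est t)) :
    g.Profile := fun i =>
  { act := fun t p =>
      g.F i *ᵥ p.1 (Fin.last t) + g.G what ξhat i *ᵥ est t p.2.2 + g.checkH what ξhat i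
    measurable_act := fun t => by
      have h1 : Measurable fun v : Vec (nx i) => g.F i *ᵥ v :=
        (Continuous.matrix_mulVec continuous_const continuous_id).measurable
      have h2 : Measurable fun v : StateVec n0 nx => g.G what ξhat i *ᵥ v :=
        (Continuous.matrix_mulVec continuous_const continuous_id).measurable
      have h3 : Measurable fun v : Fin (t + 1) → Vec (nx i) => v (Fin.last t) :=
        measurable_pi_apply _
      exact ((h1.comp (h3.comp measurable_fst)).add
        (h2.comp ((hest t).comp (measurable_snd.comp measurable_snd)))).add_const _ }

end Game

/-- Standing assumptions on the primitive random variables: `X_0, W_0, W_1, …, ξ_0, ξ_1, …` are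
mutually independent with finite second moments, and `(W_t)`, `(ξ_t)` are each identically
distributed. -/
structure Primitives {N n0 ny : ℕ} {nx : Fin N → ℕ} {Ω : Type*} [MeasurableSpace Ω]
    (μ : Measure Ω) (X0 : Ω → StateVec n0 nx) (W : ℕ → Ω → StateVec n0 nx)
    (ξ : ℕ → Ω → Vec ny) : Prop where
  measurable_X0 : Measurable X0
  measurable_W : ∀ t, Measurable (W t)
  measurable_ξ : ∀ t, Measurable (ξ t)
  memLp_X0 : MemLp X0 2 μ
  memLp_W : ∀ t, MemLp (W t) 2 μ
  memLp_ξ : ∀ t, MemLp (ξ t) 2 μ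
  indep : iIndep (fun k : Option (ℕ ⊕ ℕ) => match k with
    | none => MeasurableSpace.comap X0 inferInstance
    | some (Sum.inl t) => MeasurableSpace.comap (W t) inferInstance
    | some (Sum.inr t) => MeasurableSpace.comap (ξ t) inferInstance) μ
  ident_W : ∀ t, IdentDistrib (W t) (W 0) μ μ
  ident_ξ : ∀ t, IdentDistrib (ξ t) (ξ 0) μ μ

end LQ

end

noncomputable section

namespace LQ

/-! ### Quadratic forms -/

section Quadratic

variable {ι κ ν : Type*} [Fintype ι] [Fintype κ] [Fintype ν]

-- Facing an exogenous environment, a player solves a linear-quadratic problem whose solution is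
-- certainty equivalent: feedback on the own state plus a weighted sum of forecasts. The mean system
-- already contains everybody's reaction to the forecasts, so forecasts taken from its bounded
-- solution are the correct ones once everybody uses them.
--
-- Beliefs. Outside a null set, the closed loop driven by the replica primitives obeys the recursion
-- of the replica (`ae_envPath_eq_replicaEnv`). The environment path is a measurable function of the
-- primitives, so its law under `μ` is that of the replica environment under `P`
-- (`envLaw_affineProfile`). Since `J` fixes the environment before averaging over the player's own
-- noise, the cost under this belief is an integral over `P.prod μ`, where environment and own noise
-- are independent (`beliefCost_eq`).
--
-- Forecasts. Conditioning the replica on its past replaces the state by its estimate and the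
-- disturbances by their means: the conditional means of the environment variable and of the next
-- estimate are `meanEnv` and `meanNext` of the current estimate. By uniqueness of bounded
-- solutions, the tail of the mean solution from `x` is the mean solution from `meanNext x`
-- (`MeanSolvable.meanSolution_meanNext`). Hence the `n`-th term of the mean solution from the
-- estimate is the conditional forecast `n` steps ahead, and its mean square is at most that of the
-- variable it forecasts.
--
-- Optimality. The value function is `x'Mx + 2x'q`, with `q = ∑ Φⁿ(F'K' + L' + ΦMC)ŷₙ + Φ(1 -
-- Φ)⁻¹Mŵ`. Completing the square in one stage leaves linear terms whose coefficients are the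
-- residuals of the costate recursion and of the first-order condition. Both residuals are linear in
-- forecast errors, hence orthogonal to whatever the player knows. There remain a nonnegative
-- square, zero for the candidate, and terms that no strategy can influence (`integral_cost_add`);
-- summation over time telescopes.
--
-- Infinite horizon. Since `M` dominates `Q`, the discounted closed loop contracts in the norm of
-- `M`, so the powers of `Φ` are summable and `q` inherits a uniform mean-square bound from the
-- environment. This bounds the candidate's terminal value from below and makes its cost finite. A
-- rival of finite cost has, by coercivity, summable discounted mean-square states, so its terminal
-- term vanishes in the limit (`tsum_lintegral_stage_le`). The matrix `M` itself exists by value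
-- iteration (`exists_riccati_solution`).

lemma dotProduct_transpose_mulVec' (A : Matrix ι κ ℝ) (x : κ → ℝ) (y : ι → ℝ) :
    x ⬝ᵥ (Aᵀ *ᵥ y) = (A *ᵥ x) ⬝ᵥ y := by
  rw [mulVec_transpose, dotProduct_comm, ← dotProduct_mulVec, dotProduct_comm]

lemma dotProduct_mulVec_comm {M : Matrix ι ι ℝ} (hM : Mᵀ = M) (x y : ι → ℝ) :
    x ⬝ᵥ (M *ᵥ y) = y ⬝ᵥ (M *ᵥ x) := by
  conv_lhs => rw [← hM]
  rw [dotProduct_transpose_mulVec', dotProduct_comm]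

lemma dotProduct_self_nonneg' (x : ι → ℝ) : 0 ≤ x ⬝ᵥ x :=
  Finset.sum_nonneg fun i _ => mul_self_nonneg (x i)

lemma sq_le_dotProduct_self (x : ι → ℝ) (i : ι) : x i ^ 2 ≤ x ⬝ᵥ x := by
  rw [pow_two]
  exact Finset.single_le_sum (f := fun i => x i * x i) (fun j _ => mul_self_nonneg (x j))
    (Finset.mem_univ i)

lemma two_mul_dotProduct_le (x y : ι → ℝ) : 2 * (x ⬝ᵥ y) ≤ x ⬝ᵥ x + y ⬝ᵥ y := by
  have := dotProduct_self_nonneg' (x - y)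
  simp only [sub_dotProduct, dotProduct_sub, dotProduct_comm y x] at this
  linarith

lemma two_mul_dotProduct_le_weighted {c : ℝ} (hc : 0 < c) (x y : ι → ℝ) :
    2 * (x ⬝ᵥ y) ≤ c * (x ⬝ᵥ x) + c⁻¹ * (y ⬝ᵥ y) := by
  have h := dotProduct_self_nonneg' (c • x - y)
  simp only [sub_dotProduct, dotProduct_sub, dotProduct_comm y, smul_dotProduct, dotProduct_smul,
    smul_eq_mul] at h
  have h2 : 0 ≤ c⁻¹ * (c * (c * x ⬝ᵥ x - x ⬝ᵥ y) - (c * x ⬝ᵥ y - y ⬝ᵥ y)) :=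
    mul_nonneg (inv_pos.2 hc).le h
  have h3 : c⁻¹ * (c * (c * x ⬝ᵥ x - x ⬝ᵥ y) - (c * x ⬝ᵥ y - y ⬝ᵥ y)) =
      c * (x ⬝ᵥ x) + c⁻¹ * (y ⬝ᵥ y) - 2 * (x ⬝ᵥ y) := by
    field_simp
    ring
  linarith

lemma dotProduct_self_add_le (x y : ι → ℝ) :
    (x + y) ⬝ᵥ (x + y) ≤ 2 * (x ⬝ᵥ x) + 2 * (y ⬝ᵥ y) := by
  have := two_mul_dotProduct_le x y
  simp only [add_dotProduct, dotProduct_add, dotProduct_comm y x]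
  linarith

lemma exists_dotProduct_mulVec_self_le (A : Matrix ι κ ℝ) :
    ∃ c : ℝ, 0 < c ∧ ∀ x : κ → ℝ, (A *ᵥ x) ⬝ᵥ (A *ᵥ x) ≤ c * (x ⬝ᵥ x) := by
  -- Cauchy–Schwarz in each row gives the squared Frobenius norm; the 1 keeps the constant positive
  -- when `A = 0`.
  refine ⟨∑ i, ∑ j, A i j ^ 2 + 1, ?_, fun x => ?_⟩
  · have : 0 ≤ ∑ i, ∑ j, A i j ^ 2 :=
      Finset.sum_nonneg fun i _ => Finset.sum_nonneg fun j _ => sq_nonneg _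
    linarith
  · have h : (A *ᵥ x) ⬝ᵥ (A *ᵥ x) ≤ (∑ i, ∑ j, A i j ^ 2) * (x ⬝ᵥ x) := by
      rw [Finset.sum_mul]
      refine Finset.sum_le_sum fun i _ => ?_
      have := Finset.sum_mul_sq_le_sq_mul_sq Finset.univ (fun j => A i j) x
      simp only [mulVec, dotProduct]
      simpa [pow_two] using this
    nlinarith [dotProduct_self_nonneg' x]

lemma exists_quadForm_le (A : Matrix ι ι ℝ) :
    ∃ c : ℝ, 0 < c ∧ ∀ x : ι → ℝ, x ⬝ᵥ (A *ᵥ x) ≤ c * (x ⬝ᵥ x) := by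
  obtain ⟨c, hc, h⟩ := exists_dotProduct_mulVec_self_le A
  refine ⟨1 + c, by linarith, fun x => ?_⟩
  have h1 := two_mul_dotProduct_le x (A *ᵥ x)
  have h2 := h x
  nlinarith [dotProduct_self_nonneg' x, dotProduct_self_nonneg' (A *ᵥ x)]

omit [Fintype ι] in
lemma transpose_eq_of_posSemidef {M : Matrix ι ι ℝ} (hM : M.PosSemidef) : Mᵀ = M := by
  have := hM.isHermitian
  rwa [IsHermitian, conjTranspose_eq_transpose_of_trivial] at this

lemma quadForm_nonneg {M : Matrix ι ι ℝ} (hM : M.PosSemidef) (x : ι → ℝ) :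
    0 ≤ x ⬝ᵥ (M *ᵥ x) := by
  simpa using hM.dotProduct_mulVec_nonneg x

lemma posSemidef_of_quadForm {M : Matrix ι ι ℝ} (hs : Mᵀ = M) (h : ∀ x, 0 ≤ x ⬝ᵥ (M *ᵥ x)) :
    M.PosSemidef :=
  PosSemidef.of_dotProduct_mulVec_nonneg
    (by rwa [IsHermitian, conjTranspose_eq_transpose_of_trivial]) (by simpa using h)

/-- Nonnegativity of the form at `x - c⁻¹Q⁻¹x` reads `x'Qx ≥ 2c⁻¹x'x - c⁻²x'Q⁻¹x`. With `c` an upper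
bound for the form of `Q⁻¹`, the right side is at least `c⁻¹x'x`; no eigenvalues are needed. -/
lemma exists_le_quadForm_of_posDef [DecidableEq ι] {Q : Matrix ι ι ℝ} (hQ : Q.PosDef) :
    ∃ ε : ℝ, 0 < ε ∧ ∀ x : ι → ℝ, ε * (x ⬝ᵥ x) ≤ x ⬝ᵥ (Q *ᵥ x) := by
  obtain ⟨c, hc, h⟩ := exists_quadForm_le Q⁻¹
  have hs := transpose_eq_of_posSemidef hQ.posSemidef
  have hdet : IsUnit Q.det := (isUnit_iff_isUnit_det Q).1 hQ.isUnit
  refine ⟨c⁻¹, inv_pos.2 hc, fun x => ?_⟩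
  have h1 := quadForm_nonneg hQ.posSemidef (x - c⁻¹ • (Q⁻¹ *ᵥ x))
  have h2 : Q *ᵥ (Q⁻¹ *ᵥ x) = x := by
    rw [mulVec_mulVec, mul_nonsing_inv _ hdet, one_mulVec]
  have h3 : (Q⁻¹ *ᵥ x) ⬝ᵥ (Q *ᵥ x) = x ⬝ᵥ x := by
    rw [dotProduct_mulVec_comm hs, h2]
  simp only [mulVec_sub, mulVec_smul, h2, sub_dotProduct, dotProduct_sub, smul_dotProduct,
    dotProduct_smul, smul_eq_mul, h3, dotProduct_comm _ x] at h1
  have h4 : c⁻¹ * (c⁻¹ * (x ⬝ᵥ (Q⁻¹ *ᵥ x))) ≤ c⁻¹ * (c⁻¹ * (c * (x ⬝ᵥ x))) := by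
    have := h x
    have hc' := (inv_pos.2 hc).le
    gcongr
  have h5 : c⁻¹ * (c⁻¹ * (c * (x ⬝ᵥ x))) = c⁻¹ * (x ⬝ᵥ x) := by field_simp
  linarith

/-- Completing the square in one step of the linear-quadratic problem. -/
lemma lq_stage_identity {A : Matrix ι ι ℝ} {B : Matrix ι κ ℝ} {Q M : Matrix ι ι ℝ}
    {R S : Matrix κ κ ℝ} {F : Matrix κ ι ℝ} {β : ℝ} (K : Matrix ν κ ℝ) (L : Matrix ν ι ℝ)
    (hM : Mᵀ = M) (hR : Rᵀ = R) (hS : S = R + β • (Bᵀ * M * B))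
    (hF : S * F = -(β • (Bᵀ * M * A))) (x η q : ι → ℝ) (ρ : κ → ℝ) (z : ν → ℝ) :
    x ⬝ᵥ (Q *ᵥ x) + (F *ᵥ x + ρ) ⬝ᵥ (R *ᵥ (F *ᵥ x + ρ))
        + 2 * (z ⬝ᵥ (K *ᵥ (F *ᵥ x + ρ) + L *ᵥ x))
        + β * ((A *ᵥ x + B *ᵥ (F *ᵥ x + ρ) + η) ⬝ᵥ (M *ᵥ (A *ᵥ x + B *ᵥ (F *ᵥ x + ρ) + η))
          + 2 * ((A *ᵥ x + B *ᵥ (F *ᵥ x + ρ) + η) ⬝ᵥ q))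
      = x ⬝ᵥ ((Q + β • (Aᵀ * M * A) - Fᵀ * S * F) *ᵥ x)
        + 2 * (x ⬝ᵥ (Lᵀ *ᵥ z + Fᵀ *ᵥ (Kᵀ *ᵥ z) + (β • (A + B * F)ᵀ) *ᵥ (M *ᵥ η + q)))
        + ρ ⬝ᵥ (S *ᵥ ρ) + 2 * (ρ ⬝ᵥ (Kᵀ *ᵥ z + β • (Bᵀ *ᵥ (M *ᵥ η + q))))
        + β * (η ⬝ᵥ (M *ᵥ η) + 2 * (η ⬝ᵥ q)) := by
  -- The normal equation `hF` paired with an arbitrary input. With `v = ρ` it removes the terms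
  -- bilinear in `ρ` and `x`; with `v = Fx` it turns the terms in `x` alone into `-F'SF`.
  have key : ∀ v : κ → ℝ, v ⬝ᵥ (R *ᵥ (F *ᵥ x)) + β * ((B *ᵥ v) ⬝ᵥ (M *ᵥ (B *ᵥ (F *ᵥ x)))) =
      -(β * ((B *ᵥ v) ⬝ᵥ (M *ᵥ (A *ᵥ x)))) := by
    intro v
    have := congrArg (fun T => v ⬝ᵥ (T *ᵥ x)) hF
    simpa only [hS, add_mul, add_mulVec, smul_mulVec, smul_mul_assoc, neg_mulVec,
      ← mulVec_mulVec, dotProduct_add, dotProduct_smul, dotProduct_neg, smul_eq_mul,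
      dotProduct_transpose_mulVec'] using this
  have k1 := key (F *ᵥ x)
  have k2 := key ρ
  have c1 : x ⬝ᵥ (Lᵀ *ᵥ z) = z ⬝ᵥ (L *ᵥ x) := by
    rw [dotProduct_transpose_mulVec', dotProduct_comm]
  have c2 : x ⬝ᵥ (Fᵀ *ᵥ (Kᵀ *ᵥ z)) = z ⬝ᵥ (K *ᵥ (F *ᵥ x)) := by
    rw [dotProduct_transpose_mulVec', dotProduct_transpose_mulVec', dotProduct_comm]
  have c3 : ρ ⬝ᵥ (Kᵀ *ᵥ z) = z ⬝ᵥ (K *ᵥ ρ) := by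
    rw [dotProduct_transpose_mulVec', dotProduct_comm]
  have hN : x ⬝ᵥ ((Q + β • (Aᵀ * M * A) - Fᵀ * S * F) *ᵥ x) = x ⬝ᵥ (Q *ᵥ x)
      + β * ((A *ᵥ x) ⬝ᵥ (M *ᵥ (A *ᵥ x))) - (F *ᵥ x) ⬝ᵥ (S *ᵥ (F *ᵥ x)) := by
    simp only [sub_mulVec, add_mulVec, smul_mulVec, ← mulVec_mulVec, dotProduct_add,
      dotProduct_sub, dotProduct_smul, smul_eq_mul, dotProduct_transpose_mulVec']
  have hSv : ∀ v : κ → ℝ, v ⬝ᵥ (S *ᵥ v) = v ⬝ᵥ (R *ᵥ v) + β * ((B *ᵥ v) ⬝ᵥ (M *ᵥ (B *ᵥ v))) := by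
    intro v
    simp only [hS, add_mulVec, smul_mulVec, ← mulVec_mulVec, dotProduct_add,
      dotProduct_smul, smul_eq_mul, dotProduct_transpose_mulVec']
  have hP : ∀ v : ι → ℝ, x ⬝ᵥ ((β • (A + B * F)ᵀ) *ᵥ v) =
      β * ((A *ᵥ x) ⬝ᵥ v + (B *ᵥ (F *ᵥ x)) ⬝ᵥ v) := by
    intro v
    simp only [smul_mulVec, dotProduct_smul, dotProduct_transpose_mulVec', add_mulVec,
      ← mulVec_mulVec, add_dotProduct, smul_eq_mul]
  rw [hN, hSv, hSv]
  simp only [dotProduct_add x, hP, dotProduct_add ρ, dotProduct_smul, dotProduct_transpose_mulVec' B,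
    c1, c2, c3, smul_eq_mul]
  simp only [mulVec_add, dotProduct_add, add_dotProduct]
  rw [dotProduct_mulVec_comm hM (B *ᵥ (F *ᵥ x)) (B *ᵥ ρ),
    dotProduct_mulVec_comm hM (B *ᵥ (F *ᵥ x)) (A *ᵥ x),
    dotProduct_mulVec_comm hM η (A *ᵥ x), dotProduct_mulVec_comm hM η (B *ᵥ ρ),
    dotProduct_mulVec_comm hM η (B *ᵥ (F *ᵥ x)),
    dotProduct_mulVec_comm hR (F *ᵥ x) ρ]
  rw [dotProduct_mulVec_comm hM (B *ᵥ (F *ᵥ x)) (A *ᵥ x)] at k1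
  rw [dotProduct_mulVec_comm hM (B *ᵥ ρ) (A *ᵥ x)] at k2 ⊢
  linear_combination 2 * k1 + 2 * k2

end Quadratic

/-! ### The algebraic Riccati equation -/

section Riccati

variable {m k : ℕ}

/-- `S = R + β B' P B`. -/
def inputWeight (B : Matrix (Fin m) (Fin k) ℝ) (R : Matrix (Fin k) (Fin k) ℝ) (β : ℝ)
    (P : Matrix (Fin m) (Fin m) ℝ) : Matrix (Fin k) (Fin k) ℝ :=
  R + β • (Bᵀ * P * B)

/-- The minimizing feedback for the continuation cost `x' P x`. -/
def feedback (A : Matrix (Fin m) (Fin m) ℝ) (B : Matrix (Fin m) (Fin k) ℝ)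
    (R : Matrix (Fin k) (Fin k) ℝ) (β : ℝ) (P : Matrix (Fin m) (Fin m) ℝ) :
    Matrix (Fin k) (Fin m) ℝ :=
  -(β • ((inputWeight B R β P)⁻¹ * Bᵀ * P * A))

/-- The right hand side of the algebraic Riccati equation. -/
def riccatiMap (A : Matrix (Fin m) (Fin m) ℝ) (B : Matrix (Fin m) (Fin k) ℝ)
    (Q : Matrix (Fin m) (Fin m) ℝ) (R : Matrix (Fin k) (Fin k) ℝ) (β : ℝ)
    (P : Matrix (Fin m) (Fin m) ℝ) : Matrix (Fin m) (Fin m) ℝ :=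
  Q + β • (Aᵀ * (P - β • (P * B * (inputWeight B R β P)⁻¹ * Bᵀ * P)) * A)

variable {A : Matrix (Fin m) (Fin m) ℝ} {B : Matrix (Fin m) (Fin k) ℝ}
  {Q P : Matrix (Fin m) (Fin m) ℝ} {R : Matrix (Fin k) (Fin k) ℝ} {β : ℝ}

lemma posDef_inputWeight (hR : R.PosDef) (hβ : 0 ≤ β) (hP : P.PosSemidef) :
    (inputWeight B R β P).PosDef := by
  have h := (hP.conjTranspose_mul_mul_same B).smul hβ
  rw [conjTranspose_eq_transpose_of_trivial] at h
  exact hR.add_posSemidef h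

lemma isUnit_det_inputWeight (hR : R.PosDef) (hβ : 0 ≤ β) (hP : P.PosSemidef) :
    IsUnit (inputWeight B R β P).det :=
  (isUnit_iff_isUnit_det _).1 (posDef_inputWeight hR hβ hP).isUnit

lemma inputWeight_mul_feedback (hR : R.PosDef) (hβ : 0 ≤ β) (hP : P.PosSemidef) :
    inputWeight B R β P * feedback A B R β P = -(β • (Bᵀ * P * A)) := by
  have h := isUnit_det_inputWeight (B := B) hR hβ hP
  rw [feedback, Matrix.mul_neg, Matrix.mul_smul, Matrix.mul_assoc, Matrix.mul_assoc,
    ← Matrix.mul_assoc (inputWeight B R β P), mul_nonsing_inv _ h, Matrix.one_mul,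
    ← Matrix.mul_assoc]

lemma riccatiMap_eq (hR : R.PosDef) (hβ : 0 ≤ β) (hP : P.PosSemidef) :
    riccatiMap A B Q R β P = Q + β • (Aᵀ * P * A)
      - (feedback A B R β P)ᵀ * inputWeight B R β P * feedback A B R β P := by
  have hS := transpose_eq_of_posSemidef (posDef_inputWeight (B := B) hR hβ hP).posSemidef
  rw [Matrix.mul_assoc _ _ (feedback A B R β P), inputWeight_mul_feedback hR hβ hP, riccatiMap,
    feedback]
  simp only [transpose_neg, transpose_smul, transpose_mul, transpose_transpose,
    transpose_nonsing_inv, hS, transpose_eq_of_posSemidef hP, Matrix.mul_sub, Matrix.sub_mul,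
    Matrix.mul_smul, Matrix.smul_mul, Matrix.mul_assoc, Matrix.neg_mul, Matrix.mul_neg, smul_neg,
    neg_neg, smul_sub, add_sub_assoc]

lemma riccati_completion (hR : R.PosDef) (hβ : 0 ≤ β) (hP : P.PosSemidef)
    (x : Fin m → ℝ) (u : Fin k → ℝ) :
    x ⬝ᵥ (Q *ᵥ x) + u ⬝ᵥ (R *ᵥ u) + β * ((A *ᵥ x + B *ᵥ u) ⬝ᵥ (P *ᵥ (A *ᵥ x + B *ᵥ u))) =
      x ⬝ᵥ (riccatiMap A B Q R β P *ᵥ x) + (u - feedback A B R β P *ᵥ x) ⬝ᵥ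
        (inputWeight B R β P *ᵥ (u - feedback A B R β P *ᵥ x)) := by
  -- An empty environment, no disturbance and no linear term reduce the stage identity to the pure
  -- regulator.
  have h := lq_stage_identity (ν := Fin 0) (Q := Q) (S := inputWeight B R β P) 0 0
    (transpose_eq_of_posSemidef hP) (transpose_eq_of_posSemidef hR.posSemidef) rfl
    (inputWeight_mul_feedback (A := A) hR hβ hP) x 0 0 (u - feedback A B R β P *ᵥ x) 0
  rw [riccatiMap_eq hR hβ hP]
  simpa using h

lemma riccatiMap_le (hR : R.PosDef) (hβ : 0 ≤ β) (hP : P.PosSemidef)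
    (x : Fin m → ℝ) (u : Fin k → ℝ) :
    x ⬝ᵥ (riccatiMap A B Q R β P *ᵥ x) ≤
      x ⬝ᵥ (Q *ᵥ x) + u ⬝ᵥ (R *ᵥ u) +
        β * ((A *ᵥ x + B *ᵥ u) ⬝ᵥ (P *ᵥ (A *ᵥ x + B *ᵥ u))) := by
  rw [riccati_completion hR hβ hP]
  linarith [quadForm_nonneg (posDef_inputWeight (B := B) hR hβ hP).posSemidef
    (u - feedback A B R β P *ᵥ x)]

lemma riccatiMap_feedback (hR : R.PosDef) (hβ : 0 ≤ β) (hP : P.PosSemidef) (x : Fin m → ℝ) :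
    x ⬝ᵥ (riccatiMap A B Q R β P *ᵥ x) =
      x ⬝ᵥ (Q *ᵥ x) + (feedback A B R β P *ᵥ x) ⬝ᵥ (R *ᵥ (feedback A B R β P *ᵥ x)) +
        β * ((A *ᵥ x + B *ᵥ (feedback A B R β P *ᵥ x)) ⬝ᵥ
          (P *ᵥ (A *ᵥ x + B *ᵥ (feedback A B R β P *ᵥ x)))) := by
  rw [riccati_completion hR hβ hP]
  simp

lemma transpose_riccatiMap (hQ : Q.PosDef) (hR : R.PosDef) (hβ : 0 ≤ β) (hP : P.PosSemidef) :
    (riccatiMap A B Q R β P)ᵀ = riccatiMap A B Q R β P := by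
  have hS := transpose_eq_of_posSemidef (posDef_inputWeight (B := B) hR hβ hP).posSemidef
  rw [riccatiMap_eq hR hβ hP]
  simp only [transpose_sub, transpose_add, transpose_smul, transpose_mul, transpose_transpose, hS,
    transpose_eq_of_posSemidef hP, transpose_eq_of_posSemidef hQ.posSemidef, Matrix.mul_assoc]

lemma posSemidef_riccatiMap (hQ : Q.PosDef) (hR : R.PosDef) (hβ : 0 ≤ β) (hP : P.PosSemidef) :
    (riccatiMap A B Q R β P).PosSemidef := by
  refine posSemidef_of_quadForm (transpose_riccatiMap hQ hR hβ hP) fun x => ?_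
  rw [riccatiMap_feedback hR hβ hP]
  have h1 := quadForm_nonneg hQ.posSemidef x
  have h2 := quadForm_nonneg hR.posSemidef (feedback A B R β P *ᵥ x)
  have h3 := quadForm_nonneg hP (A *ᵥ x + B *ᵥ (feedback A B R β P *ᵥ x))
  positivity

/-- The Riccati map at `x` is the minimum over inputs of stage cost plus continuation
(`riccatiMap_le`, `riccatiMap_feedback`). Inserting the minimizer for `P'` into the problem for `P`
gives the comparison. -/
lemma riccatiMap_mono (hR : R.PosDef) (hβ : 0 ≤ β) {P' : Matrix (Fin m) (Fin m) ℝ}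
    (hP : P.PosSemidef) (hP' : P'.PosSemidef) (h : ∀ x, x ⬝ᵥ (P *ᵥ x) ≤ x ⬝ᵥ (P' *ᵥ x))
    (x : Fin m → ℝ) :
    x ⬝ᵥ (riccatiMap A B Q R β P *ᵥ x) ≤ x ⬝ᵥ (riccatiMap A B Q R β P' *ᵥ x) := by
  rw [riccatiMap_feedback hR hβ hP']
  refine (riccatiMap_le hR hβ hP x (feedback A B R β P' *ᵥ x)).trans ?_
  have := h (A *ᵥ x + B *ᵥ (feedback A B R β P' *ᵥ x))
  gcongr

-- Gelfand's formula: the roots of the norms of the powers tend to a spectral radius below 1, so all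
-- but finitely many powers have norm at most 1, and the sum of the remaining norms covers the rest.
attribute [local instance] Matrix.linftyOpNormedRing Matrix.linftyOpNormedAlgebra in
lemma exists_bound_pow_of_isStable (hA : IsStable A) :
    ∃ c : ℝ, ∀ n i j, |(A ^ n) i j| ≤ c := by
  -- In dimension zero the matrix ring is trivial and the spectrum empty, so the spectral argument
  -- is kept to `m > 0`.
  rcases Nat.eq_zero_or_pos m with rfl | hm
  · exact ⟨0, fun n i => i.elim0⟩
  have : Nonempty (Fin m) := ⟨⟨0, hm⟩⟩
  set Ac : Matrix (Fin m) (Fin m) ℂ := A.map (algebraMap ℝ ℂ) with hAc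
  have hpow : ∀ n i j, ((A ^ n) i j : ℂ) = (Ac ^ n) i j := by
    intro n i j
    have : (A ^ n).map (algebraMap ℝ ℂ) = Ac ^ n := by
      rw [hAc, ← RingHom.mapMatrix_apply, map_pow, RingHom.mapMatrix_apply]
    rw [← this]; rfl
  have hρ : spectralRadius ℂ Ac < ((1 : NNReal) : ℝ≥0∞) :=
    spectrum.spectralRadius_lt_of_forall_lt Ac (r := 1) fun z hz => by
      have := hA z hz
      rw [← NNReal.coe_lt_coe]; simpa using this
  have hlim := spectrum.pow_nnnorm_pow_one_div_tendsto_nhds_spectralRadius Ac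
  have hev : ∀ᶠ n : ℕ in Filter.atTop, ‖Ac ^ n‖ ≤ 1 := by
    filter_upwards [hlim.eventually_lt_const hρ, Filter.eventually_gt_atTop 0] with n hn hn0
    by_contra hcon
    push Not at hcon
    have h1 : (1 : ℝ≥0∞) ≤ (‖Ac ^ n‖₊ : ℝ≥0∞) := by
      rw [← ENNReal.coe_one, ENNReal.coe_le_coe, ← NNReal.coe_le_coe]
      simpa using hcon.le
    exact absurd hn (not_lt.2 (by simpa using ENNReal.one_le_rpow h1 (by positivity)))
  obtain ⟨n₀, hn₀⟩ := Filter.eventually_atTop.1 hev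
  have hb : ∀ n, ‖Ac ^ n‖ ≤ 1 + ∑ l ∈ Finset.range n₀, ‖Ac ^ l‖ := by
    intro n
    rcases le_or_gt n₀ n with h | h
    · have := hn₀ n h
      have h2 : 0 ≤ ∑ l ∈ Finset.range n₀, ‖Ac ^ l‖ := Finset.sum_nonneg fun _ _ => norm_nonneg _
      linarith
    · have := Finset.single_le_sum (f := fun l => ‖Ac ^ l‖) (fun _ _ => norm_nonneg _)
        (Finset.mem_range.2 h)
      linarith
  refine ⟨_, fun n i j => le_trans ?_ (hb n)⟩
  have h1 : |(A ^ n) i j| = ‖(Ac ^ n) i j‖ := by rw [← hpow]; simp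
  rw [h1]
  have h2 : ‖(Ac ^ n) i j‖ ≤ ∑ j, ‖(Ac ^ n) i j‖ :=
    Finset.single_le_sum (f := fun j => ‖(Ac ^ n) i j‖) (fun _ _ => norm_nonneg _)
      (Finset.mem_univ j)
  refine h2.trans ?_
  rw [Matrix.linfty_opNorm_def]
  have := Finset.le_sup (f := fun i => ∑ j, ‖(Ac ^ n) i j‖₊) (Finset.mem_univ i)
  have h3 := NNReal.coe_le_coe.2 this
  push_cast at h3
  exact h3

lemma exists_dotProduct_pow_mulVec_le (hA : IsStable A) :
    ∃ c : ℝ, 0 ≤ c ∧ ∀ n (x : Fin m → ℝ), (A ^ n *ᵥ x) ⬝ᵥ (A ^ n *ᵥ x) ≤ c * (x ⬝ᵥ x) := by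
  obtain ⟨c, hc⟩ := exists_bound_pow_of_isStable hA
  refine ⟨∑ _i : Fin m, ∑ _j : Fin m, c ^ 2, by positivity, fun n x => ?_⟩
  rw [Finset.sum_mul]
  refine Finset.sum_le_sum fun i _ => ?_
  have h1 := Finset.sum_mul_sq_le_sq_mul_sq Finset.univ (fun j => (A ^ n) i j) x
  have h2 : ∑ j, (A ^ n) i j ^ 2 ≤ ∑ _j : Fin m, c ^ 2 :=
    Finset.sum_le_sum fun j _ => sq_le_sq' (neg_le_of_abs_le (hc n i j)) (le_of_abs_le (hc n i j))
  have h3 : 0 ≤ x ⬝ᵥ x := dotProduct_self_nonneg' x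
  calc (A ^ n *ᵥ x) i * (A ^ n *ᵥ x) i = (∑ j, (A ^ n) i j * x j) ^ 2 := by
        simp only [mulVec, dotProduct, pow_two]
    _ ≤ (∑ j, (A ^ n) i j ^ 2) * ∑ j, x j ^ 2 := h1
    _ = (∑ j, (A ^ n) i j ^ 2) * (x ⬝ᵥ x) := by simp only [dotProduct, pow_two]
    _ ≤ _ := mul_le_mul_of_nonneg_right h2 h3

/-- Value iteration for the algebraic Riccati equation. -/
def riccatiIter (A : Matrix (Fin m) (Fin m) ℝ) (B : Matrix (Fin m) (Fin k) ℝ)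
    (Q : Matrix (Fin m) (Fin m) ℝ) (R : Matrix (Fin k) (Fin k) ℝ) (β : ℝ) :
    ℕ → Matrix (Fin m) (Fin m) ℝ
  | 0 => 0
  | n + 1 => riccatiMap A B Q R β (riccatiIter A B Q R β n)

lemma posSemidef_riccatiIter (hQ : Q.PosDef) (hR : R.PosDef) (hβ : 0 ≤ β) (n : ℕ) :
    (riccatiIter A B Q R β n).PosSemidef := by
  induction n with
  | zero => exact PosSemidef.zero
  | succ n ih => exact posSemidef_riccatiMap hQ hR hβ ih

lemma monotone_riccatiIter (hQ : Q.PosDef) (hR : R.PosDef) (hβ : 0 ≤ β) (x : Fin m → ℝ) :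
    Monotone fun n => x ⬝ᵥ (riccatiIter A B Q R β n *ᵥ x) := by
  refine monotone_nat_of_le_succ fun n => ?_
  induction n generalizing x with
  | zero =>
    simpa [riccatiIter] using
      quadForm_nonneg (posSemidef_riccatiIter (A := A) (B := B) hQ hR hβ 1) x
  | succ n ih =>
    exact riccatiMap_mono hR hβ (posSemidef_riccatiIter hQ hR hβ n)
      (posSemidef_riccatiIter hQ hR hβ (n + 1)) ih x

/-- The iterate is the optimal cost over `n` stages without terminal cost, so every fixed linear
feedback gives an upper bound. -/
lemma riccatiIter_le_sum (hQ : Q.PosDef) (hR : R.PosDef) (hβ : 0 ≤ β)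
    (F : Matrix (Fin k) (Fin m) ℝ) (n : ℕ) (x : Fin m → ℝ) :
    x ⬝ᵥ (riccatiIter A B Q R β n *ᵥ x) ≤ ∑ t ∈ Finset.range n, β ^ t *
      (((A + B * F) ^ t *ᵥ x) ⬝ᵥ ((Q + Fᵀ * R * F) *ᵥ ((A + B * F) ^ t *ᵥ x))) := by
  induction n generalizing x with
  | zero => simp [riccatiIter]
  | succ n ih =>
    have h1 := riccatiMap_le (A := A) (B := B) (Q := Q) hR hβ
      (posSemidef_riccatiIter (A := A) (B := B) hQ hR hβ n) x (F *ᵥ x)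
    have h2 : A *ᵥ x + B *ᵥ (F *ᵥ x) = (A + B * F) *ᵥ x := by
      rw [add_mulVec, mulVec_mulVec]
    have h3 : x ⬝ᵥ (Q *ᵥ x) + (F *ᵥ x) ⬝ᵥ (R *ᵥ (F *ᵥ x)) = x ⬝ᵥ ((Q + Fᵀ * R * F) *ᵥ x) := by
      simp only [add_mulVec, ← mulVec_mulVec, dotProduct_add, dotProduct_transpose_mulVec']
    rw [h2, h3] at h1
    refine h1.trans ?_
    rw [Finset.sum_range_succ', add_comm]
    refine add_le_add ?_ (by simp)
    refine (mul_le_mul_of_nonneg_left (ih ((A + B * F) *ᵥ x)) hβ).trans (le_of_eq ?_)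
    rw [Finset.mul_sum]
    refine Finset.sum_congr rfl fun t _ => ?_
    rw [mulVec_mulVec, ← pow_succ, pow_succ β]
    ring

/-- Along a stabilizing feedback the powers are bounded, and discounting makes the series geometric;
decay of the powers is not needed. -/
lemma exists_bound_riccatiIter (hAB : IsStabilizable A B) (hQ : Q.PosDef) (hR : R.PosDef)
    (hβ : 0 ≤ β) (hβ1 : β < 1) (x : Fin m → ℝ) :
    ∃ c : ℝ, ∀ n, x ⬝ᵥ (riccatiIter A B Q R β n *ᵥ x) ≤ c := by
  obtain ⟨F, hF⟩ := hAB
  obtain ⟨c, hc, h⟩ := exists_dotProduct_pow_mulVec_le hF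
  obtain ⟨d, hd, h'⟩ := exists_quadForm_le (Q + Fᵀ * R * F)
  refine ⟨(1 - β)⁻¹ * (d * (c * (x ⬝ᵥ x))), fun n => (riccatiIter_le_sum hQ hR hβ F n x).trans ?_⟩
  have hx := dotProduct_self_nonneg' x
  calc _ ≤ ∑ t ∈ Finset.range n, β ^ t * (d * (c * (x ⬝ᵥ x))) := by
        refine Finset.sum_le_sum fun t _ => mul_le_mul_of_nonneg_left ?_ (by positivity)
        exact (h' _).trans (mul_le_mul_of_nonneg_left (h t x) hd.le)
    _ = (∑ t ∈ Finset.range n, β ^ t) * (d * (c * (x ⬝ᵥ x))) := by rw [Finset.sum_mul]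
    _ ≤ _ := by
        refine mul_le_mul_of_nonneg_right ?_ (by positivity)
        rw [← tsum_geometric_of_lt_one hβ hβ1]
        exact (summable_geometric_of_lt_one hβ hβ1).sum_le_tsum _ fun t _ => by positivity

lemma tendsto_matrix_mul {ι κ ν : Type*} [Fintype κ] {M : ℕ → Matrix ι κ ℝ} {M' : Matrix ι κ ℝ}
    {L : ℕ → Matrix κ ν ℝ} {L' : Matrix κ ν ℝ} (hM : Filter.Tendsto M Filter.atTop (nhds M'))
    (hL : Filter.Tendsto L Filter.atTop (nhds L')) :
    Filter.Tendsto (fun n => M n * L n) Filter.atTop (nhds (M' * L')) :=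
  ((Continuous.matrix_mul continuous_fst continuous_snd).tendsto (M', L')).comp
    (hM.prodMk_nhds hL)

lemma tendsto_inv_of_isUnit_det {M : ℕ → Matrix (Fin k) (Fin k) ℝ} {M' : Matrix (Fin k) (Fin k) ℝ}
    (h : Filter.Tendsto M Filter.atTop (nhds M')) (hM' : IsUnit M'.det) :
    Filter.Tendsto (fun n => (M n)⁻¹) Filter.atTop (nhds M'⁻¹) := by
  simp only [Matrix.inv_def, Ring.inverse_eq_inv']
  have hdet : Filter.Tendsto (fun n => (M n).det) Filter.atTop (nhds M'.det) :=
    ((continuous_id.matrix_det).tendsto M').comp h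
  have hadj : Filter.Tendsto (fun n => (M n).adjugate) Filter.atTop (nhds M'.adjugate) :=
    ((continuous_id.matrix_adjugate).tendsto M').comp h
  exact (hdet.inv₀ hM'.ne_zero).smul hadj

/-- A stabilizable discounted linear-quadratic regulator has a positive semidefinite solution of
its algebraic Riccati equation. -/
theorem exists_riccati_solution (hAB : IsStabilizable A B) (hQ : Q.PosDef) (hR : R.PosDef)
    (hβ : 0 ≤ β) (hβ1 : β < 1) :
    ∃ P : Matrix (Fin m) (Fin m) ℝ, P.PosSemidef ∧ P = riccatiMap A B Q R β P := by
  set T := riccatiIter A B Q R β with hT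
  have hpsd : ∀ n, (T n).PosSemidef := posSemidef_riccatiIter hQ hR hβ
  have hq : ∀ x : Fin m → ℝ, ∃ l, Filter.Tendsto (fun n => x ⬝ᵥ (T n *ᵥ x)) Filter.atTop (nhds l) := by
    intro x
    obtain ⟨c, hc⟩ := exists_bound_riccatiIter hAB hQ hR hβ hβ1 x
    exact ⟨_, tendsto_atTop_ciSup (monotone_riccatiIter hQ hR hβ x)
      ⟨c, by rintro _ ⟨n, rfl⟩; exact hc n⟩⟩
  -- Polarization: for a symmetric matrix each entry is half of a combination of three values of the
  -- quadratic form, and those converge.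
  have hentry : ∀ i j, ∃ l, Filter.Tendsto (fun n => T n i j) Filter.atTop (nhds l) := by
    intro i j
    obtain ⟨l1, h1⟩ := hq (Pi.single i 1 + Pi.single j 1)
    obtain ⟨l2, h2⟩ := hq (Pi.single i 1)
    obtain ⟨l3, h3⟩ := hq (Pi.single j 1)
    refine ⟨(l1 - l2 - l3) / 2, ((h1.sub h2).sub h3 |>.div_const 2).congr fun n => ?_⟩
    have hs : T n j i = T n i j := by
      conv_lhs => rw [← transpose_eq_of_posSemidef (hpsd n)]
      rfl
    simp only [mulVec_add, add_dotProduct, dotProduct_add, single_one_dotProduct, mulVec_single_one,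
      Matrix.col_apply, hs]
    ring
  choose P hP using hentry
  have hlim : Filter.Tendsto T Filter.atTop (nhds (Matrix.of P)) :=
    tendsto_pi_nhds.2 fun i => tendsto_pi_nhds.2 fun j => hP i j
  have hPs : (Matrix.of P).PosSemidef := by
    refine posSemidef_of_quadForm ?_ fun x => ?_
    · refine tendsto_nhds_unique (((continuous_id.matrix_transpose).tendsto _).comp hlim) ?_
      refine hlim.congr fun n => ?_
      exact (transpose_eq_of_posSemidef (hpsd n)).symm
    · have hc : Continuous fun M : Matrix (Fin m) (Fin m) ℝ => x ⬝ᵥ (M *ᵥ x) := by fun_prop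
      exact ge_of_tendsto' ((hc.tendsto _).comp hlim) fun n => quadForm_nonneg (hpsd n) x
  refine ⟨Matrix.of P, hPs, ?_⟩
  have hS : Filter.Tendsto (fun n => inputWeight B R β (T n)) Filter.atTop
      (nhds (inputWeight B R β (Matrix.of P))) := by
    have hc : Continuous fun M => inputWeight B R β M := by
      unfold inputWeight; fun_prop
    exact (hc.tendsto _).comp hlim
  -- The limit is positive semidefinite, so its input weight is invertible and inversion is
  -- continuous there; this lets the recursion pass to the limit.
  have hSi := tendsto_inv_of_isUnit_det hS (isUnit_det_inputWeight hR hβ hPs)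
  have hstep : Filter.Tendsto (fun n => T (n + 1)) Filter.atTop
      (nhds (riccatiMap A B Q R β (Matrix.of P))) := by
    have hT1 : ∀ n, T (n + 1) = riccatiMap A B Q R β (T n) := fun n => rfl
    simp only [hT1, riccatiMap]
    have h1 := tendsto_matrix_mul (tendsto_matrix_mul (tendsto_matrix_mul (tendsto_matrix_mul hlim
      (tendsto_const_nhds (x := B))) hSi) (tendsto_const_nhds (x := Bᵀ))) hlim
    exact ((tendsto_matrix_mul (tendsto_matrix_mul tendsto_const_nhds
      (hlim.sub (h1.const_smul β))) tendsto_const_nhds).const_smul β).const_add Q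
  exact tendsto_nhds_unique (hlim.comp (Filter.tendsto_add_atTop_nat 1)) hstep

end Riccati

/-! ### Absolutely summable sequences of matrices -/

section AbsSummable

variable {ι κ ν : Type*}

/-- Entrywise absolute summability of a sequence of matrices. -/
def AbsSummable (f : ℕ → Matrix ι κ ℝ) : Prop := ∀ i j, Summable fun n => |f n i j|

lemma AbsSummable.mul_left [Fintype κ] {f : ℕ → Matrix κ ν ℝ} (hf : AbsSummable f)
    (A : Matrix ι κ ℝ) : AbsSummable fun n => A * f n := by
  intro i j
  refine Summable.of_nonneg_of_le (fun _ => abs_nonneg _) (fun n => ?_)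
    (summable_sum (s := Finset.univ) fun k _ => (hf k j).mul_left |A i k|)
  change |(A * f n) i j| ≤ _
  rw [Matrix.mul_apply]
  exact (Finset.abs_sum_le_sum_abs _ _).trans (le_of_eq (by simp only [abs_mul]))

lemma AbsSummable.mul_right [Fintype κ] {f : ℕ → Matrix ι κ ℝ} (hf : AbsSummable f)
    (A : Matrix κ ν ℝ) : AbsSummable fun n => f n * A := by
  intro i j
  refine Summable.of_nonneg_of_le (fun _ => abs_nonneg _) (fun n => ?_)
    (summable_sum (s := Finset.univ) fun k _ => (hf i k).mul_right |A k j|)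
  change |(f n * A) i j| ≤ _
  rw [Matrix.mul_apply]
  exact (Finset.abs_sum_le_sum_abs _ _).trans (le_of_eq (by simp only [abs_mul]))

lemma AbsSummable.neg {f : ℕ → Matrix ι κ ℝ} (hf : AbsSummable f) :
    AbsSummable fun n => -f n := fun i j => by simpa using hf i j

lemma AbsSummable.const_smul {f : ℕ → Matrix ι κ ℝ} (hf : AbsSummable f) (c : ℝ) :
    AbsSummable fun n => c • f n := fun i j => by
  simpa [abs_mul] using (hf i j).mul_left |c|

lemma AbsSummable.of_succ {f : ℕ → Matrix ι κ ℝ} (hf : AbsSummable fun n => f (n + 1)) :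
    AbsSummable f := fun i j => (summable_nat_add_iff (f := fun n => |f n i j|) 1).1 (hf i j)

lemma AbsSummable.sum {σ : Type*} (s : Finset σ) {f : σ → ℕ → Matrix ι κ ℝ}
    (hf : ∀ l ∈ s, AbsSummable (f l)) : AbsSummable fun n => ∑ l ∈ s, f l n := by
  intro i j
  refine Summable.of_nonneg_of_le (fun _ => abs_nonneg _) (fun n => ?_)
    (summable_sum (s := s) fun l hl => hf l hl i j)
  change |(∑ l ∈ s, f l n) i j| ≤ _
  rw [Matrix.sum_apply]
  exact Finset.abs_sum_le_sum_abs _ _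

lemma AbsSummable.summable {f : ℕ → Matrix ι κ ℝ} (hf : AbsSummable f) : Summable f :=
  Pi.summable.2 fun i => Pi.summable.2 fun j => (hf i j).of_abs

lemma AbsSummable.mul_bounded [Fintype κ] {f : ℕ → Matrix ι κ ℝ} (hf : AbsSummable f)
    {a : ℕ → Matrix κ ν ℝ} {c : ℝ} (ha : ∀ n k j, |a n k j| ≤ c) :
    AbsSummable fun n => f n * a n := by
  intro i j
  refine Summable.of_nonneg_of_le (fun _ => abs_nonneg _) (fun n => ?_)
    (summable_sum (s := Finset.univ) fun k _ => (hf i k).mul_right c)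
  change |(f n * a n) i j| ≤ _
  rw [Matrix.mul_apply]
  refine (Finset.abs_sum_le_sum_abs _ _).trans (Finset.sum_le_sum fun k _ => ?_)
  rw [abs_mul]
  exact mul_le_mul_of_nonneg_left (ha n k j) (abs_nonneg _)

lemma AbsSummable.summable_mulVec [Fintype κ] {f : ℕ → Matrix ι κ ℝ} (hf : AbsSummable f)
    {y : ℕ → κ → ℝ} {c : ℝ} (hy : ∀ n k, |y n k| ≤ c) : Summable fun n => f n *ᵥ y n := by
  refine Pi.summable.2 fun i => Summable.of_abs ?_
  refine Summable.of_nonneg_of_le (fun _ => abs_nonneg _) (fun n => ?_)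
    (summable_sum (s := Finset.univ) fun k _ => (hf i k).mul_right c)
  refine (Finset.abs_sum_le_sum_abs _ _).trans (Finset.sum_le_sum fun k _ => ?_)
  rw [abs_mul]
  exact mul_le_mul_of_nonneg_left (hy n k) (abs_nonneg _)

lemma mulVec_tsum [Fintype κ] (A : Matrix ι κ ℝ) {v : ℕ → κ → ℝ} (hv : Summable v) :
    A *ᵥ (∑' n, v n) = ∑' n, A *ᵥ v n :=
  hv.map_tsum (A.mulVecLin) (Continuous.matrix_mulVec continuous_const continuous_id)

lemma tsum_mulVec [Fintype κ] {f : ℕ → Matrix ι κ ℝ} (hf : Summable f) (x : κ → ℝ) :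
    (∑' n, f n) *ᵥ x = ∑' n, f n *ᵥ x :=
  hf.map_tsum (⟨⟨fun A => A *ᵥ x, zero_mulVec x⟩, fun A B => add_mulVec A B x⟩ :
    Matrix ι κ ℝ →+ (ι → ℝ)) (Continuous.matrix_mulVec continuous_id continuous_const)

lemma mul_tsum_matrix [Fintype κ] (A : Matrix ι κ ℝ) {f : ℕ → Matrix κ ν ℝ} (hf : Summable f) :
    A * (∑' n, f n) = ∑' n, A * f n :=
  hf.map_tsum (⟨⟨fun B => A * B, Matrix.mul_zero A⟩, fun B C => Matrix.mul_add A B C⟩ :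
    Matrix κ ν ℝ →+ Matrix ι ν ℝ) (Continuous.matrix_mul continuous_const continuous_id)

/-- Neumann series: splitting off the zeroth term makes the product telescope. The right inverse
shows that the inverse of `1 - Φ` in `Game.H` is a genuine one. -/
lemma one_sub_mul_tsum_pow [Fintype ι] [DecidableEq ι] {Φ : Matrix ι ι ℝ}
    (h : AbsSummable fun n => Φ ^ n) : (1 - Φ) * ∑' n, Φ ^ n = 1 := by
  have hs := h.summable
  rw [Matrix.sub_mul, Matrix.one_mul, mul_tsum_matrix _ hs, hs.tsum_eq_zero_add]
  simp only [pow_zero, pow_succ']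
  abel

end AbsSummable

namespace Game

variable {N n0 ny : ℕ} {nx nu : Fin N → ℕ} {g : Game N n0 ny nx nu}

/-! ### Best-response coefficients -/

section Coefficients

variable {i : Fin N}

/-- Existence of a solution makes the `epsilon` choice a genuine one. Which positive semidefinite
solution is chosen plays no role later, so uniqueness is not needed. -/
lemma isRiccatiSolution_M (h : IsStabilizable (g.A i) (g.B i)) :
    g.IsRiccatiSolution i (g.M i) := by
  obtain ⟨P, hP, hP'⟩ := exists_riccati_solution h (g.Q_posDef i) (g.R_posDef i) (g.β_nonneg i)
    (g.β_lt_one i)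
  exact Classical.epsilon_spec (p := g.IsRiccatiSolution i) ⟨P, hP, hP'⟩

lemma posSemidef_M (h : IsStabilizable (g.A i) (g.B i)) : (g.M i).PosSemidef :=
  (isRiccatiSolution_M h).1

lemma posDef_S (h : IsStabilizable (g.A i) (g.B i)) : (g.S i).PosDef :=
  posDef_inputWeight (g.R_posDef i) (g.β_nonneg i) (posSemidef_M h)

lemma S_mul_F (h : IsStabilizable (g.A i) (g.B i)) :
    g.S i * g.F i = -(g.β i • ((g.B i)ᵀ * g.M i * g.A i)) :=
  inputWeight_mul_feedback (g.R_posDef i) (g.β_nonneg i) (posSemidef_M h)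

lemma S_mul_inv (h : IsStabilizable (g.A i) (g.B i)) : g.S i * (g.S i)⁻¹ = 1 :=
  mul_nonsing_inv _ ((isUnit_iff_isUnit_det _).1 (posDef_S h).isUnit)

lemma M_eq (h : IsStabilizable (g.A i) (g.B i)) :
    g.M i = g.Q i + g.β i • ((g.A i)ᵀ * g.M i * g.A i) - (g.F i)ᵀ * g.S i * g.F i := by
  have h1 := riccatiMap_eq (A := g.A i) (B := g.B i) (Q := g.Q i) (g.R_posDef i) (g.β_nonneg i)
    (posSemidef_M h)
  exact (isRiccatiSolution_M h).2.trans h1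

lemma quadForm_M (h : IsStabilizable (g.A i) (g.B i)) (x : Vec (nx i)) :
    x ⬝ᵥ (g.M i *ᵥ x) = x ⬝ᵥ (g.Q i *ᵥ x) + (g.F i *ᵥ x) ⬝ᵥ (g.R i *ᵥ (g.F i *ᵥ x)) +
      g.β i * (((g.A i + g.B i * g.F i) *ᵥ x) ⬝ᵥ
        (g.M i *ᵥ ((g.A i + g.B i * g.F i) *ᵥ x))) := by
  have h1 := riccatiMap_feedback (A := g.A i) (B := g.B i) (Q := g.Q i) (g.R_posDef i)
    (g.β_nonneg i) (posSemidef_M h) x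
  rw [add_mulVec, ← mulVec_mulVec]
  refine Eq.trans ?_ h1
  conv_lhs => rw [(isRiccatiSolution_M h).2]
  rfl

/-- In closed-loop form the Riccati equation exhibits `M` as `Q` plus positive semidefinite terms.
-/
lemma exists_le_quadForm_M (h : IsStabilizable (g.A i) (g.B i)) :
    ∃ ε : ℝ, 0 < ε ∧ ∀ x : Vec (nx i), ε * (x ⬝ᵥ x) ≤ x ⬝ᵥ (g.M i *ᵥ x) := by
  obtain ⟨ε, hε, hq⟩ := exists_le_quadForm_of_posDef (g.Q_posDef i)
  refine ⟨ε, hε, fun x => (hq x).trans ?_⟩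
  rw [quadForm_M h]
  have h1 := quadForm_nonneg (g.R_posDef i).posSemidef (g.F i *ᵥ x)
  have h2 := mul_nonneg (g.β_nonneg i)
    (quadForm_nonneg (posSemidef_M h) ((g.A i + g.B i * g.F i) *ᵥ x))
  linarith

/-- Lyapunov argument: by `quadForm_M` a discounted closed-loop step lowers `x'Mx` by at least
`x'Qx`, which is at least a fixed fraction of `x'Mx`. -/
lemma exists_contraction (h : IsStabilizable (g.A i) (g.B i)) :
    ∃ ρ : ℝ, 0 ≤ ρ ∧ ρ < 1 ∧ ∀ x : Vec (nx i),
      g.β i * (((g.A i + g.B i * g.F i) *ᵥ x) ⬝ᵥ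
        (g.M i *ᵥ ((g.A i + g.B i * g.F i) *ᵥ x))) ≤ ρ * (x ⬝ᵥ (g.M i *ᵥ x)) := by
  obtain ⟨ε, hε, hq⟩ := exists_le_quadForm_of_posDef (g.Q_posDef i)
  obtain ⟨c, hc, hm⟩ := exists_quadForm_le (g.M i)
  have hd : 0 < max c ε := lt_max_of_lt_left hc
  -- `max c ε` is still an upper bound for `M`, and it keeps the fraction at most 1, so that `ρ ≥
  -- 0`.
  refine ⟨1 - ε / max c ε, ?_, ?_, fun x => ?_⟩
  · rw [sub_nonneg, div_le_one hd]
    exact le_max_right _ _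
  · linarith [div_pos hε hd]
  · have h1 := quadForm_nonneg (g.R_posDef i).posSemidef (g.F i *ᵥ x)
    have h2 := quadForm_M h x
    have h3 := hq x
    have hx := dotProduct_self_nonneg' x
    have h4 : x ⬝ᵥ (g.M i *ᵥ x) ≤ max c ε * (x ⬝ᵥ x) :=
      (hm x).trans (mul_le_mul_of_nonneg_right (le_max_left _ _) hx)
    have h5 : ε / max c ε * (x ⬝ᵥ (g.M i *ᵥ x)) ≤ ε * (x ⬝ᵥ x) := by
      calc ε / max c ε * (x ⬝ᵥ (g.M i *ᵥ x)) ≤ ε / max c ε * (max c ε * (x ⬝ᵥ x)) :=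
            mul_le_mul_of_nonneg_left h4 (by positivity)
        _ = ε * (x ⬝ᵥ x) := by field_simp
    linarith

/-- Iterating the contraction and bounding the Euclidean form by that of `M`, the entries of `Φ ^ n`
decay like `√ρ ^ n`. Convergence of all the forecast series rests on this. -/
lemma absSummable_pow_Φ (h : IsStabilizable (g.A i) (g.B i)) :
    AbsSummable fun n => g.Φ i ^ n := by
  obtain ⟨ρ, hρ, hρ1, hcon⟩ := exists_contraction h
  obtain ⟨ε, hε, hq⟩ := exists_le_quadForm_M h
  set T := g.A i + g.B i * g.F i with hT
  have hβ := g.β_nonneg i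
  have hβ1 := (g.β_lt_one i).le
  have hpow : ∀ n (x : Vec (nx i)), g.β i ^ n * ((T ^ n *ᵥ x) ⬝ᵥ (g.M i *ᵥ (T ^ n *ᵥ x))) ≤
      ρ ^ n * (x ⬝ᵥ (g.M i *ᵥ x)) := by
    intro n
    induction n with
    | zero => intro x; simp
    | succ n ih =>
      intro x
      have h1 := hcon (T ^ n *ᵥ x)
      have h2 : T *ᵥ (T ^ n *ᵥ x) = T ^ (n + 1) *ᵥ x := by rw [mulVec_mulVec, ← pow_succ']
      rw [h2] at h1
      calc _ = g.β i ^ n * (g.β i * ((T ^ (n + 1) *ᵥ x) ⬝ᵥ (g.M i *ᵥ (T ^ (n + 1) *ᵥ x)))) := by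
            ring
        _ ≤ g.β i ^ n * (ρ * ((T ^ n *ᵥ x) ⬝ᵥ (g.M i *ᵥ (T ^ n *ᵥ x)))) :=
            mul_le_mul_of_nonneg_left h1 (by positivity)
        _ = ρ * (g.β i ^ n * ((T ^ n *ᵥ x) ⬝ᵥ (g.M i *ᵥ (T ^ n *ᵥ x)))) := by ring
        _ ≤ ρ * (ρ ^ n * (x ⬝ᵥ (g.M i *ᵥ x))) := mul_le_mul_of_nonneg_left (ih x) hρ
        _ = _ := by ring
  intro r c
  set K := ε⁻¹ * ((Pi.single r 1 : Vec (nx i)) ⬝ᵥ (g.M i *ᵥ Pi.single r 1)) with hK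
  have hK0 : 0 ≤ K := mul_nonneg (inv_pos.2 hε).le (quadForm_nonneg (posSemidef_M h) _)
  refine Summable.of_nonneg_of_le (fun _ => abs_nonneg _) (fun n => ?_)
    ((summable_geometric_of_lt_one (Real.sqrt_nonneg ρ)
      (by rw [Real.sqrt_lt' one_pos]; simpa using hρ1)).mul_left (Real.sqrt K))
  have e1 : (g.Φ i ^ n) r c = g.β i ^ n * (T ^ n *ᵥ Pi.single r 1) c := by
    rw [Game.Φ, smul_pow, ← transpose_pow, mulVec_single_one]
    rfl
  have h1 : (T ^ n *ᵥ Pi.single r 1) c ^ 2 * ε ≤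
      (T ^ n *ᵥ Pi.single r 1) ⬝ᵥ (g.M i *ᵥ (T ^ n *ᵥ Pi.single r 1)) := by
    have := sq_le_dotProduct_self (T ^ n *ᵥ Pi.single r 1) c
    nlinarith [hq (T ^ n *ᵥ Pi.single r 1)]
  have hb : 0 ≤ g.β i ^ n := by positivity
  have hb1 : g.β i ^ n ≤ 1 := pow_le_one₀ hβ hβ1
  have h2 : (g.Φ i ^ n) r c ^ 2 ≤ K * ρ ^ n := by
    have h3 := hpow n (Pi.single r 1)
    have h4 : (g.Φ i ^ n) r c ^ 2 * ε ≤ ρ ^ n *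
        ((Pi.single r 1 : Vec (nx i)) ⬝ᵥ (g.M i *ᵥ Pi.single r 1)) := by
      rw [e1]
      refine le_trans ?_ h3
      -- The squared entry carries the factor `β ^ n` twice, whereas the contraction estimate uses
      -- it once; the surplus factor is at most 1.
      calc _ = g.β i ^ n * (g.β i ^ n * ((T ^ n *ᵥ Pi.single r 1) c ^ 2 * ε)) := by ring
        _ ≤ 1 * (g.β i ^ n * ((T ^ n *ᵥ Pi.single r 1) c ^ 2 * ε)) :=
            mul_le_mul_of_nonneg_right hb1 (by positivity)
        _ ≤ _ := by
            rw [one_mul]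
            exact mul_le_mul_of_nonneg_left h1 hb
    rw [hK]
    calc (g.Φ i ^ n) r c ^ 2 = ε⁻¹ * ((g.Φ i ^ n) r c ^ 2 * ε) := by field_simp
      _ ≤ ε⁻¹ * (ρ ^ n * ((Pi.single r 1 : Vec (nx i)) ⬝ᵥ (g.M i *ᵥ Pi.single r 1))) :=
          mul_le_mul_of_nonneg_left h4 (inv_pos.2 hε).le
      _ = _ := by ring
  have h5 := Real.abs_le_sqrt h2
  have h6 : ρ ^ n = (Real.sqrt ρ ^ n) ^ 2 := by
    rw [← pow_mul, mul_comm, pow_mul, Real.sq_sqrt hρ]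
  rwa [Real.sqrt_mul hK0, h6, Real.sqrt_sq (by positivity)] at h5

end Coefficients

end Game

-- Summability of the forecast weights

namespace Game

variable {N n0 ny : ℕ} {nx nu : Fin N → ℕ} {g : Game N n0 ny nx nu}

lemma absSummable_Gn {i : Fin N} (h : IsStabilizable (g.A i) (g.B i)) :
    AbsSummable (g.Gn i) :=
  AbsSummable.of_succ ((((absSummable_pow_Φ h).mul_left ((g.S i)⁻¹ * (g.B i)ᵀ)).mul_right
    (((g.F i)ᵀ * (g.K i)ᵀ + (g.L i)ᵀ) + g.Φ i * g.M i * g.C i)).const_smul (g.β i)).neg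

lemma absSummable_calGp (hAB : ∀ i, IsStabilizable (g.A i) (g.B i)) : AbsSummable g.calGp :=
  AbsSummable.sum _ fun i _ => (absSummable_Gn (hAB i)).mul_left (g.E1 i)

lemma absSummable_calGX (hAB : ∀ i, IsStabilizable (g.A i) (g.B i)) : AbsSummable g.calGX := by
  intro r c
  rcases r with r | ⟨i, r⟩
  · exact AbsSummable.sum Finset.univ
      (fun i _ => (absSummable_Gn (hAB i)).mul_left (g.B1 i)) r c
  · exact (absSummable_Gn (hAB i)).mul_left (g.B i) r c

/-! ### The mean system -/

section Mean

variable {what : StateVec n0 nx} {ξhat : Vec ny}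

/-- The mean system has a unique bounded solution for every initial state. -/
def MeanSolvable (g : Game N n0 ny nx nu) (what : StateVec n0 nx) (ξhat : Vec ny) : Prop :=
  ∀ X0 : StateVec n0 nx, ∃! y : ℕ → Vec ny, g.IsBoundedMeanSolution what ξhat X0 y

lemma MeanSolvable.isBoundedMeanSolution (h : g.MeanSolvable what ξhat) (x : StateVec n0 nx) :
    g.IsBoundedMeanSolution what ξhat x (g.meanSolution what ξhat x) :=
  Classical.epsilon_spec (h x).exists

lemma MeanSolvable.eq_meanSolution (h : g.MeanSolvable what ξhat) {x : StateVec n0 nx}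
    {y : ℕ → Vec ny} (hy : g.IsBoundedMeanSolution what ξhat x y) :
    y = g.meanSolution what ξhat x :=
  (h x).unique hy (h.isBoundedMeanSolution x)

/-- The weights `1`, `t`, `-t` sum to one, so the constant terms of the system survive exactly once.
-/
lemma IsBoundedMeanSolution.add_smul_sub {x x' x'' : StateVec n0 nx} {y y' y'' : ℕ → Vec ny}
    (h : g.IsBoundedMeanSolution what ξhat x y) (h' : g.IsBoundedMeanSolution what ξhat x' y')
    (h'' : g.IsBoundedMeanSolution what ξhat x'' y'') (t : ℝ) :
    g.IsBoundedMeanSolution what ξhat (x + t • (x' - x'')) (y + t • (y' - y'')) := by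
  obtain ⟨⟨c, hc⟩, X, hX0, hX⟩ := h
  obtain ⟨⟨c', hc'⟩, X', hX0', hX'⟩ := h'
  obtain ⟨⟨c'', hc''⟩, X'', hX0'', hX''⟩ := h''
  refine ⟨⟨c + |t| * (c' + c''), fun n => ?_⟩, X + t • (X' - X''), ?_, fun n => ?_⟩
  · refine (norm_add_le _ _).trans (add_le_add (hc n) ?_)
    change ‖t • (y' n - y'' n)‖ ≤ _
    rw [norm_smul, Real.norm_eq_abs]
    refine mul_le_mul_of_nonneg_left ?_ (abs_nonneg t)
    exact (norm_sub_le _ _).trans (add_le_add (hc' n) (hc'' n))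
  · simp [hX0, hX0', hX0'']
  · obtain ⟨s1, s2, e1, e2⟩ := hX n
    obtain ⟨s1', s2', e1', e2'⟩ := hX' n
    obtain ⟨s1'', s2'', e1'', e2''⟩ := hX'' n
    have k1 : ∀ m, g.calGp m *ᵥ (y + t • (y' - y'')) (n + m) = g.calGp m *ᵥ y (n + m) +
        t • (g.calGp m *ᵥ y' (n + m) - g.calGp m *ᵥ y'' (n + m)) := by
      intro m
      simp [mulVec_add, mulVec_smul, mulVec_sub]
    have k2 : ∀ m, g.calGX m *ᵥ (y + t • (y' - y'')) (n + m) = g.calGX m *ᵥ y (n + m) +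
        t • (g.calGX m *ᵥ y' (n + m) - g.calGX m *ᵥ y'' (n + m)) := by
      intro m
      simp [mulVec_add, mulVec_smul, mulVec_sub]
    simp only [k1, k2]
    have d1 := (s1'.sub s1'').const_smul t
    have d2 := (s2'.sub s2'').const_smul t
    refine ⟨s1.add d1, s2.add d2, ?_, ?_⟩
    · rw [s1.tsum_add d1, (s1'.sub s1'').tsum_const_smul, s1'.tsum_sub s1'']
      simp only [Pi.add_apply, Pi.smul_apply, Pi.sub_apply, mulVec_add, mulVec_smul, mulVec_sub]
      rw [e1, e1', e1'']
      module
    · rw [s2.tsum_add d2, (s2'.sub s2'').tsum_const_smul, s2'.tsum_sub s2'']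
      simp only [Pi.add_apply, Pi.smul_apply, Pi.sub_apply, mulVec_add, mulVec_smul, mulVec_sub]
      rw [e2, e2', e2'']
      module

/-- By uniqueness the affine combination of bounded solutions is the bounded solution from the
combined initial state. This is why the differences that define `a` represent a linear map. -/
lemma MeanSolvable.meanSolution_add_smul (h : g.MeanSolvable what ξhat) (x x' : StateVec n0 nx)
    (t : ℝ) : g.meanSolution what ξhat (x + t • x') = g.meanSolution what ξhat x +
      t • (g.meanSolution what ξhat x' - g.meanSolution what ξhat 0) := by
  have := (h.isBoundedMeanSolution x).add_smul_sub (h.isBoundedMeanSolution x')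
    (h.isBoundedMeanSolution 0) t
  rw [sub_zero] at this
  exact (h.eq_meanSolution this).symm

lemma MeanSolvable.meanSolution_eq (h : g.MeanSolvable what ξhat) (x : StateVec n0 nx) (n : ℕ) :
    g.meanSolution what ξhat x n = g.a what ξhat n *ᵥ x + g.b what ξhat n := by
  let ℓ : StateVec n0 nx →ₗ[ℝ] Vec ny :=
    { toFun := fun x => g.meanSolution what ξhat x n - g.meanSolution what ξhat 0 n
      map_add' := fun x x' => by
        have := congrFun (h.meanSolution_add_smul x x' 1) n
        simp only [one_smul] at this
        rw [this]
        simp only [Pi.add_apply, Pi.sub_apply]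
        abel
      map_smul' := fun t x => by
        have := congrFun (h.meanSolution_add_smul 0 x t) n
        rw [zero_add] at this
        rw [this]
        simp }
  have ha : g.a what ξhat n = LinearMap.toMatrix' ℓ := by
    ext r c
    rw [LinearMap.toMatrix'_apply]
    rfl
  rw [ha, LinearMap.toMatrix'_mulVec, Game.b]
  simp [ℓ]

lemma MeanSolvable.exists_bound (h : g.MeanSolvable what ξhat) (x : StateVec n0 nx) :
    ∃ c : ℝ, ∀ n r, |g.meanSolution what ξhat x n r| ≤ c := by
  obtain ⟨⟨c, hc⟩, -⟩ := h.isBoundedMeanSolution x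
  exact ⟨c, fun n r => (norm_le_pi_norm _ r).trans (hc n)⟩

lemma MeanSolvable.exists_bound_a (h : g.MeanSolvable what ξhat) :
    ∃ c : ℝ, ∀ n r s, |g.a what ξhat n r s| ≤ c := by
  obtain ⟨c0, h0⟩ := h.exists_bound 0
  choose c hc using fun s => h.exists_bound (Pi.single s 1)
  refine ⟨(∑ s, |c s|) + c0, fun n r s => ?_⟩
  refine (abs_sub _ _).trans (add_le_add ((hc s n r).trans ((le_abs_self _).trans ?_)) (h0 n r))
  exact Finset.single_le_sum (f := fun s => |c s|) (fun _ _ => abs_nonneg _) (Finset.mem_univ s)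

lemma MeanSolvable.exists_bound_b (h : g.MeanSolvable what ξhat) :
    ∃ c : ℝ, ∀ n r, |g.b what ξhat n r| ≤ c := h.exists_bound 0

lemma MeanSolvable.tsum_mulVec_meanSolution (h : g.MeanSolvable what ξhat) {ι : Type*}
    {f : ℕ → Matrix ι (Fin ny) ℝ} (hf : AbsSummable f) (x : StateVec n0 nx) :
    ∑' n, f n *ᵥ g.meanSolution what ξhat x n =
      (∑' n, f n * g.a what ξhat n) *ᵥ x + ∑' n, f n *ᵥ g.b what ξhat n := by
  obtain ⟨c, hc⟩ := h.exists_bound_a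
  obtain ⟨d, hd⟩ := h.exists_bound_b
  have hs := (hf.mul_bounded hc).summable
  rw [tsum_mulVec hs, ← Summable.tsum_add _ (hf.summable_mulVec hd)]
  · refine tsum_congr fun n => ?_
    rw [h.meanSolution_eq, mulVec_add, mulVec_mulVec]
  · exact hs.map (⟨⟨fun A => A *ᵥ x, zero_mulVec x⟩, fun A B => add_mulVec A B x⟩ :
      Matrix ι (StateIdx n0 nx) ℝ →+ (ι → ℝ))
      (Continuous.matrix_mulVec continuous_id continuous_const)

/-- The mean of the environment variable when the mean of the state is `x`. -/
def meanEnv (g : Game N n0 ny nx nu) (what : StateVec n0 nx) (ξhat : Vec ny)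
    (x : StateVec n0 nx) : Vec ny :=
  g.calD *ᵥ x + (∑' n, g.calGp n * g.a what ξhat n) *ᵥ x
    + (∑' n, g.calGp n *ᵥ g.b what ξhat n + g.calHp what) + ξhat

/-- The mean of the next state when the mean of the state is `x`. -/
def meanNext (g : Game N n0 ny nx nu) (what : StateVec n0 nx) (ξhat : Vec ny)
    (x : StateVec n0 nx) : StateVec n0 nx :=
  g.calA *ᵥ x + (∑' n, g.calGX n * g.a what ξhat n) *ᵥ x
    + (∑' n, g.calGX n *ᵥ g.b what ξhat n + g.calHX what) + g.calC *ᵥ g.meanEnv what ξhat x + what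

lemma MeanSolvable.meanSolution_zero (h : g.MeanSolvable what ξhat)
    (hAB : ∀ i, IsStabilizable (g.A i) (g.B i)) (x : StateVec n0 nx) :
    g.meanSolution what ξhat x 0 = g.meanEnv what ξhat x := by
  obtain ⟨-, X, hX0, hX⟩ := h.isBoundedMeanSolution x
  obtain ⟨-, -, e1, -⟩ := hX 0
  simp only [zero_add, h.tsum_mulVec_meanSolution (absSummable_calGp hAB), hX0] at e1
  rw [e1, meanEnv]
  abel

/-- Time consistency: the tail of a bounded solution is a bounded solution from its own state at
time 1, and uniqueness identifies it. Without uniqueness, forecasts made at successive dates need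
not agree. -/
lemma MeanSolvable.meanSolution_meanNext (h : g.MeanSolvable what ξhat)
    (hAB : ∀ i, IsStabilizable (g.A i) (g.B i)) (x : StateVec n0 nx) (n : ℕ) :
    g.meanSolution what ξhat (g.meanNext what ξhat x) n = g.meanSolution what ξhat x (n + 1) := by
  obtain ⟨⟨c, hc⟩, X, hX0, hX⟩ := h.isBoundedMeanSolution x
  have hX1 : X 1 = g.meanNext what ξhat x := by
    obtain ⟨-, -, -, e2⟩ := hX 0
    simp only [zero_add, h.tsum_mulVec_meanSolution (absSummable_calGX hAB), hX0,
      h.meanSolution_zero hAB] at e2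
    rw [e2, meanNext]
    abel
  have : g.IsBoundedMeanSolution what ξhat (g.meanNext what ξhat x)
      (fun n => g.meanSolution what ξhat x (n + 1)) := by
    refine ⟨⟨c, fun n => hc _⟩, fun n => X (n + 1), hX1, fun t => ?_⟩
    have := hX (t + 1)
    simpa only [add_right_comm t 1] using this
  exact (congrFun (h.eq_meanSolution this) n).symm

/-- `Fᵀ Kᵀ + Lᵀ + Φ M C`. -/
def envWeight (g : Game N n0 ny nx nu) (i : Fin N) : Matrix (Fin (nx i)) (Fin ny) ℝ :=
  ((g.F i)ᵀ * (g.K i)ᵀ + (g.L i)ᵀ) + g.Φ i * g.M i * g.C i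

/-- `(1 - Φ)⁻¹ M w`. -/
def noiseCostate (g : Game N n0 ny nx nu) (what : StateVec n0 nx) (i : Fin N) : Vec (nx i) :=
  (1 - g.Φ i)⁻¹ *ᵥ (g.M i *ᵥ own i what)

/-- The linear coefficient in player `i`'s value function when the estimate of the joint state
is `x`. -/
def costate (g : Game N n0 ny nx nu) (what : StateVec n0 nx) (ξhat : Vec ny) (i : Fin N)
    (x : StateVec n0 nx) : Vec (nx i) :=
  ∑' n, (g.Φ i ^ n * g.envWeight i) *ᵥ g.meanSolution what ξhat x n
    + g.Φ i *ᵥ g.noiseCostate what i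

lemma isUnit_det_one_sub_Φ {i : Fin N} (hAB : IsStabilizable (g.A i) (g.B i)) :
    IsUnit (1 - g.Φ i).det :=
  Matrix.isUnit_det_of_right_inverse (one_sub_mul_tsum_pow (absSummable_pow_Φ hAB))

lemma noiseCostate_eq {i : Fin N} (hAB : IsStabilizable (g.A i) (g.B i)) :
    g.noiseCostate what i = g.M i *ᵥ own i what + g.Φ i *ᵥ g.noiseCostate what i := by
  have h : (1 - g.Φ i) *ᵥ g.noiseCostate what i = g.M i *ᵥ own i what := by
    rw [noiseCostate, mulVec_mulVec, mul_nonsing_inv _ (isUnit_det_one_sub_Φ hAB), one_mulVec]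
  rw [sub_mulVec, one_mulVec, sub_eq_iff_eq_add] at h
  exact h

lemma MeanSolvable.costate_eq_affine (h : g.MeanSolvable what ξhat) {i : Fin N}
    (hAB : IsStabilizable (g.A i) (g.B i)) (x : StateVec n0 nx) :
    g.costate what ξhat i x = (∑' n, g.Φ i ^ n * g.envWeight i * g.a what ξhat n) *ᵥ x
      + g.costate what ξhat i 0 := by
  rw [costate, h.tsum_mulVec_meanSolution ((absSummable_pow_Φ hAB).mul_right _), costate,
    add_assoc]
  rfl

/-- Peeling off the current forecast leaves, by time consistency, `Φ` times the series of the next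
period; `noiseCostate_eq` does the same for the noise part. It is the costate recursion with
forecasts in place of realizations. -/
lemma MeanSolvable.costate_eq (h : g.MeanSolvable what ξhat)
    (hAB : ∀ i, IsStabilizable (g.A i) (g.B i)) (i : Fin N) (x : StateVec n0 nx) :
    g.costate what ξhat i x = g.envWeight i *ᵥ g.meanEnv what ξhat x
      + g.Φ i *ᵥ (g.M i *ᵥ own i what + g.costate what ξhat i (g.meanNext what ξhat x)) := by
  obtain ⟨c, hc⟩ := h.exists_bound x
  obtain ⟨c', hc'⟩ := h.exists_bound (g.meanNext what ξhat x)
  have hs := ((absSummable_pow_Φ (hAB i)).mul_right (g.envWeight i)).summable_mulVec hc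
  have hs' := ((absSummable_pow_Φ (hAB i)).mul_right (g.envWeight i)).summable_mulVec hc'
  rw [costate, hs.tsum_eq_zero_add, costate, mulVec_add, mulVec_add, mulVec_tsum _ hs']
  simp only [h.meanSolution_meanNext hAB, mulVec_mulVec, pow_zero, Matrix.one_mul,
    h.meanSolution_zero hAB]
  conv_lhs => rw [noiseCostate_eq (hAB i), mulVec_add]
  simp only [pow_succ', Matrix.mul_assoc, mulVec_mulVec]
  abel

lemma MeanSolvable.input_eq (hs : g.MeanSolvable what ξhat)
    (hAB : ∀ i, IsStabilizable (g.A i) (g.B i)) (i : Fin N) (x : StateVec n0 nx) :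
    g.G what ξhat i *ᵥ x + g.checkH what ξhat i =
      ∑' n, g.Gn i n *ᵥ g.meanSolution what ξhat x n + g.H what i := by
  rw [hs.tsum_mulVec_meanSolution (absSummable_Gn (hAB i)), Game.G, checkH, add_assoc]

/-- First-order condition in the forecasts. Multiplication by `S` clears the inverses in the
weights, and by time consistency the weights from index 1 on assemble into the costate at `meanNext
x`. -/
lemma MeanSolvable.S_mulVec_input (h : g.MeanSolvable what ξhat)
    (hAB : ∀ i, IsStabilizable (g.A i) (g.B i)) (i : Fin N) (x : StateVec n0 nx) :
    g.S i *ᵥ (g.G what ξhat i *ᵥ x + g.checkH what ξhat i) =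
      -((g.K i)ᵀ *ᵥ g.meanEnv what ξhat x + g.β i • ((g.B i)ᵀ *ᵥ
        (g.M i *ᵥ (g.C i *ᵥ g.meanEnv what ξhat x + own i what)
          + g.costate what ξhat i (g.meanNext what ξhat x)))) := by
  obtain ⟨c, hc⟩ := h.exists_bound x
  obtain ⟨c', hc'⟩ := h.exists_bound (g.meanNext what ξhat x)
  have hs := (absSummable_Gn (hAB i)).summable_mulVec hc
  have hs' := ((absSummable_pow_Φ (hAB i)).mul_right (g.envWeight i)).summable_mulVec hc'
  have e1 := h.input_eq hAB i x
  have e2 : ∀ n, g.Gn i (n + 1) *ᵥ g.meanSolution what ξhat x (n + 1) =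
      (-(g.β i • ((g.S i)⁻¹ * (g.B i)ᵀ))) *ᵥ ((g.Φ i ^ n * g.envWeight i) *ᵥ
        g.meanSolution what ξhat (g.meanNext what ξhat x) n) := by
    intro n
    rw [h.meanSolution_meanNext hAB, mulVec_mulVec]
    congr 1
    simp only [Gn, envWeight, Matrix.neg_mul, Matrix.smul_mul, Matrix.mul_assoc]
  have e3 : g.H what i = (-(g.β i • ((g.S i)⁻¹ * (g.B i)ᵀ))) *ᵥ g.noiseCostate what i := by
    simp only [Game.H, noiseCostate, neg_mulVec, smul_mulVec, mulVec_mulVec, Matrix.mul_assoc,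
      Matrix.neg_mul, Matrix.smul_mul]
  have e4 : g.S i * (-(g.β i • ((g.S i)⁻¹ * (g.B i)ᵀ))) = -(g.β i • (g.B i)ᵀ) := by
    rw [Matrix.mul_neg, Matrix.mul_smul, ← Matrix.mul_assoc, S_mul_inv (hAB i), Matrix.one_mul]
  have e5 : g.S i * g.Gn i 0 = -((g.K i)ᵀ + g.β i • ((g.B i)ᵀ * g.M i * g.C i)) := by
    rw [Gn, Matrix.mul_neg, ← Matrix.mul_assoc, S_mul_inv (hAB i), Matrix.one_mul]
  rw [e1, hs.tsum_eq_zero_add, e3]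
  simp only [e2]
  rw [← mulVec_tsum _ hs', mulVec_add, mulVec_add, mulVec_mulVec, mulVec_mulVec, mulVec_mulVec, e4,
    e5, h.meanSolution_zero hAB, costate]
  -- The part `M ŵ` joins the mean disturbance; the part `Φ (1 - Φ)⁻¹ M ŵ` is the constant term of
  -- the next costate.
  conv_lhs => rw [noiseCostate_eq (hAB i)]
  simp only [neg_mulVec, add_mulVec, smul_mulVec, mulVec_add, mulVec_mulVec, smul_add,
    Matrix.mul_assoc, Matrix.neg_mul, Matrix.smul_mul]
  abel

end Mean

end Game

/-! ### Measurability and square integrability of vector-valued maps -/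

section Vector

variable {ι κ : Type*} [Fintype ι] [Fintype κ]

/-- A matrix as a continuous linear map. -/
def mulVecCLM (A : Matrix ι κ ℝ) : (κ → ℝ) →L[ℝ] (ι → ℝ) :=
  LinearMap.toContinuousLinearMap A.mulVecLin

omit [Fintype ι] in
@[simp] lemma mulVecCLM_apply [Finite ι] (A : Matrix ι κ ℝ) (x : κ → ℝ) :
    mulVecCLM A x = A *ᵥ x := rfl

lemma measurable_mulVec {Ω : Type*} {m : MeasurableSpace Ω} (A : Matrix ι κ ℝ) {f : Ω → κ → ℝ}
    (hf : Measurable f) : Measurable fun ω => A *ᵥ f ω :=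
  (Continuous.matrix_mulVec continuous_const continuous_id).measurable.comp hf

variable {Ω : Type*} [MeasurableSpace Ω] {μ : Measure Ω}

lemma memLp_mulVec (A : Matrix ι κ ℝ) {f : Ω → κ → ℝ} (hf : MemLp f 2 μ) :
    MemLp (fun ω => A *ᵥ f ω) 2 μ :=
  (mulVecCLM A).comp_memLp' hf

lemma integrable_dotProduct {f h : Ω → ι → ℝ} (hf : MemLp f 2 μ) (hh : MemLp h 2 μ) :
    Integrable (fun ω => f ω ⬝ᵥ h ω) μ :=
  integrable_finsetSum _ fun i _ => (hf.eval i).integrable_mul (hh.eval i)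

lemma memLp_mulVec_add {ν : Type*} [Fintype ν] [IsFiniteMeasure μ] (A : Matrix ι κ ℝ)
    (B : Matrix ι ν ℝ) (c : ι → ℝ) {f : Ω → κ → ℝ} {h : Ω → ν → ℝ} {k : Ω → ι → ℝ}
    (hf : MemLp f 2 μ) (hh : MemLp h 2 μ) (hk : MemLp k 2 μ) :
    MemLp (fun ω => A *ᵥ f ω + B *ᵥ h ω + c + k ω) 2 μ :=
  (((memLp_mulVec A hf).add (memLp_mulVec B hh)).add (memLp_const c)).add hk

end Vector

/-! ### Independence of the primitive random variables -/

section Independence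

/-- Independence depends on the joint law only: every event in question is the preimage under `V'`
of a measurable set, and has the probability of its preimage under `V`. -/
lemma iIndep_comap_of_identDistrib {κ E Ω Ω' : Type*} [mE : MeasurableSpace E]
    [MeasurableSpace Ω] [MeasurableSpace Ω'] {μ : Measure Ω} {P : Measure Ω'} {V : Ω → E}
    {V' : Ω' → E} (n : κ → MeasurableSpace E) (hn : ∀ k, n k ≤ mE) (h : IdentDistrib V' V P μ)
    (hind : iIndep (fun k => (n k).comap V) μ) : iIndep (fun k => (n k).comap V') P := by
  rw [iIndep_iff] at hind ⊢
  intro s f hf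
  choose! T hT hT' using hf
  have h1 := hind s (f := fun k => V ⁻¹' T k) fun i hi => ⟨T i, hT i hi, rfl⟩
  have e1 : ⋂ i ∈ s, f i = V' ⁻¹' ⋂ i ∈ s, T i := by
    rw [Set.preimage_iInter₂]
    exact Set.iInter₂_congr fun i hi => (hT' i hi).symm
  have e2 : ⋂ i ∈ s, V ⁻¹' T i = V ⁻¹' ⋂ i ∈ s, T i := by rw [Set.preimage_iInter₂]
  rw [e1, h.measure_mem_eq (Finset.measurableSet_biInter s fun i hi => hn i _ (hT i hi)), ← e2, h1]
  refine Finset.prod_congr rfl fun i hi => ?_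
  rw [← hT' i hi, h.measure_mem_eq (hn i _ (hT i hi))]

variable {N n0 ny : ℕ} {nx : Fin N → ℕ} {Ω : Type*} [mΩ : MeasurableSpace Ω] {μ : Measure Ω}
  {X0 : Ω → StateVec n0 nx} {W : ℕ → Ω → StateVec n0 nx} {ξ : ℕ → Ω → Vec ny}

lemma Primitives.of_identDistrib (h : Primitives μ X0 W ξ) {Ω' : Type*} [MeasurableSpace Ω']
    {P : Measure Ω'} {X0' : Ω' → StateVec n0 nx} {W' : ℕ → Ω' → StateVec n0 nx}
    {ξ' : ℕ → Ω' → Vec ny} (hX0 : Measurable X0') (hW : ∀ t, Measurable (W' t))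
    (hξ : ∀ t, Measurable (ξ' t))
    (hident : IdentDistrib (fun ω' => (X0' ω', fun t => ξ' t ω', fun t => W' t ω'))
      (fun ω => (X0 ω, fun t => ξ t ω, fun t => W t ω)) P μ) :
    Primitives P X0' W' ξ' := by
  have iX : IdentDistrib X0' X0 P μ := hident.comp measurable_fst
  have iξ : ∀ t, IdentDistrib (ξ' t) (ξ t) P μ := fun t =>
    hident.comp ((measurable_pi_apply t).comp (measurable_fst.comp measurable_snd))
  have iW : ∀ t, IdentDistrib (W' t) (W t) P μ := fun t =>
    hident.comp ((measurable_pi_apply t).comp (measurable_snd.comp measurable_snd))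
  refine ⟨hX0, hW, hξ, iX.memLp_iff.2 h.memLp_X0, fun t => (iW t).memLp_iff.2 (h.memLp_W t),
    fun t => (iξ t).memLp_iff.2 (h.memLp_ξ t), ?_,
    fun t => ((iW t).trans (h.ident_W t)).trans (iW 0).symm,
    fun t => ((iξ t).trans (h.ident_ξ t)).trans (iξ 0).symm⟩
  -- Coordinate σ-algebras on the space of all primitives; pulled back along either triple they
  -- become the σ-algebras generated by its variables.
  let n : Option (ℕ ⊕ ℕ) →
      MeasurableSpace (StateVec n0 nx × (ℕ → Vec ny) × (ℕ → StateVec n0 nx)) := fun k =>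
    match k with
    | none => MeasurableSpace.comap (fun v => v.1) inferInstance
    | some (Sum.inl t) => MeasurableSpace.comap (fun v => v.2.2 t) inferInstance
    | some (Sum.inr t) => MeasurableSpace.comap (fun v => v.2.1 t) inferInstance
  have hn : ∀ k, n k ≤ (inferInstance :
      MeasurableSpace (StateVec n0 nx × (ℕ → Vec ny) × (ℕ → StateVec n0 nx))) := by
    rintro (_ | t | t)
    · exact measurable_fst.comap_le
    · exact ((measurable_pi_apply t).comp (measurable_snd.comp measurable_snd)).comap_le
    · exact ((measurable_pi_apply t).comp (measurable_fst.comp measurable_snd)).comap_le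
  have key := iIndep_comap_of_identDistrib n hn hident (by
    convert h.indep using 1
    funext k
    rcases k with (_ | t | t) <;> simp only [n, MeasurableSpace.comap_comp] <;> rfl)
  convert key using 1
  funext k
  rcases k with (_ | t | t) <;> simp only [n, MeasurableSpace.comap_comp] <;> rfl

/-- The `σ`-algebra generated by one of the primitive random variables. -/
@[reducible] def primAlg (X0 : Ω → StateVec n0 nx) (W : ℕ → Ω → StateVec n0 nx) (ξ : ℕ → Ω → Vec ny)
    (k : Option (ℕ ⊕ ℕ)) : MeasurableSpace Ω :=
  match k with
  | none => MeasurableSpace.comap X0 inferInstance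
  | some (Sum.inl t) => MeasurableSpace.comap (W t) inferInstance
  | some (Sum.inr t) => MeasurableSpace.comap (ξ t) inferInstance

/-- Indices of the primitive random variables realized before time `t`. -/
def pastIdx (t : ℕ) : Set (Option (ℕ ⊕ ℕ)) :=
  {k | ∀ s, k = some (Sum.inl s) ∨ k = some (Sum.inr s) → s < t}

/-- The `σ`-algebra generated by the primitive random variables realized before time `t`. -/
@[reducible] def past (X0 : Ω → StateVec n0 nx) (W : ℕ → Ω → StateVec n0 nx) (ξ : ℕ → Ω → Vec ny)
    (t : ℕ) : MeasurableSpace Ω :=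
  ⨆ k ∈ pastIdx t, primAlg X0 W ξ k

omit mΩ in
lemma past_mono {s t : ℕ} (h : s ≤ t) : past X0 W ξ s ≤ past X0 W ξ t :=
  biSup_mono fun _ hk r hr => (hk r hr).trans_le h

omit mΩ in
lemma measurable_past_X0 (t : ℕ) : Measurable[past X0 W ξ t] X0 :=
  (comap_measurable X0).mono (le_biSup (primAlg X0 W ξ) (i := none)
    (by intro s hs; simp at hs)) le_rfl

omit mΩ in
lemma measurable_past_W {s t : ℕ} (h : s < t) : Measurable[past X0 W ξ t] (W s) :=
  (comap_measurable (W s)).mono (le_biSup (primAlg X0 W ξ) (i := some (Sum.inl s))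
    (by intro r hr; simp at hr; omega)) le_rfl

omit mΩ in
lemma measurable_past_ξ {s t : ℕ} (h : s < t) : Measurable[past X0 W ξ t] (ξ s) :=
  (comap_measurable (ξ s)).mono (le_biSup (primAlg X0 W ξ) (i := some (Sum.inr s))
    (by intro r hr; simp at hr; omega)) le_rfl

namespace Primitives

lemma primAlg_le (h : Primitives μ X0 W ξ) (k : Option (ℕ ⊕ ℕ)) :
    primAlg X0 W ξ k ≤ mΩ := by
  rcases k with (_ | t | t)
  · exact h.measurable_X0.comap_le
  · exact (h.measurable_W t).comap_le
  · exact (h.measurable_ξ t).comap_le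

lemma past_le (h : Primitives μ X0 W ξ) (t : ℕ) : past X0 W ξ t ≤ mΩ :=
  iSup₂_le fun k _ => h.primAlg_le k

lemma indep_past (h : Primitives μ X0 W ξ) {t : ℕ} {k : Option (ℕ ⊕ ℕ)} (hk : k ∉ pastIdx t) :
    Indep (primAlg X0 W ξ k) (past X0 W ξ t) μ := by
  have hi : iIndep (primAlg X0 W ξ) μ := h.indep
  have := indep_iSup_of_disjoint h.primAlg_le hi (S := {k}) (T := pastIdx t)
    (Set.disjoint_singleton_left.2 hk)
  simpa using this

end Primitives

end Independence

-- Conditional means of the disturbances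

namespace Primitives

variable {N n0 ny : ℕ} {nx : Fin N → ℕ} {Ω : Type*} {m : MeasurableSpace Ω}
  [mΩ : MeasurableSpace Ω] {μ : Measure Ω} {X0 : Ω → StateVec n0 nx} {W : ℕ → Ω → StateVec n0 nx}
  {ξ : ℕ → Ω → Vec ny}

/-- The index of `W t` lies outside `pastIdx t`, so `W t` is independent of the past and
conditioning returns its mean, which does not depend on `t`. -/
lemma condExp_W [IsProbabilityMeasure μ] (h : Primitives μ X0 W ξ) (t : ℕ)
    (hm : m ≤ past X0 W ξ t) :
    μ[W t | m] =ᵐ[μ] fun _ => ∫ ω, W 0 ω ∂μ := by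
  have hk : (some (Sum.inl t) : Option (ℕ ⊕ ℕ)) ∉ pastIdx t := fun hk =>
    lt_irrefl t (hk t (Or.inl rfl))
  have hW : ∫ ω, W t ω ∂μ = ∫ ω, W 0 ω ∂μ := (h.ident_W t).integral_eq
  rw [← hW]
  exact condExp_indep_eq (h.primAlg_le (some (Sum.inl t))) (hm.trans (h.past_le t))
    (comap_measurable (W t)).stronglyMeasurable (indep_of_indep_of_le_right (h.indep_past hk) hm)

lemma condExp_ξ [IsProbabilityMeasure μ] (h : Primitives μ X0 W ξ) (t : ℕ)
    (hm : m ≤ past X0 W ξ t) :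
    μ[ξ t | m] =ᵐ[μ] fun _ => ∫ ω, ξ 0 ω ∂μ := by
  have hk : (some (Sum.inr t) : Option (ℕ ⊕ ℕ)) ∉ pastIdx t := fun hk =>
    lt_irrefl t (hk t (Or.inr rfl))
  have hξ : ∫ ω, ξ t ω ∂μ = ∫ ω, ξ 0 ω ∂μ := (h.ident_ξ t).integral_eq
  rw [← hξ]
  exact condExp_indep_eq (h.primAlg_le (some (Sum.inr t))) (hm.trans (h.past_le t))
    (comap_measurable (ξ t)).stronglyMeasurable (indep_of_indep_of_le_right (h.indep_past hk) hm)

end Primitives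

namespace Game

/-! ### The replica process -/

section Replica

variable {N n0 ny : ℕ} {nx nu : Fin N → ℕ} (g : Game N n0 ny nx nu) {Ω : Type*}
  [MeasurableSpace Ω] (P : Measure Ω) (what : StateVec n0 nx) (ξhat : Vec ny)
  (X0 : Ω → StateVec n0 nx) (W : ℕ → Ω → StateVec n0 nx) (ξ : ℕ → Ω → Vec ny)

/-- The replica state. -/
def repState (t : ℕ) : Ω → StateVec n0 nx := (g.replica P what ξhat X0 W ξ t).1

/-- The `σ`-algebra generated by the replica environment variables before time `t`. -/
@[reducible] def repAlg (t : ℕ) : MeasurableSpace Ω :=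
  MeasurableSpace.comap (g.replica P what ξhat X0 W ξ t).2 inferInstance

/-- The conditional expectation of the replica state. -/
def repEst (t : ℕ) : Ω → StateVec n0 nx :=
  P[g.repState P what ξhat X0 W ξ t | g.repAlg P what ξhat X0 W ξ t]

lemma replicaEnv_eq (t : ℕ) (ω : Ω) : g.replicaEnv P what ξhat X0 W ξ t ω =
    g.calD *ᵥ g.repState P what ξhat X0 W ξ t ω
      + (∑' n, g.calGp n * g.a what ξhat n) *ᵥ g.repEst P what ξhat X0 W ξ t ω
      + (∑' n, g.calGp n *ᵥ g.b what ξhat n + g.calHp what) + ξ t ω := by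
  simp only [replicaEnv, replica, Fin.snoc_last]
  rfl

lemma repState_succ (t : ℕ) (ω : Ω) : g.repState P what ξhat X0 W ξ (t + 1) ω =
    g.calA *ᵥ g.repState P what ξhat X0 W ξ t ω
      + (∑' n, g.calGX n * g.a what ξhat n) *ᵥ g.repEst P what ξhat X0 W ξ t ω
      + (∑' n, g.calGX n *ᵥ g.b what ξhat n + g.calHX what)
      + g.calC *ᵥ g.replicaEnv P what ξhat X0 W ξ t ω + W t ω := by
  rw [replicaEnv_eq]
  rfl

lemma replica_snd_succ (t : ℕ) (ω : Ω) : (g.replica P what ξhat X0 W ξ (t + 1)).2 ω =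
    Fin.snoc (α := fun _ => Vec ny) ((g.replica P what ξhat X0 W ξ t).2 ω)
      (g.replicaEnv P what ξhat X0 W ξ t ω) := by
  rw [replicaEnv_eq]
  rfl

lemma replica_snd_apply (t : ℕ) (ω : Ω) (k : Fin t) :
    (g.replica P what ξhat X0 W ξ t).2 ω k = g.replicaEnv P what ξhat X0 W ξ k ω := by
  induction t with
  | zero => exact k.elim0
  | succ t ih =>
    rw [replica_snd_succ]
    refine Fin.lastCases ?_ (fun k => ?_) k
    · simp
    · rw [Fin.snoc_castSucc, ih]
      rfl

lemma measurable_fin_snoc {α : Type*} [MeasurableSpace α] {Ω : Type*} {m : MeasurableSpace Ω}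
    {t : ℕ} {f : Ω → Fin t → α} {h : Ω → α} (hf : Measurable f) (hh : Measurable h) :
    Measurable fun ω => Fin.snoc (α := fun _ => α) (f ω) (h ω) := by
  refine measurable_pi_iff.2 fun k => ?_
  refine Fin.lastCases ?_ (fun k => ?_) k
  · simpa using hh
  · simpa [Function.comp_def] using (measurable_pi_apply k).comp hf

variable {g P what ξhat X0 W ξ}

/-- State and observation history at `t` depend only on the initial state and the disturbances
before `t`. The conditional expectation in the recursion respects this, being measurable with
respect to the observations, which lie in the past. -/
lemma measurable_replica_past (t : ℕ) :
    Measurable[past X0 W ξ t] (g.repState P what ξhat X0 W ξ t) ∧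
      Measurable[past X0 W ξ t] (g.replica P what ξhat X0 W ξ t).2 := by
  induction t with
  | zero =>
    refine ⟨measurable_past_X0 0, ?_⟩
    exact @measurable_const _ _ _ (past X0 W ξ 0) Fin.elim0
  | succ t ih =>
    have hle : past X0 W ξ t ≤ past X0 W ξ (t + 1) := past_mono t.le_succ
    have hX : Measurable[past X0 W ξ (t + 1)] (g.repState P what ξhat X0 W ξ t) :=
      ih.1.mono hle le_rfl
    have hest : Measurable[past X0 W ξ (t + 1)] (g.repEst P what ξhat X0 W ξ t) :=
      (stronglyMeasurable_condExp.measurable).mono (ih.2.comap_le.trans hle) le_rfl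
    have hy : Measurable[past X0 W ξ (t + 1)] (g.replicaEnv P what ξhat X0 W ξ t) := by
      have : g.replicaEnv P what ξhat X0 W ξ t = _ := funext (replicaEnv_eq g P what ξhat X0 W ξ t)
      rw [this]
      exact (((measurable_mulVec _ hX).add (measurable_mulVec _ hest)).add measurable_const).add
        (measurable_past_ξ t.lt_succ_self)
    refine ⟨?_, ?_⟩
    · have : g.repState P what ξhat X0 W ξ (t + 1) = _ :=
        funext (repState_succ g P what ξhat X0 W ξ t)
      rw [this]
      exact ((((measurable_mulVec _ hX).add (measurable_mulVec _ hest)).add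
        measurable_const).add (measurable_mulVec _ hy)).add (measurable_past_W t.lt_succ_self)
    · have : (g.replica P what ξhat X0 W ξ (t + 1)).2 = _ :=
        funext (replica_snd_succ g P what ξhat X0 W ξ t)
      rw [this]
      exact measurable_fin_snoc (ih.2.mono hle le_rfl) hy

lemma repAlg_le_past (t : ℕ) : g.repAlg P what ξhat X0 W ξ t ≤ past X0 W ξ t :=
  (measurable_replica_past t).2.comap_le

lemma measurable_replicaEnv_repAlg {s t : ℕ} (h : s < t) :
    Measurable[g.repAlg P what ξhat X0 W ξ t] (g.replicaEnv P what ξhat X0 W ξ s) := by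
  have h1 : Measurable[g.repAlg P what ξhat X0 W ξ t] (g.replica P what ξhat X0 W ξ t).2 :=
    comap_measurable _
  have h2 := (measurable_pi_apply (⟨s, h⟩ : Fin t)).comp h1
  have h3 : g.replicaEnv P what ξhat X0 W ξ s =
      (fun v : Fin t → Vec ny => v ⟨s, h⟩) ∘ (g.replica P what ξhat X0 W ξ t).2 :=
    funext fun ω => (replica_snd_apply g P what ξhat X0 W ξ t ω ⟨s, h⟩).symm
  rw [h3]
  exact h2

lemma repAlg_mono {s t : ℕ} (h : s ≤ t) :
    g.repAlg P what ξhat X0 W ξ s ≤ g.repAlg P what ξhat X0 W ξ t := by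
  have hm : Measurable[g.repAlg P what ξhat X0 W ξ t] (g.replica P what ξhat X0 W ξ s).2 := by
    refine @measurable_pi_lambda _ _ _ (g.repAlg P what ξhat X0 W ξ t) _ _ fun k => ?_
    simp only [replica_snd_apply]
    exact measurable_replicaEnv_repAlg (k.2.trans_le h)
  exact hm.comap_le

lemma memLp_replicaEnv_of_repState [IsProbabilityMeasure P] (h : Primitives P X0 W ξ) {t : ℕ}
    (ht : MemLp (g.repState P what ξhat X0 W ξ t) 2 P) :
    MemLp (g.replicaEnv P what ξhat X0 W ξ t) 2 P :=
  (memLp_mulVec_add g.calD (∑' n, g.calGp n * g.a what ξhat n)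
    (∑' n, g.calGp n *ᵥ g.b what ξhat n + g.calHp what) ht (ht.condExp (by norm_num))
      (h.memLp_ξ t)).ae_eq
    (Filter.Eventually.of_forall fun ω => (replicaEnv_eq g P what ξhat X0 W ξ t ω).symm)

lemma memLp_repState [IsProbabilityMeasure P] (h : Primitives P X0 W ξ) (t : ℕ) :
    MemLp (g.repState P what ξhat X0 W ξ t) 2 P := by
  induction t with
  | zero => exact h.memLp_X0
  | succ t ih =>
    have h1 := memLp_mulVec_add g.calA (∑' n, g.calGX n * g.a what ξhat n)
      (∑' n, g.calGX n *ᵥ g.b what ξhat n + g.calHX what) ih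
      (ih.condExp (m := g.repAlg P what ξhat X0 W ξ t) (by norm_num))
      (memLp_mulVec g.calC (memLp_replicaEnv_of_repState h ih))
    refine (h1.add (h.memLp_W t)).ae_eq (Filter.Eventually.of_forall fun ω => ?_)
    exact (repState_succ g P what ξhat X0 W ξ t ω).symm

lemma memLp_repEst [IsProbabilityMeasure P] (h : Primitives P X0 W ξ) (t : ℕ) :
    MemLp (g.repEst P what ξhat X0 W ξ t) 2 P :=
  (memLp_repState h t).condExp (by norm_num)

lemma memLp_replicaEnv [IsProbabilityMeasure P] (h : Primitives P X0 W ξ) (t : ℕ) :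
    MemLp (g.replicaEnv P what ξhat X0 W ξ t) 2 P :=
  memLp_replicaEnv_of_repState h (memLp_repState h t)

end Replica

end Game

-- Conditional expectation of affine expressions

section CondExp

variable {ι κ ν : Type*} [Fintype ι] [Fintype κ] [Fintype ν] {Ω : Type*} {m : MeasurableSpace Ω}
  [mΩ : MeasurableSpace Ω] {P : Measure Ω} [IsProbabilityMeasure P]

omit [IsProbabilityMeasure P] in
lemma condExp_mulVec (A : Matrix ι κ ℝ) {f : Ω → κ → ℝ} (hf : Integrable f P) :
    P[fun ω => A *ᵥ f ω | m] =ᵐ[P] fun ω => A *ᵥ P[f | m] ω :=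
  ((mulVecCLM A).comp_condExp_comm hf).symm

omit [IsProbabilityMeasure P] in
lemma integrable_mulVec (A : Matrix ι κ ℝ) {f : Ω → κ → ℝ} (hf : Integrable f P) :
    Integrable (fun ω => A *ᵥ f ω) P := (mulVecCLM A).integrable_comp hf

lemma condExp_mulVec_add (hm : m ≤ mΩ) (A : Matrix ι κ ℝ) (B : Matrix ι ν ℝ) (c : ι → ℝ)
    {f : Ω → κ → ℝ} {h : Ω → ν → ℝ} {k : Ω → ι → ℝ} (hf : Integrable f P) (hh : Integrable h P)
    (hh' : StronglyMeasurable[m] h) (hk : Integrable k P) :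
    P[fun ω => A *ᵥ f ω + B *ᵥ h ω + c + k ω | m] =ᵐ[P]
      fun ω => A *ᵥ P[f | m] ω + B *ᵥ h ω + c + P[k | m] ω := by
  have h1 := integrable_mulVec A hf
  have h2 := integrable_mulVec B hh
  have e1 := condExp_add ((h1.add h2).add (integrable_const c)) hk m
  have e2 := condExp_add (h1.add h2) (integrable_const c) m
  have e3 := condExp_add h1 h2 m
  have e4 := condExp_mulVec (m := m) A hf
  have e5 := condExp_mulVec (m := m) B hh
  have e6 : P[h | m] = h := condExp_of_stronglyMeasurable hm hh' hh
  have e7 : P[fun _ : Ω => c | m] = fun _ => c := condExp_const hm c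
  rw [e6] at e5
  refine e1.trans ?_
  filter_upwards [e2, e3, e4, e5] with ω w2 w3 w4 w5
  rw [Pi.add_apply, w2, Pi.add_apply, w3, Pi.add_apply, w4, w5, e7]

end CondExp

-- Forecasts of the replica environment and their mean squares

namespace Game

variable {N n0 ny : ℕ} {nx nu : Fin N → ℕ} {g : Game N n0 ny nx nu} {Ω : Type*}
  [mΩ : MeasurableSpace Ω] {P : Measure Ω} [IsProbabilityMeasure P] {what : StateVec n0 nx}
  {ξhat : Vec ny} {X0 : Ω → StateVec n0 nx} {W : ℕ → Ω → StateVec n0 nx} {ξ : ℕ → Ω → Vec ny}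

omit [IsProbabilityMeasure P] in
lemma repAlg_le (h : Primitives P X0 W ξ) (t : ℕ) : g.repAlg P what ξhat X0 W ξ t ≤ mΩ :=
  (repAlg_le_past t).trans (h.past_le t)

/-- The estimate is known and the current disturbance is independent of the past, so conditioning
changes only the state, into its estimate, and the disturbance, into its mean. -/
lemma condExp_replicaEnv (h : Primitives P X0 W ξ) (hξ : ξhat = ∫ ω, ξ 0 ω ∂P) (t : ℕ) :
    P[g.replicaEnv P what ξhat X0 W ξ t | g.repAlg P what ξhat X0 W ξ t] =ᵐ[P]
      fun ω => g.meanEnv what ξhat (g.repEst P what ξhat X0 W ξ t ω) := by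
  have e := condExp_mulVec_add (repAlg_le (g := g) (what := what) (ξhat := ξhat) h t) g.calD
    (∑' n, g.calGp n * g.a what ξhat n) (∑' n, g.calGp n *ᵥ g.b what ξhat n + g.calHp what)
    ((memLp_repState (g := g) (what := what) (ξhat := ξhat) h t).integrable (by norm_num))
    ((memLp_repEst (g := g) (what := what) (ξhat := ξhat) h t).integrable (by norm_num))
    stronglyMeasurable_condExp ((h.memLp_ξ t).integrable (by norm_num))
  have e0 : g.replicaEnv P what ξhat X0 W ξ t = _ := funext (replicaEnv_eq g P what ξhat X0 W ξ t)
  rw [e0]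
  refine e.trans ?_
  filter_upwards [h.condExp_ξ t (repAlg_le_past (g := g) (P := P) (what := what) (ξhat := ξhat) t)]
    with ω w
  rw [w, ← hξ]
  rfl

lemma condExp_repState_succ (h : Primitives P X0 W ξ) (hW : what = ∫ ω, W 0 ω ∂P)
    (hξ : ξhat = ∫ ω, ξ 0 ω ∂P) (t : ℕ) :
    P[g.repState P what ξhat X0 W ξ (t + 1) | g.repAlg P what ξhat X0 W ξ t] =ᵐ[P]
      fun ω => g.meanNext what ξhat (g.repEst P what ξhat X0 W ξ t ω) := by
  have iy := (memLp_replicaEnv (g := g) (what := what) (ξhat := ξhat) h t).integrable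
    (q := 2) (by norm_num)
  have iW := (h.memLp_W t).integrable (by norm_num)
  have e := condExp_mulVec_add (repAlg_le (g := g) (what := what) (ξhat := ξhat) h t) g.calA
    (∑' n, g.calGX n * g.a what ξhat n) (∑' n, g.calGX n *ᵥ g.b what ξhat n + g.calHX what)
    ((memLp_repState (g := g) (what := what) (ξhat := ξhat) h t).integrable (by norm_num))
    ((memLp_repEst (g := g) (what := what) (ξhat := ξhat) h t).integrable (by norm_num))
    stronglyMeasurable_condExp ((integrable_mulVec g.calC iy).add iW)
  have e0 : g.repState P what ξhat X0 W ξ (t + 1) = _ := funext fun ω =>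
    (repState_succ g P what ξhat X0 W ξ t ω).trans (add_assoc _ _ _)
  rw [e0]
  refine e.trans ?_
  filter_upwards [h.condExp_W t (repAlg_le_past (g := g) (P := P) (what := what) (ξhat := ξhat) t),
    condExp_add (integrable_mulVec g.calC iy) iW (g.repAlg P what ξhat X0 W ξ t),
    condExp_mulVec (m := g.repAlg P what ξhat X0 W ξ t) g.calC iy,
    condExp_replicaEnv h hξ t] with ω w1 w2 w3 w4
  rw [w2, Pi.add_apply, w3, w1, w4, ← hW, ← add_assoc]
  rfl

/-- Tower property: today's forecast of tomorrow's estimate is today's forecast of tomorrow's state.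
-/
lemma condExp_repEst_succ (h : Primitives P X0 W ξ) (hW : what = ∫ ω, W 0 ω ∂P)
    (hξ : ξhat = ∫ ω, ξ 0 ω ∂P) (t : ℕ) :
    P[g.repEst P what ξhat X0 W ξ (t + 1) | g.repAlg P what ξhat X0 W ξ t] =ᵐ[P]
      fun ω => g.meanNext what ξhat (g.repEst P what ξhat X0 W ξ t ω) :=
  (condExp_condExp_of_le (repAlg_mono t.le_succ) (repAlg_le h (t + 1))).trans
    (condExp_repState_succ h hW hξ t)

/-- Forecasts of the replica environment variables are no larger in mean square than the
environment variables themselves. -/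
lemma eLpNorm_meanSolution_repEst_le (h : Primitives P X0 W ξ) (hW : what = ∫ ω, W 0 ω ∂P)
    (hξ : ξhat = ∫ ω, ξ 0 ω ∂P) (hAB : ∀ i, IsStabilizable (g.A i) (g.B i))
    (hs : g.MeanSolvable what ξhat) (n t : ℕ) :
    eLpNorm (fun ω => g.meanSolution what ξhat (g.repEst P what ξhat X0 W ξ t ω) n) 2 P ≤
      eLpNorm (g.replicaEnv P what ξhat X0 W ξ (t + n)) 2 P := by
  induction n generalizing t with
  | zero =>
    simp only [hs.meanSolution_zero hAB]
    rw [← eLpNorm_congr_ae (condExp_replicaEnv h hξ t)]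
    exact eLpNorm_condExp_le_eLpNorm _ (by norm_num)
  | succ n ih =>
    -- A forecast `n + 1` steps ahead is the conditional expectation of the forecast `n` steps ahead
    -- made one period later, and conditioning contracts the `L²` norm.
    have e1 : (fun ω => g.meanSolution what ξhat (g.repEst P what ξhat X0 W ξ t ω) (n + 1)) =ᵐ[P]
        P[fun ω => g.meanSolution what ξhat (g.repEst P what ξhat X0 W ξ (t + 1) ω) n |
          g.repAlg P what ξhat X0 W ξ t] := by
      have e2 := (mulVecCLM (g.a what ξhat n)).comp_condExp_add_const_comm
        (repAlg_le (g := g) (what := what) (ξhat := ξhat) h t)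
        ((memLp_repEst (g := g) (what := what) (ξhat := ξhat) h (t + 1)).integrable (by norm_num))
        (g.b what ξhat n)
      simp only [mulVecCLM_apply, ← hs.meanSolution_eq] at e2
      refine Filter.EventuallyEq.trans ?_ e2
      filter_upwards [condExp_repEst_succ h hW hξ t] with ω w
      rw [w, hs.meanSolution_meanNext hAB]
    rw [eLpNorm_congr_ae e1]
    refine (eLpNorm_condExp_le_eLpNorm _ (by norm_num)).trans ((ih (t + 1)).trans (le_of_eq ?_))
    congr 2
    ring

lemma norm_mulVec_le_sum {ι κ : Type*} [Fintype ι] [Fintype κ] (A : Matrix ι κ ℝ) (v : κ → ℝ) :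
    ‖A *ᵥ v‖ ≤ (∑ i, ∑ j, |A i j|) * ‖v‖ := by
  refine (pi_norm_le_iff_of_nonneg (by positivity)).2 fun i => ?_
  have h1 : ∑ j, |A i j| ≤ ∑ i, ∑ j, |A i j| :=
    Finset.single_le_sum (f := fun i => ∑ j, |A i j|) (fun _ _ => by positivity) (Finset.mem_univ i)
  refine le_trans ?_ (mul_le_mul_of_nonneg_right h1 (norm_nonneg v))
  rw [Finset.sum_mul]
  refine (Finset.abs_sum_le_sum_abs _ _).trans (Finset.sum_le_sum fun j _ => ?_)
  rw [abs_mul]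
  exact mul_le_mul_of_nonneg_left (norm_le_pi_norm v j) (abs_nonneg _)

omit [IsProbabilityMeasure P] in
/-- A weighted sum of random vectors bounded in mean square, with absolutely summable weights, is
bounded in mean square. -/
lemma eLpNorm_tsum_mulVec_le {ι κ : Type*} [Fintype ι] [Fintype κ] {f : ℕ → Matrix ι κ ℝ}
    {y : ℕ → Ω → κ → ℝ} (hy : ∀ n, AEStronglyMeasurable (y n) P)
    (hsum : ∀ ω, Summable fun n => f n *ᵥ y n ω) {c : ℝ≥0∞} (hc : ∀ n, eLpNorm (y n) 2 P ≤ c)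
    (hf : AbsSummable f) :
    eLpNorm (fun ω => ∑' n, f n *ᵥ y n ω) 2 P ≤
      ENNReal.ofReal (∑' n, ∑ i, ∑ j, |f n i j|) * c := by
  have hk : Summable fun n => ∑ i, ∑ j, |f n i j| :=
    summable_sum fun i _ => summable_sum fun j _ => hf i j
  have hk0 : ∀ n, 0 ≤ ∑ i, ∑ j, |f n i j| := fun n => by positivity
  have hmeas : ∀ n, AEStronglyMeasurable (fun ω => f n *ᵥ y n ω) P := fun n =>
    (mulVecCLM (f n)).continuous.comp_aestronglyMeasurable (hy n)
  have hterm : ∀ n, eLpNorm (fun ω => f n *ᵥ y n ω) 2 P ≤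
      ENNReal.ofReal (∑ i, ∑ j, |f n i j|) * c := fun n =>
    (eLpNorm_le_mul_eLpNorm_of_ae_le_mul
      (Filter.Eventually.of_forall fun ω => norm_mulVec_le_sum (f n) (y n ω)) 2).trans
      (mul_le_mul_right (hc n) _)
  have hpart : ∀ m, eLpNorm (∑ n ∈ Finset.range m, fun ω => f n *ᵥ y n ω) 2 P ≤
      ENNReal.ofReal (∑' n, ∑ i, ∑ j, |f n i j|) * c := by
    intro m
    refine (eLpNorm_sum_le (fun n _ => hmeas n) (by norm_num)).trans ?_
    refine (Finset.sum_le_sum fun n _ => hterm n).trans ?_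
    rw [← Finset.sum_mul, ← ENNReal.ofReal_sum_of_nonneg fun n _ => hk0 n]
    gcongr
    exact hk.sum_le_tsum _ fun n _ => hk0 n
  -- Fatou in `L²`: the partial sums converge pointwise and satisfy the bound uniformly.
  refine (Lp.eLpNorm_lim_le_liminf_eLpNorm
    (f := fun m => ∑ n ∈ Finset.range m, fun ω => f n *ᵥ y n ω)
    (fun m => Finset.aestronglyMeasurable_sum _ fun n _ => hmeas n) _
    (Filter.Eventually.of_forall fun ω => ?_)).trans ?_
  · simpa only [Finset.sum_apply] using (hsum ω).hasSum.tendsto_sum_nat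
  · exact Filter.liminf_le_of_frequently_le' (Filter.Frequently.of_forall hpart)

/-- The affine expression in the estimate would give no bound uniform in `t`, since only the
environment variables are bounded in mean square. The forecast series does: each forecast is
dominated by the variable it forecasts, and the weights are summable. -/
lemma exists_eLpNorm_costate_le (h : Primitives P X0 W ξ) (hW : what = ∫ ω, W 0 ω ∂P)
    (hξ : ξhat = ∫ ω, ξ 0 ω ∂P) (hAB : ∀ i, IsStabilizable (g.A i) (g.B i))
    (hs : g.MeanSolvable what ξhat) {c : ℝ≥0∞} (hc : c ≠ ⊤)
    (hy : ∀ t, eLpNorm (g.replicaEnv P what ξhat X0 W ξ t) 2 P ≤ c) (i : Fin N) :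
    ∃ d : ℝ≥0∞, d ≠ ⊤ ∧ ∀ t,
      eLpNorm (fun ω => g.costate what ξhat i (g.repEst P what ξhat X0 W ξ t ω)) 2 P ≤ d := by
  have hf := (absSummable_pow_Φ (hAB i)).mul_right (g.envWeight i)
  have hm : ∀ t n, AEStronglyMeasurable
      (fun ω => g.meanSolution what ξhat (g.repEst P what ξhat X0 W ξ t ω) n) P := by
    intro t n
    simp only [hs.meanSolution_eq]
    exact ((mulVecCLM (g.a what ξhat n)).continuous.comp_aestronglyMeasurable
      (memLp_repEst h t).1).add_const _
  have hsum : ∀ t ω, Summable fun n => (g.Φ i ^ n * g.envWeight i) *ᵥ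
      g.meanSolution what ξhat (g.repEst P what ξhat X0 W ξ t ω) n := fun t ω => by
    obtain ⟨b, hb⟩ := hs.exists_bound (g.repEst P what ξhat X0 W ξ t ω)
    exact hf.summable_mulVec hb
  have hb := fun t => eLpNorm_tsum_mulVec_le (hm t) (hsum t)
    (fun n => (eLpNorm_meanSolution_repEst_le h hW hξ hAB hs n t).trans (hy (t + n))) hf
  refine ⟨ENNReal.ofReal (∑' n, ∑ r, ∑ s,
      |(g.Φ i ^ n * g.envWeight i : Matrix (Fin (nx i)) (Fin ny) ℝ) r s|) * c
    + eLpNorm (fun _ : Ω => g.Φ i *ᵥ g.noiseCostate what i) 2 P, ?_, fun t => ?_⟩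
  · exact ENNReal.add_ne_top.2 ⟨ENNReal.mul_ne_top ENNReal.ofReal_ne_top hc,
      (memLp_const _).eLpNorm_ne_top⟩
  · have hmt : AEStronglyMeasurable (fun ω => ∑' n, (g.Φ i ^ n * g.envWeight i) *ᵥ
        g.meanSolution what ξhat (g.repEst P what ξhat X0 W ξ t ω) n) P := by
      simp only [hs.tsum_mulVec_meanSolution hf]
      exact ((mulVecCLM _).continuous.comp_aestronglyMeasurable
        (memLp_repEst h t).1).add_const _
    exact (eLpNorm_add_le hmt aestronglyMeasurable_const (by norm_num)).trans
      (add_le_add (hb t) le_rfl)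

end Game

namespace Game

variable {N n0 ny : ℕ} {nx nu : Fin N → ℕ} {g : Game N n0 ny nx nu}

/-! ### The joint system in vector form -/

section JointSystem

variable {what : StateVec n0 nx} {ξhat : Vec ny}

lemma calD_mulVec (X : StateVec n0 nx) :
    g.calD *ᵥ X = g.D *ᵥ envPart X + ∑ i, (g.E1 i *ᵥ (g.F i *ᵥ own i X) + g.E2 i *ᵥ own i X) := by
  funext r
  simp only [mulVec_mulVec, ← add_mulVec, Pi.add_apply, Finset.sum_apply, mulVec, dotProduct,
    calD, Fintype.sum_sum_type, Fintype.sum_sigma, fromCols_apply_inl, fromCols_apply_inr,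
    of_apply, envPart, own]

lemma calA_mulVec_inl (X : StateVec n0 nx) (r : Fin n0) :
    (g.calA *ᵥ X) (Sum.inl r) = (g.A0 *ᵥ envPart X +
      ∑ i, (g.B1 i *ᵥ (g.F i *ᵥ own i X) + g.B2 i *ᵥ own i X)) r := by
  simp only [mulVec_mulVec, ← add_mulVec, Pi.add_apply, Finset.sum_apply, mulVec, dotProduct,
    calA, Fintype.sum_sum_type, Fintype.sum_sigma, fromBlocks_apply₁₁, fromBlocks_apply₁₂,
    of_apply, envPart, own]

lemma calA_mulVec_inr (X : StateVec n0 nx) (i : Fin N) (r : Fin (nx i)) :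
    (g.calA *ᵥ X) (Sum.inr ⟨i, r⟩) = (g.A i *ᵥ own i X + g.B i *ᵥ (g.F i *ᵥ own i X)) r := by
  rw [mulVec_mulVec, ← add_mulVec]
  simp only [mulVec, dotProduct, calA, Fintype.sum_sum_type, Fintype.sum_sigma,
    fromBlocks_apply₂₁, fromBlocks_apply₂₂, Matrix.zero_apply, zero_mul, Finset.sum_const_zero,
    zero_add, own]
  rw [Finset.sum_eq_single i]
  · refine Finset.sum_congr rfl fun s _ => ?_
    rw [blockDiagonal'_apply_eq]
  · intro j _ hj
    refine Finset.sum_eq_zero fun s _ => ?_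
    rw [blockDiagonal'_apply_ne _ _ _ (Ne.symm hj), zero_mul]
  · simp

lemma calC_mulVec_inl (y : Vec ny) (r : Fin n0) : (g.calC *ᵥ y) (Sum.inl r) = 0 := by
  simp [calC, mulVec, dotProduct]

lemma calC_mulVec_inr (y : Vec ny) (i : Fin N) (r : Fin (nx i)) :
    (g.calC *ᵥ y) (Sum.inr ⟨i, r⟩) = (g.C i *ᵥ y) r := by
  simp [calC, mulVec, dotProduct]

/-- The finite sum over players is exchanged with the convergent forecast series; thus the aggregate
coefficients of the replica match what the players actually play. -/
lemma MeanSolvable.env_feedforward (hs : g.MeanSolvable what ξhat)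
    (hAB : ∀ i, IsStabilizable (g.A i) (g.B i)) (x : StateVec n0 nx) :
    (∑' n, g.calGp n * g.a what ξhat n) *ᵥ x + (∑' n, g.calGp n *ᵥ g.b what ξhat n + g.calHp what)
      = ∑ i, g.E1 i *ᵥ (g.G what ξhat i *ᵥ x + g.checkH what ξhat i) := by
  obtain ⟨c, hc⟩ := hs.exists_bound x
  have hsum := fun i => (absSummable_Gn (hAB i)).summable_mulVec hc
  rw [← add_assoc, ← hs.tsum_mulVec_meanSolution (absSummable_calGp hAB)]
  simp only [hs.input_eq hAB, mulVec_add, Finset.sum_add_distrib, calHp]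
  congr 1
  simp only [mulVec_tsum _ (hsum _)]
  rw [← Summable.tsum_finsetSum fun i _ => ?_]
  · refine tsum_congr fun n => ?_
    simp only [calGp, sum_mulVec, mulVec_mulVec]
  · exact (hsum i).map (g.E1 i).mulVecLin
      (Continuous.matrix_mulVec continuous_const continuous_id)

lemma MeanSolvable.state_feedforward (hs : g.MeanSolvable what ξhat)
    (hAB : ∀ i, IsStabilizable (g.A i) (g.B i)) (x : StateVec n0 nx) :
    (∑' n, g.calGX n * g.a what ξhat n) *ᵥ x + (∑' n, g.calGX n *ᵥ g.b what ξhat n + g.calHX what)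
      = Sum.elim (∑ i, g.B1 i *ᵥ (g.G what ξhat i *ᵥ x + g.checkH what ξhat i))
        (fun p => (g.B p.1 *ᵥ (g.G what ξhat p.1 *ᵥ x + g.checkH what ξhat p.1)) p.2) := by
  obtain ⟨c, hc⟩ := hs.exists_bound x
  have hsum := fun i => (absSummable_Gn (hAB i)).summable_mulVec hc
  have hsumX := (absSummable_calGX hAB).summable_mulVec hc
  rw [← add_assoc, ← hs.tsum_mulVec_meanSolution (absSummable_calGX hAB)]
  simp only [hs.input_eq hAB, mulVec_add, Finset.sum_add_distrib, mulVec_tsum _ (hsum _)]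
  have hs2 : ∀ i, Summable fun n => g.B1 i *ᵥ (g.Gn i n *ᵥ g.meanSolution what ξhat x n) :=
    fun i => (hsum i).map (g.B1 i).mulVecLin
      (Continuous.matrix_mulVec continuous_const continuous_id)
  have hs3 : ∀ i, Summable fun n => g.B i *ᵥ (g.Gn i n *ᵥ g.meanSolution what ξhat x n) :=
    fun i => (hsum i).map (g.B i).mulVecLin
      (Continuous.matrix_mulVec continuous_const continuous_id)
  funext q
  rw [Pi.add_apply, tsum_apply hsumX]
  rcases q with r | ⟨i, r⟩
  · simp only [calHX, Sum.elim_inl, Pi.add_apply]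
    congr 1
    rw [← Summable.tsum_finsetSum fun i _ => hs2 i, tsum_apply (summable_sum fun i _ => hs2 i)]
    refine tsum_congr fun n => ?_
    rw [calGX, fromRows_mulVec]
    simp only [Sum.elim_inl, sum_mulVec, mulVec_mulVec]
  · simp only [calHX, Sum.elim_inr, Pi.add_apply]
    congr 1
    rw [tsum_apply (hs3 i)]
    refine tsum_congr fun n => ?_
    rw [calGX, fromRows_mulVec, mulVec_mulVec]
    rfl

end JointSystem

-- The closed loop and its coincidence with the replica

section ClosedLoop

variable {what : StateVec n0 nx} {ξhat : Vec ny}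
  {est : ∀ t : ℕ, (Fin t → Vec ny) → StateVec n0 nx} {hest : ∀ t, Measurable (est t)}

lemma envPath_affineProfile (hs : g.MeanSolvable what ξhat)
    (hAB : ∀ i, IsStabilizable (g.A i) (g.B i)) (X0 : StateVec n0 nx) (W : ℕ → StateVec n0 nx)
    (ξ : ℕ → Vec ny) (t : ℕ) :
    g.envPath (g.affineProfile what ξhat est hest) X0 W ξ t =
      g.calD *ᵥ (g.closedLoop (g.affineProfile what ξhat est hest) X0 W ξ t).1 (Fin.last t)
        + (∑' n, g.calGp n * g.a what ξhat n) *ᵥ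
          est t (g.closedLoop (g.affineProfile what ξhat est hest) X0 W ξ t).2.2
        + (∑' n, g.calGp n *ᵥ g.b what ξhat n + g.calHp what) + ξ t := by
  rw [add_assoc (g.calD *ᵥ _), hs.env_feedforward hAB, calD_mulVec]
  simp only [envPath, closedLoop, Fin.snoc_last, affineProfile, mulVec_add, Finset.sum_add_distrib]
  abel

lemma closedLoop_succ_env (s : g.Profile) (X0 : StateVec n0 nx) (W : ℕ → StateVec n0 nx)
    (ξ : ℕ → Vec ny) (t : ℕ) :
    (g.closedLoop s X0 W ξ (t + 1)).2.2 = Fin.snoc (α := fun _ => Vec ny)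
      (g.closedLoop s X0 W ξ t).2.2 (g.envPath s X0 W ξ t) := by
  simp only [envPath, closedLoop, Fin.snoc_last]

lemma closedLoop_succ_state (hs : g.MeanSolvable what ξhat)
    (hAB : ∀ i, IsStabilizable (g.A i) (g.B i)) (X0 : StateVec n0 nx) (W : ℕ → StateVec n0 nx)
    (ξ : ℕ → Vec ny) (t : ℕ) :
    (g.closedLoop (g.affineProfile what ξhat est hest) X0 W ξ (t + 1)).1 (Fin.last (t + 1)) =
      g.calA *ᵥ (g.closedLoop (g.affineProfile what ξhat est hest) X0 W ξ t).1 (Fin.last t)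
        + (∑' n, g.calGX n * g.a what ξhat n) *ᵥ
          est t (g.closedLoop (g.affineProfile what ξhat est hest) X0 W ξ t).2.2
        + (∑' n, g.calGX n *ᵥ g.b what ξhat n + g.calHX what)
        + g.calC *ᵥ g.envPath (g.affineProfile what ξhat est hest) X0 W ξ t + W t := by
  rw [add_assoc (g.calA *ᵥ _), hs.state_feedforward hAB]
  simp only [envPath, closedLoop, Fin.snoc_last]
  congr 1
  funext q
  rcases q with r | ⟨i, r⟩
  · simp only [Pi.add_apply, calA_mulVec_inl, calC_mulVec_inl, Sum.elim_inl, affineProfile,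
      mulVec_add, Finset.sum_add_distrib]
    ring
  · simp only [Pi.add_apply, calA_mulVec_inr, calC_mulVec_inr, Sum.elim_inr, affineProfile,
      mulVec_add, Finset.sum_add_distrib]
    ring

variable {Ω : Type*} [MeasurableSpace Ω]

lemma measurable_own (i : Fin N) : Measurable (own i : StateVec n0 nx → Vec (nx i)) :=
  measurable_pi_lambda _ fun _ => measurable_pi_apply _

lemma measurable_envPart : Measurable (envPart : StateVec n0 nx → Vec n0) :=
  measurable_pi_lambda _ fun _ => measurable_pi_apply _

lemma measurable_closedLoop (s : g.Profile) (t : ℕ) :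
    Measurable fun V : StateVec n0 nx × (ℕ → Vec ny) × (ℕ → StateVec n0 nx) =>
      g.closedLoop s V.1 V.2.2 V.2.1 t := by
  induction t with
  | zero =>
    refine (measurable_pi_lambda _ fun _ => measurable_fst).prodMk
      (measurable_const.prodMk measurable_const)
  | succ t ih =>
    have h1 := ih.fst
    have h2 := ih.snd.fst
    have h3 := ih.snd.snd
    have hX : Measurable fun V : StateVec n0 nx × (ℕ → Vec ny) × (ℕ → StateVec n0 nx) =>
        (g.closedLoop s V.1 V.2.2 V.2.1 t).1 (Fin.last t) := (measurable_pi_apply _).comp h1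
    have hu : ∀ i, Measurable fun V : StateVec n0 nx × (ℕ → Vec ny) × (ℕ → StateVec n0 nx) =>
        (s i).act t (fun k => own i ((g.closedLoop s V.1 V.2.2 V.2.1 t).1 k),
          fun k => (g.closedLoop s V.1 V.2.2 V.2.1 t).2.1 k i,
          (g.closedLoop s V.1 V.2.2 V.2.1 t).2.2) := by
      intro i
      refine ((s i).measurable_act t).comp (Measurable.prodMk ?_ (Measurable.prodMk ?_ h3))
      · exact measurable_pi_lambda _ fun k =>
          (measurable_own i).comp ((measurable_pi_apply k).comp h1)
      · exact measurable_pi_lambda _ fun k =>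
          (measurable_pi_apply i).comp ((measurable_pi_apply k).comp h2)
    have hown := fun i => (measurable_own i).comp hX
    have henv := measurable_envPart.comp hX
    have hy := ((measurable_mulVec g.D henv).add (Finset.measurable_sum Finset.univ fun i _ =>
      (measurable_mulVec (g.E1 i) (hu i)).add (measurable_mulVec (g.E2 i) (hown i)))).add
      ((measurable_pi_apply t).comp (measurable_fst.comp measurable_snd))
    have hx0 := (measurable_mulVec g.A0 henv).add (Finset.measurable_sum Finset.univ fun i _ =>
      (measurable_mulVec (g.B1 i) (hu i)).add (measurable_mulVec (g.B2 i) (hown i)))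
    have hx := fun i => ((measurable_mulVec (g.A i) (hown i)).add
      (measurable_mulVec (g.B i) (hu i))).add (measurable_mulVec (g.C i) hy)
    refine Measurable.prodMk (measurable_fin_snoc h1 (Measurable.add
      (measurable_pi_lambda _ fun q => ?_) ((measurable_pi_apply t).comp
        (measurable_snd.comp measurable_snd)))) (Measurable.prodMk (measurable_fin_snoc h2
          (measurable_pi_lambda _ hu)) (measurable_fin_snoc h3 ?_))
    · rcases q with r | ⟨i, r⟩
      · convert (measurable_pi_apply r).comp hx0 using 1
        funext V
        simp
      · convert (measurable_pi_apply r).comp (hx i) using 1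
        funext V
        simp
    · convert hy using 1
      funext V
      simp

lemma measurable_envPath (s : g.Profile) :
    Measurable fun V : StateVec n0 nx × (ℕ → Vec ny) × (ℕ → StateVec n0 nx) =>
      g.envPath s V.1 V.2.2 V.2.1 :=
  measurable_pi_lambda _ fun t =>
    (measurable_pi_apply (Fin.last t)).comp (measurable_closedLoop s (t + 1)).snd.snd

/-- Each `est t` may fail on a null set, and there are countably many of them. Outside their union
the closed loop and the replica satisfy the same recursion from the same primitives. -/
lemma ae_envPath_eq_replicaEnv {P : Measure Ω} (hs : g.MeanSolvable what ξhat)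
    (hAB : ∀ i, IsStabilizable (g.A i) (g.B i)) {X0 : Ω → StateVec n0 nx}
    {W : ℕ → Ω → StateVec n0 nx} {ξ : ℕ → Ω → Vec ny}
    (he : g.IsEstimator P what ξhat X0 W ξ est) :
    ∀ᵐ ω ∂P, ∀ t, g.envPath (g.affineProfile what ξhat est hest) (X0 ω) (fun t => W t ω)
      (fun t => ξ t ω) t = g.replicaEnv P what ξhat X0 W ξ t ω := by
  filter_upwards [ae_all_iff.2 he.ae_eq] with ω hω
  have key : ∀ t, (g.closedLoop (g.affineProfile what ξhat est hest) (X0 ω) (fun t => W t ω)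
        (fun t => ξ t ω) t).1 (Fin.last t) = g.repState P what ξhat X0 W ξ t ω ∧
      (g.closedLoop (g.affineProfile what ξhat est hest) (X0 ω) (fun t => W t ω)
        (fun t => ξ t ω) t).2.2 = (g.replica P what ξhat X0 W ξ t).2 ω := by
    intro t
    induction t with
    | zero => exact ⟨rfl, funext fun k => k.elim0⟩
    | succ t ih =>
      have hy : g.envPath (g.affineProfile what ξhat est hest) (X0 ω) (fun t => W t ω)
          (fun t => ξ t ω) t = g.replicaEnv P what ξhat X0 W ξ t ω := by
        rw [envPath_affineProfile hs hAB, ih.1, ih.2, hω t, replicaEnv_eq]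
        rfl
      refine ⟨?_, ?_⟩
      · rw [closedLoop_succ_state hs hAB, ih.1, ih.2, hω t, hy, repState_succ]
        rfl
      · rw [closedLoop_succ_env, ih.2, hy, replica_snd_succ]
  intro t
  rw [envPath_affineProfile hs hAB, (key t).1, (key t).2, hω t, replicaEnv_eq]
  rfl

/-- The environment variables generated by the estimator-based profile have the distribution of the
replica environment variables. -/
lemma envLaw_affineProfile {μ : Measure Ω} {X0 : Ω → StateVec n0 nx}
    {W : ℕ → Ω → StateVec n0 nx} {ξ : ℕ → Ω → Vec ny} {Ω' : Type*} [MeasurableSpace Ω']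
    {P : Measure Ω'} {X0' : Ω' → StateVec n0 nx} {W' : ℕ → Ω' → StateVec n0 nx}
    {ξ' : ℕ → Ω' → Vec ny} (hs : g.MeanSolvable what ξhat)
    (hAB : ∀ i, IsStabilizable (g.A i) (g.B i))
    (hident : IdentDistrib (fun ω' => (X0' ω', fun t => ξ' t ω', fun t => W' t ω'))
      (fun ω => (X0 ω, fun t => ξ t ω, fun t => W t ω)) P μ)
    (he : g.IsEstimator P what ξhat X0' W' ξ' est) :
    g.envLaw μ X0 W ξ (g.affineProfile what ξhat est hest) =
      P.map (fun ω t => g.replicaEnv P what ξhat X0' W' ξ' t ω) := by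
  -- The path is one measurable function of all primitives, so equality of their joint laws carries
  -- the law of the closed loop from `μ` to `P`.
  have h := (hident.comp (measurable_envPath (g.affineProfile what ξhat est hest))).map_eq
  refine Eq.trans h.symm (Measure.map_congr ?_)
  filter_upwards [ae_envPath_eq_replicaEnv (hest := hest) hs hAB he] with ω hω
  exact funext hω

end ClosedLoop

end Game

/-! ### Extended-real sums and expectations -/

section EReal

/-- Only the subtrahends must be finite: if one minuend is infinite, so is the other, and both
differences are `⊤`. -/
lemma coe_sub_coe_eq {a b p d : ℝ≥0∞} (h : a + d = p + b) (hb : b ≠ ⊤) (hd : d ≠ ⊤) :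
    (a : EReal) - (b : EReal) = (p : EReal) - (d : EReal) := by
  lift b to NNReal using hb
  lift d to NNReal using hd
  induction a with
  | top =>
    have : p = ⊤ := by
      by_contra hp
      rw [top_add] at h
      exact ENNReal.add_ne_top.2 ⟨hp, ENNReal.coe_ne_top⟩ h.symm
    rw [this]
    simp only [EReal.coe_ennreal_top, EReal.coe_nnreal_eq_coe_real]
    rw [EReal.top_sub_coe, EReal.top_sub_coe]
  | coe a =>
    have hp : p ≠ ⊤ := by
      rintro rfl
      rw [top_add] at h
      exact ENNReal.add_ne_top.2 ⟨ENNReal.coe_ne_top, ENNReal.coe_ne_top⟩ h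
    lift p to NNReal using hp
    have h' : (a : ℝ) + d = p + b := by exact_mod_cast h
    simp only [EReal.coe_nnreal_eq_coe_real]
    rw [← EReal.coe_sub, ← EReal.coe_sub]
    congr 1
    linarith

/-- Positive and negative parts of `p - d` are truncated differences, and adding back `d` or `p`
gives `max p d` either way. The series of `p` may diverge, so infinite costs are covered. -/
lemma esum_sub {p d : ℕ → ℝ} (hp : ∀ t, 0 ≤ p t) (hd : ∀ t, 0 ≤ d t)
    (hsum : ∑' t, ENNReal.ofReal (d t) ≠ ⊤) :
    esum (fun t => p t - d t) =
      ((∑' t, ENNReal.ofReal (p t) : ℝ≥0∞) : EReal) -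
        ((∑' t, ENNReal.ofReal (d t) : ℝ≥0∞) : EReal) := by
  refine coe_sub_coe_eq ?_ ?_ hsum
  · rw [← ENNReal.tsum_add, ← ENNReal.tsum_add]
    refine tsum_congr fun t => ?_
    rw [neg_sub, ENNReal.ofReal_sub _ (hd t), ENNReal.ofReal_sub _ (hp t), tsub_add_eq_max,
      add_tsub_eq_max]
  · refine ne_top_of_le_ne_top hsum (ENNReal.tsum_le_tsum fun t => ENNReal.ofReal_le_ofReal ?_)
    linarith [hp t]

lemma eexp_sub {Ω : Type*} [MeasurableSpace Ω] {ν : Measure Ω} {f : Ω → EReal} {p d : Ω → ℝ≥0∞}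
    (hp : Measurable p) (hd : Measurable d) (hInt : ∫⁻ ω, d ω ∂ν ≠ ⊤)
    (hf : ∀ᵐ ω ∂ν, f ω = (p ω : EReal) - (d ω : EReal)) :
    eexp ν f = ((∫⁻ ω, p ω ∂ν : ℝ≥0∞) : EReal) - ((∫⁻ ω, d ω ∂ν : ℝ≥0∞) : EReal) := by
  have hfin : ∀ᵐ ω ∂ν, d ω < ⊤ := ae_lt_top hd hInt
  have h1 : ∫⁻ ω, (f ω).toENNReal ∂ν = ∫⁻ ω, (p ω - d ω) ∂ν := by
    refine lintegral_congr_ae ?_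
    filter_upwards [hf] with ω h
    simp only [h]
    rw [EReal.toENNReal_sub (EReal.coe_ennreal_nonneg _), EReal.toENNReal_coe,
      EReal.toENNReal_coe]
  have h2 : ∫⁻ ω, (-(f ω)).toENNReal ∂ν = ∫⁻ ω, (d ω - p ω) ∂ν := by
    refine lintegral_congr_ae ?_
    filter_upwards [hf, hfin] with ω h hω
    simp only [h]
    rw [EReal.neg_sub, add_comm, ← sub_eq_add_neg, EReal.toENNReal_sub (EReal.coe_ennreal_nonneg _),
      EReal.toENNReal_coe, EReal.toENNReal_coe]
    · exact Or.inl (EReal.coe_ennreal_ne_bot _)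
    · exact Or.inr (by simpa using hω.ne)
  rw [eexp, h1, h2]
  refine coe_sub_coe_eq ?_ ?_ hInt
  · rw [← lintegral_add_right _ hd, ← lintegral_add_left hp]
    refine lintegral_congr fun ω => ?_
    rw [tsub_add_eq_max, add_tsub_eq_max]
  · exact ne_top_of_le_ne_top hInt (lintegral_mono fun ω => tsub_le_self)

end EReal

namespace Game

variable {N n0 ny : ℕ} {nx nu : Fin N → ℕ} (g : Game N n0 ny nx nu)

/-! ### A single player facing exogenous environment variables -/

section Player

variable (i : Fin N) (s : Strategy (nx i) (nu i) ny) (x0 : Vec (nx i)) (w : ℕ → Vec (nx i))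
  (z : ℕ → Vec ny)

/-- State of player `i` at time `t`. -/
def plState (t : ℕ) : Vec (nx i) := (g.playerHist i s x0 w z t).1 (Fin.last t)

/-- Decision of player `i` at time `t`. -/
def plInput (t : ℕ) : Vec (nu i) :=
  s.act t ((g.playerHist i s x0 w z t).1, (g.playerHist i s x0 w z t).2, fun k => z k)

lemma plState_succ (t : ℕ) : g.plState i s x0 w z (t + 1) =
    g.A i *ᵥ g.plState i s x0 w z t + g.B i *ᵥ g.plInput i s x0 w z t + g.C i *ᵥ z t + w t := by
  simp only [plState, playerHist, Fin.snoc_last]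
  rfl

lemma plInput_affineProfile {what : StateVec n0 nx} {ξhat : Vec ny}
    {est : ∀ t : ℕ, (Fin t → Vec ny) → StateVec n0 nx} {hest : ∀ t, Measurable (est t)} (t : ℕ) :
    g.plInput i (g.affineProfile what ξhat est hest i) x0 w z t =
      g.F i *ᵥ g.plState i (g.affineProfile what ξhat est hest i) x0 w z t
        + (g.G what ξhat i *ᵥ est t (fun k => z k) + g.checkH what ξhat i) := by
  rw [← add_assoc]
  rfl

-- Only the `w k` and `z k` with `k < t` enter the history at `t`. Since the σ-algebra is arbitrary,
-- the same lemma later yields adaptedness.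
variable {g i s} in
lemma measurable_playerHist {Θ : Type*} {m : MeasurableSpace Θ} {x0 : Θ → Vec (nx i)}
    {w : ℕ → Θ → Vec (nx i)} {z : ℕ → Θ → Vec ny} (hx0 : Measurable x0) (t : ℕ)
    (hw : ∀ k < t, Measurable (w k)) (hz : ∀ k < t, Measurable (z k)) :
    Measurable fun θ => g.playerHist i s (x0 θ) (fun k => w k θ) (fun k => z k θ) t := by
  induction t with
  | zero => exact (measurable_pi_lambda _ fun _ => hx0).prodMk measurable_const
  | succ t ih =>
    have h := ih (fun k hk => hw k (hk.trans t.lt_succ_self))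
      fun k hk => hz k (hk.trans t.lt_succ_self)
    have hu := (s.measurable_act t).comp (h.fst.prodMk (h.snd.prodMk
      (measurable_pi_lambda (fun θ (k : Fin t) => z k θ) fun k =>
        hz k (k.2.trans t.lt_succ_self))))
    have hX := (measurable_pi_apply (Fin.last t)).comp h.fst
    exact (measurable_fin_snoc h.fst ((((measurable_mulVec (g.A i) hX).add
      (measurable_mulVec (g.B i) hu)).add (measurable_mulVec (g.C i) (hz t t.lt_succ_self))).add
        (hw t t.lt_succ_self))).prodMk (measurable_fin_snoc h.snd hu)

variable {g i s} in
lemma measurable_plState {Θ : Type*} {m : MeasurableSpace Θ} {x0 : Θ → Vec (nx i)}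
    {w : ℕ → Θ → Vec (nx i)} {z : ℕ → Θ → Vec ny} (hx0 : Measurable x0) (t : ℕ)
    (hw : ∀ k < t, Measurable (w k)) (hz : ∀ k < t, Measurable (z k)) :
    Measurable fun θ => g.plState i s (x0 θ) (fun k => w k θ) (fun k => z k θ) t :=
  (measurable_pi_apply (Fin.last t)).comp (measurable_playerHist hx0 t hw hz).fst

variable {g i s} in
lemma measurable_plInput {Θ : Type*} {m : MeasurableSpace Θ} {x0 : Θ → Vec (nx i)}
    {w : ℕ → Θ → Vec (nx i)} {z : ℕ → Θ → Vec ny} (hx0 : Measurable x0) (t : ℕ)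
    (hw : ∀ k < t, Measurable (w k)) (hz : ∀ k < t, Measurable (z k)) :
    Measurable fun θ => g.plInput i s (x0 θ) (fun k => w k θ) (fun k => z k θ) t :=
  (s.measurable_act t).comp ((measurable_playerHist hx0 t hw hz).fst.prodMk
    ((measurable_playerHist hx0 t hw hz).snd.prodMk
      (measurable_pi_lambda (fun θ (k : Fin t) => z k θ) fun k => hz k k.2)))

lemma measurable_dotProduct {ι Θ : Type*} [Fintype ι] {m : MeasurableSpace Θ} {f h : Θ → ι → ℝ}
    (hf : Measurable f) (hh : Measurable h) : Measurable fun θ => f θ ⬝ᵥ h θ :=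
  Finset.measurable_fun_sum _ fun i _ =>
    ((measurable_pi_apply i).comp hf).mul ((measurable_pi_apply i).comp hh)

variable {g i} in
lemma measurable_cost {Θ : Type*} {m : MeasurableSpace Θ} {x : Θ → Vec (nx i)}
    {u : Θ → Vec (nu i)} {y : Θ → Vec ny} (hx : Measurable x) (hu : Measurable u)
    (hy : Measurable y) : Measurable fun θ => g.cost i (x θ) (u θ) (y θ) :=
  ((measurable_dotProduct hx (measurable_mulVec _ hx)).add
    (measurable_dotProduct hu (measurable_mulVec _ hu))).add
    ((measurable_dotProduct hy
      ((measurable_mulVec _ hu).add (measurable_mulVec _ hx))).const_mul 2)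

/-- The stage cost is coercive up to a multiple of the squared environment variable. -/
lemma exists_le_cost : ∃ ε κ : ℝ, 0 < ε ∧ 0 ≤ κ ∧ ∀ (x : Vec (nx i)) (u : Vec (nu i)) (y : Vec ny),
    ε * (x ⬝ᵥ x + u ⬝ᵥ u) ≤ g.cost i x u y + κ * (y ⬝ᵥ y) := by
  obtain ⟨e1, he1, h1⟩ := exists_le_quadForm_of_posDef (g.Q_posDef i)
  obtain ⟨e2, he2, h2⟩ := exists_le_quadForm_of_posDef (g.R_posDef i)
  obtain ⟨c1, hc1, h3⟩ := exists_dotProduct_mulVec_self_le (g.K i)ᵀ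
  obtain ⟨c2, hc2, h4⟩ := exists_dotProduct_mulVec_self_le (g.L i)ᵀ
  refine ⟨min e1 e2 / 2, (e2 / 2)⁻¹ * c1 + (e1 / 2)⁻¹ * c2, by positivity, by positivity,
    fun x u y => ?_⟩
  -- Half of each coercivity constant absorbs its cross term; the sign of `u` and `x` is reversed to
  -- obtain lower bounds.
  have k1 := two_mul_dotProduct_le_weighted (half_pos he2) (-u) ((g.K i)ᵀ *ᵥ y)
  have k2 := two_mul_dotProduct_le_weighted (half_pos he1) (-x) ((g.L i)ᵀ *ᵥ y)
  rw [neg_dotProduct, dotProduct_transpose_mulVec', neg_dotProduct_neg] at k1 k2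
  have m1 := mul_le_mul_of_nonneg_left (h3 y) (inv_pos.2 (half_pos he2)).le
  have m2 := mul_le_mul_of_nonneg_left (h4 y) (inv_pos.2 (half_pos he1)).le
  have m3 := mul_le_mul_of_nonneg_right (min_le_left e1 e2) (dotProduct_self_nonneg' x)
  have m4 := mul_le_mul_of_nonneg_right (min_le_right e1 e2) (dotProduct_self_nonneg' u)
  rw [cost, dotProduct_add, dotProduct_comm y (g.K i *ᵥ u), dotProduct_comm y (g.L i *ᵥ x)]
  linarith [h1 x, h2 u]

variable {g i} in
/-- The expected cost under the belief that the environment variables are distributed as `ȳ`,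
as a difference of nonnegative series. -/
lemma beliefCost_eq {Ω Ω' : Type*} [MeasurableSpace Ω] [MeasurableSpace Ω'] {μ : Measure Ω}
    [IsProbabilityMeasure μ] {P : Measure Ω'} [IsProbabilityMeasure P] {X0 : Ω → StateVec n0 nx}
    {W : ℕ → Ω → StateVec n0 nx} (hX0 : Measurable X0) (hW : ∀ t, Measurable (W t))
    {y : ℕ → Ω' → Vec ny} (hy : ∀ t, Measurable (y t)) {κ : ℝ} (hκ : 0 ≤ κ)
    (hcost : ∀ (x : Vec (nx i)) (u : Vec (nu i)) (z : Vec ny), 0 ≤ g.cost i x u z + κ * (z ⬝ᵥ z))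
    (hfin : ∑' t, ∫⁻ ω', ENNReal.ofReal (g.β i ^ t * (κ * (y t ω' ⬝ᵥ y t ω'))) ∂P ≠ ⊤)
    (s : Strategy (nx i) (nu i) ny) :
    g.beliefCost μ X0 W i (P.map fun ω' t => y t ω') s =
      ((∑' t, ∫⁻ θ, ENNReal.ofReal (g.β i ^ t *
        (g.cost i (g.plState i s (own i (X0 θ.2)) (fun k => own i (W k θ.2)) (fun k => y k θ.1) t)
          (g.plInput i s (own i (X0 θ.2)) (fun k => own i (W k θ.2)) (fun k => y k θ.1) t)
          (y t θ.1) + κ * (y t θ.1 ⬝ᵥ y t θ.1))) ∂(P.prod μ) : ℝ≥0∞) : EReal) -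
      ((∑' t, ∫⁻ ω', ENNReal.ofReal (g.β i ^ t * (κ * (y t ω' ⬝ᵥ y t ω'))) ∂P : ℝ≥0∞) : EReal) := by
  have hβ := g.β_nonneg i
  have hY : Measurable fun ω' t => y t ω' := measurable_pi_lambda _ hy
  set p : ℕ → (ℕ → Vec ny) × Ω → ℝ := fun t v => g.β i ^ t *
    (g.cost i (g.plState i s (own i (X0 v.2)) (fun k => own i (W k v.2)) (fun k => v.1 k) t)
      (g.plInput i s (own i (X0 v.2)) (fun k => own i (W k v.2)) (fun k => v.1 k) t)
      (v.1 t) + κ * (v.1 t ⬝ᵥ v.1 t)) with hp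
  set d : ℕ → (ℕ → Vec ny) → ℝ := fun t z => g.β i ^ t * (κ * (z t ⬝ᵥ z t)) with hd
  have hzm : ∀ t, Measurable fun v : (ℕ → Vec ny) × Ω => v.1 t := fun t =>
    (measurable_pi_apply t).comp measurable_fst
  have hx0m : Measurable fun v : (ℕ → Vec ny) × Ω => own i (X0 v.2) :=
    (measurable_own i).comp (hX0.comp measurable_snd)
  have hwm : ∀ t, Measurable fun v : (ℕ → Vec ny) × Ω => own i (W t v.2) := fun t =>
    (measurable_own i).comp ((hW t).comp measurable_snd)
  have hpm : ∀ t, Measurable (p t) := fun t =>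
    ((measurable_cost (measurable_plState hx0m t (fun k _ => hwm k) fun k _ => hzm k)
      (measurable_plInput hx0m t (fun k _ => hwm k) fun k _ => hzm k) (hzm t)).add
      ((measurable_dotProduct (hzm t) (hzm t)).const_mul κ)).const_mul _
  have hdm : ∀ t, Measurable (d t) := fun t =>
    ((measurable_dotProduct (measurable_pi_apply t) (measurable_pi_apply t)).const_mul κ).const_mul _
  have hp0 : ∀ t v, 0 ≤ p t v := fun t v => mul_nonneg (by positivity) (hcost _ _ _)
  have hd0 : ∀ t z, 0 ≤ d t z := fun t z =>
    mul_nonneg (by positivity) (mul_nonneg hκ (dotProduct_self_nonneg' _))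
  have hpE : Measurable fun v => ∑' t, ENNReal.ofReal (p t v) :=
    Measurable.tsum fun t => (hpm t).ennreal_ofReal
  have hdE : Measurable fun z => ∑' t, ENNReal.ofReal (d t z) :=
    Measurable.tsum fun t => (hdm t).ennreal_ofReal
  have hD : ∫⁻ z, ∑' t, ENNReal.ofReal (d t z) ∂(P.map fun ω' t => y t ω') =
      ∑' t, ∫⁻ ω', ENNReal.ofReal (g.β i ^ t * (κ * (y t ω' ⬝ᵥ y t ω'))) ∂P := by
    rw [lintegral_map hdE hY, lintegral_tsum]
    exact fun t => ((hdm t).comp hY).ennreal_ofReal.aemeasurable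
  have hDfin : ∫⁻ z, ∑' t, ENNReal.ofReal (d t z) ∂(P.map fun ω' t => y t ω') ≠ ⊤ := by rwa [hD]
  -- The subtracted series is free of the player's noise, so wherever it converges it passes through
  -- the inner expectation as a constant.
  have hJ : ∀ z : ℕ → Vec ny, ∑' t, ENNReal.ofReal (d t z) < ⊤ →
      g.J μ X0 W i s z = ((∫⁻ ω, ∑' t, ENNReal.ofReal (p t (z, ω)) ∂μ : ℝ≥0∞) : EReal) -
        ((∑' t, ENNReal.ofReal (d t z) : ℝ≥0∞) : EReal) := by
    intro z hz
    have h1 := eexp_sub (ν := μ) (f := fun ω => esum fun t =>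
        g.β i ^ t * g.stageCost i s (own i (X0 ω)) (fun k => own i (W k ω)) z t)
      (p := fun ω => ∑' t, ENNReal.ofReal (p t (z, ω)))
      (d := fun _ => ∑' t, ENNReal.ofReal (d t z))
      (hpE.comp measurable_prodMk_left) measurable_const (by simpa using hz.ne)
      (Filter.Eventually.of_forall fun ω => by
        rw [← esum_sub (fun t => hp0 t (z, ω)) (fun t => hd0 t z) hz.ne]
        congr 1
        funext t
        simp only [hp, hd]
        rw [← mul_sub, add_sub_cancel_right]
        rfl)
    rw [J, h1]
    simp
  rw [beliefCost, eexp_sub (p := fun z => ∫⁻ ω, ∑' t, ENNReal.ofReal (p t (z, ω)) ∂μ)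
    (d := fun z => ∑' t, ENNReal.ofReal (d t z)) hpE.lintegral_prod_right' hdE hDfin
    ((ae_lt_top hdE hDfin).mono hJ), hD, lintegral_map hpE.lintegral_prod_right' hY]
  congr 2
  have hcomp : Measurable fun θ : Ω' × Ω => ((fun t => y t θ.1, θ.2) : (ℕ → Vec ny) × Ω) :=
    (hY.comp measurable_fst).prodMk measurable_snd
  have h1 := lintegral_tsum (μ := P.prod μ)
    fun t => ((hpm t).comp hcomp).ennreal_ofReal.aemeasurable
  -- Averaging over own noise at a fixed environment and then over the belief is integration over
  -- the product measure: the belief makes the environment independent of the player's noise.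
  have h2 := lintegral_prod (μ := P) (ν := μ) _ (hpE.comp hcomp).aemeasurable
  exact h2.symm.trans h1

end Player

end Game

lemma memLp_two_of_integrable_dotProduct {ι Θ : Type*} [Fintype ι] [MeasurableSpace Θ]
    {ν : Measure Θ} {x : Θ → ι → ℝ} (hx : Measurable x)
    (h : Integrable (fun θ => x θ ⬝ᵥ x θ) ν) : MemLp x 2 ν := by
  refine MemLp.of_eval fun i => ?_
  have hi : Measurable fun θ => x θ i := (measurable_pi_apply i).comp hx
  refine (memLp_two_iff_integrable_sq hi.aestronglyMeasurable).2
    (h.mono' (hi.pow_const 2).aestronglyMeasurable (Filter.Eventually.of_forall fun θ => ?_))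
  rw [Real.norm_of_nonneg (sq_nonneg _)]
  exact sq_le_dotProduct_self (x θ) i

namespace Game

variable {N n0 ny : ℕ} {nx nu : Fin N → ℕ} {g : Game N n0 ny nx nu} {i : Fin N}

/-! ### Verification of optimality

The disturbances `z`, `w` drive the state of player `i`, `q` is the linear coefficient of the
value function and `r` the feedforward part of the decision. -/

/-- Residual of the costate recursion at one stage; `q'` is the costate at the next stage. -/
def stateResid (g : Game N n0 ny nx nu) (i : Fin N) (z : Vec ny) (w q q' : Vec (nx i)) :
    Vec (nx i) :=
  (g.L i)ᵀ *ᵥ z + (g.F i)ᵀ *ᵥ ((g.K i)ᵀ *ᵥ z)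
    + g.Φ i *ᵥ (g.M i *ᵥ (g.C i *ᵥ z + w) + q') - q

/-- Residual of the first-order condition at one stage. -/
def inputResid (g : Game N n0 ny nx nu) (i : Fin N) (z : Vec ny) (w q' : Vec (nx i))
    (r : Vec (nu i)) : Vec (nu i) :=
  (g.K i)ᵀ *ᵥ z + g.β i • ((g.B i)ᵀ *ᵥ (g.M i *ᵥ (g.C i *ᵥ z + w) + q')) + g.S i *ᵥ r

/-- Value function `x' M x + 2 x' q`. -/
def valueFn (g : Game N n0 ny nx nu) (i : Fin N) (x q : Vec (nx i)) : ℝ :=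
  x ⬝ᵥ (g.M i *ᵥ x) + 2 * (x ⬝ᵥ q)

/-- The part of the stage cost that does not depend on the strategy. -/
def fixedCost (g : Game N n0 ny nx nu) (i : Fin N) (z : Vec ny) (w q' : Vec (nx i))
    (r : Vec (nu i)) : ℝ :=
  -(r ⬝ᵥ (g.S i *ᵥ r)) + g.β i * ((g.C i *ᵥ z + w) ⬝ᵥ (g.M i *ᵥ (g.C i *ᵥ z + w))
    + 2 * ((g.C i *ᵥ z + w) ⬝ᵥ q'))

/-- This is `lq_stage_identity` at the deviation `ρ = u - Fx`. Adding and subtracting `q` and `S r`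
recentres the square at `r` and collects the linear terms into the two residuals. -/
lemma cost_add_valueFn (hAB : IsStabilizable (g.A i) (g.B i)) (x w q q' : Vec (nx i))
    (u r : Vec (nu i)) (z : Vec ny) :
    g.cost i x u z + g.β i * g.valueFn i (g.A i *ᵥ x + g.B i *ᵥ u + g.C i *ᵥ z + w) q' =
      g.valueFn i x q + 2 * (x ⬝ᵥ g.stateResid i z w q q')
        + (u - g.F i *ᵥ x - r) ⬝ᵥ (g.S i *ᵥ (u - g.F i *ᵥ x - r))
        + 2 * ((u - g.F i *ᵥ x) ⬝ᵥ g.inputResid i z w q' r) + g.fixedCost i z w q' r := by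
  have hS := transpose_eq_of_posSemidef (posDef_S hAB).posSemidef
  have h := lq_stage_identity (Q := g.Q i) (S := g.S i) (g.K i) (g.L i)
    (transpose_eq_of_posSemidef (posSemidef_M hAB))
    (transpose_eq_of_posSemidef (g.R_posDef i).posSemidef) rfl (S_mul_F hAB) x
    (g.C i *ᵥ z + w) q' (u - g.F i *ᵥ x) z
  rw [← M_eq hAB] at h
  simp only [add_sub_cancel] at h
  have e1 : (u - g.F i *ᵥ x) ⬝ᵥ (g.S i *ᵥ (u - g.F i *ᵥ x)) =
      (u - g.F i *ᵥ x - r) ⬝ᵥ (g.S i *ᵥ (u - g.F i *ᵥ x - r)) - r ⬝ᵥ (g.S i *ᵥ r)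
        + 2 * ((u - g.F i *ᵥ x) ⬝ᵥ (g.S i *ᵥ r)) := by
    generalize u - g.F i *ᵥ x = ρ
    rw [mulVec_sub, sub_dotProduct, dotProduct_sub, dotProduct_sub, dotProduct_mulVec_comm hS r ρ]
    ring
  simp only [cost, valueFn, stateResid, inputResid, fixedCost, dotProduct_sub x,
    dotProduct_add (u - g.F i *ᵥ x) _ (g.S i *ᵥ r), add_assoc (g.A i *ᵥ x + g.B i *ᵥ u)]
  rw [e1] at h
  rw [Game.Φ]
  linear_combination h

variable {Θ : Type*} [mΘ : MeasurableSpace Θ] {ν : Measure Θ} {m : ℕ → MeasurableSpace Θ}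
  {z : ℕ → Θ → Vec ny} {w q : ℕ → Θ → Vec (nx i)} {r : ℕ → Θ → Vec (nu i)}

/-- The costate and feedforward processes are consistent with one-step forecasts given the
information `m t`. -/
structure IsForecast (g : Game N n0 ny nx nu) (i : Fin N) (ν : Measure Θ)
    (m : ℕ → MeasurableSpace Θ) (z : ℕ → Θ → Vec ny) (w q : ℕ → Θ → Vec (nx i))
    (r : ℕ → Θ → Vec (nu i)) : Prop where
  le : ∀ t, m t ≤ mΘ
  memLp_z : ∀ t, MemLp (z t) 2 ν
  memLp_w : ∀ t, MemLp (w t) 2 ν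
  memLp_q : ∀ t, MemLp (q t) 2 ν
  memLp_r : ∀ t, MemLp (r t) 2 ν
  state_orth : ∀ t (φ : Θ → Vec (nx i)), Measurable[m t] φ → MemLp φ 2 ν →
    ∫ θ, φ θ ⬝ᵥ g.stateResid i (z t θ) (w t θ) (q t θ) (q (t + 1) θ) ∂ν = 0
  input_orth : ∀ t (φ : Θ → Vec (nu i)), Measurable[m t] φ → MemLp φ 2 ν →
    ∫ θ, φ θ ⬝ᵥ g.inputResid i (z t θ) (w t θ) (q (t + 1) θ) (r t θ) ∂ν = 0

/-- `x`, `u` are adapted state and decision processes of player `i`. -/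
structure IsPath (g : Game N n0 ny nx nu) (i : Fin N) (m : ℕ → MeasurableSpace Θ)
    (z : ℕ → Θ → Vec ny) (w x : ℕ → Θ → Vec (nx i)) (u : ℕ → Θ → Vec (nu i)) : Prop where
  measurable_x : ∀ t, Measurable[m t] (x t)
  measurable_u : ∀ t, Measurable[m t] (u t)
  succ : ∀ t θ, x (t + 1) θ = g.A i *ᵥ x t θ + g.B i *ᵥ u t θ + g.C i *ᵥ z t θ + w t θ

lemma integrable_cost {x : Θ → Vec (nx i)} {u : Θ → Vec (nu i)} {y : Θ → Vec ny}
    (hx : MemLp x 2 ν) (hu : MemLp u 2 ν) (hy : MemLp y 2 ν) :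
    Integrable (fun θ => g.cost i (x θ) (u θ) (y θ)) ν := by
  have h : MemLp (fun θ => g.K i *ᵥ u θ + g.L i *ᵥ x θ) 2 ν :=
    (memLp_mulVec (g.K i) hu).add (memLp_mulVec (g.L i) hx)
  exact ((integrable_dotProduct hx (memLp_mulVec (g.Q i) hx)).add
    (integrable_dotProduct hu (memLp_mulVec (g.R i) hu))).add
    ((integrable_dotProduct hy h).const_mul 2)

lemma integrable_valueFn {x p : Θ → Vec (nx i)} (hx : MemLp x 2 ν) (hp : MemLp p 2 ν) :
    Integrable (fun θ => g.valueFn i (x θ) (p θ)) ν :=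
  (integrable_dotProduct hx (memLp_mulVec (g.M i) hx)).add ((integrable_dotProduct hx hp).const_mul 2)

lemma memLp_noise (hF : g.IsForecast i ν m z w q r) (t : ℕ) :
    MemLp (fun θ => g.C i *ᵥ z t θ + w t θ) 2 ν :=
  (memLp_mulVec (g.C i) (hF.memLp_z t)).add (hF.memLp_w t)

lemma memLp_noiseCostate (hF : g.IsForecast i ν m z w q r) (t : ℕ) :
    MemLp (fun θ => g.M i *ᵥ (g.C i *ᵥ z t θ + w t θ) + q (t + 1) θ) 2 ν :=
  (memLp_mulVec (g.M i) (memLp_noise hF t)).add (hF.memLp_q (t + 1))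

lemma memLp_stateResid (hF : g.IsForecast i ν m z w q r) (t : ℕ) :
    MemLp (fun θ => g.stateResid i (z t θ) (w t θ) (q t θ) (q (t + 1) θ)) 2 ν :=
  (((memLp_mulVec (g.L i)ᵀ (hF.memLp_z t)).add
    (memLp_mulVec (g.F i)ᵀ (memLp_mulVec (g.K i)ᵀ (hF.memLp_z t)))).add
    (memLp_mulVec (g.Φ i) (memLp_noiseCostate hF t))).sub (hF.memLp_q t)

lemma memLp_inputResid (hF : g.IsForecast i ν m z w q r) (t : ℕ) :
    MemLp (fun θ => g.inputResid i (z t θ) (w t θ) (q (t + 1) θ) (r t θ)) 2 ν :=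
  ((memLp_mulVec (g.K i)ᵀ (hF.memLp_z t)).add
    ((memLp_mulVec (g.B i)ᵀ (memLp_noiseCostate hF t)).const_smul (g.β i))).add
    (memLp_mulVec (g.S i) (hF.memLp_r t))

lemma integrable_fixedCost (hF : g.IsForecast i ν m z w q r) (t : ℕ) :
    Integrable (fun θ => g.fixedCost i (z t θ) (w t θ) (q (t + 1) θ) (r t θ)) ν :=
  (integrable_dotProduct (hF.memLp_r t) (memLp_mulVec (g.S i) (hF.memLp_r t))).neg.add
    (((integrable_dotProduct (memLp_noise hF t) (memLp_mulVec (g.M i) (memLp_noise hF t))).add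
      ((integrable_dotProduct (memLp_noise hF t) (hF.memLp_q (t + 1))).const_mul 2)).const_mul (g.β i))

lemma integral_add_two_mul_add {a b c d e : Θ → ℝ} (ha : Integrable a ν) (hb : Integrable b ν)
    (hc : Integrable c ν) (hd : Integrable d ν) (he : Integrable e ν) :
    ∫ θ, (a θ + 2 * b θ + c θ + 2 * d θ + e θ) ∂ν =
      ∫ θ, a θ ∂ν + 2 * ∫ θ, b θ ∂ν + ∫ θ, c θ ∂ν + 2 * ∫ θ, d θ ∂ν + ∫ θ, e θ ∂ν := by
  have h1 : Integrable (fun θ => a θ + 2 * b θ) ν := ha.add (hb.const_mul 2)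
  have h2 : Integrable (fun θ => a θ + 2 * b θ + c θ) ν := h1.add hc
  have h3 : Integrable (fun θ => a θ + 2 * b θ + c θ + 2 * d θ) ν := h2.add (hd.const_mul 2)
  rw [integral_add h3 he, integral_add h2 (hd.const_mul 2), integral_add h1 hc,
    integral_add ha (hb.const_mul 2), integral_const_mul, integral_const_mul]

/-- One step of the dynamic programming identity in expectation. -/
lemma integral_cost_add (hAB : IsStabilizable (g.A i) (g.B i)) (hF : g.IsForecast i ν m z w q r)
    {x : ℕ → Θ → Vec (nx i)} {u : ℕ → Θ → Vec (nu i)} (hP : g.IsPath i m z w x u) {t : ℕ}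
    (hx : MemLp (x t) 2 ν) (hu : MemLp (u t) 2 ν) :
    ∫ θ, g.cost i (x t θ) (u t θ) (z t θ) ∂ν
        + g.β i * ∫ θ, g.valueFn i (x (t + 1) θ) (q (t + 1) θ) ∂ν =
      ∫ θ, g.valueFn i (x t θ) (q t θ) ∂ν
        + ∫ θ, (u t θ - g.F i *ᵥ x t θ - r t θ) ⬝ᵥ
            (g.S i *ᵥ (u t θ - g.F i *ᵥ x t θ - r t θ)) ∂ν
        + ∫ θ, g.fixedCost i (z t θ) (w t θ) (q (t + 1) θ) (r t θ) ∂ν := by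
  have hx' : MemLp (x (t + 1)) 2 ν := by
    have : x (t + 1) = _ := funext (hP.succ t)
    rw [this]
    exact (((memLp_mulVec (g.A i) hx).add (memLp_mulVec (g.B i) hu)).add
      (memLp_mulVec (g.C i) (hF.memLp_z t))).add (hF.memLp_w t)
  have hρ : MemLp (fun θ => u t θ - g.F i *ᵥ x t θ) 2 ν := hu.sub (memLp_mulVec (g.F i) hx)
  have hρm : Measurable[m t] (fun θ => u t θ - g.F i *ᵥ x t θ) :=
    (hP.measurable_u t).sub (measurable_mulVec _ (hP.measurable_x t))
  have hd : MemLp (fun θ => u t θ - g.F i *ᵥ x t θ - r t θ) 2 ν := hρ.sub (hF.memLp_r t)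
  have i1 := integrable_cost (g := g) hx hu (hF.memLp_z t)
  have i2 := integrable_valueFn (g := g) hx' (hF.memLp_q (t + 1))
  have i3 := integrable_valueFn (g := g) hx (hF.memLp_q t)
  have i4 := integrable_dotProduct hx (memLp_stateResid hF t)
  have i5 := integrable_dotProduct hd (memLp_mulVec (g.S i) hd)
  have i6 := integrable_dotProduct hρ (memLp_inputResid hF t)
  have i7 := integrable_fixedCost hF t
  -- The linear terms vanish in expectation: `x t` and `u t - F x t` are known at `t`, and the
  -- residuals are orthogonal to what is known.
  have o1 := hF.state_orth t (x t) (hP.measurable_x t) hx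
  have o2 := hF.input_orth t _ hρm hρ
  have e := integral_congr_ae (μ := ν) (Filter.Eventually.of_forall fun θ =>
    (congrArg (fun v => g.cost i (x t θ) (u t θ) (z t θ) + g.β i * g.valueFn i v (q (t + 1) θ))
      (hP.succ t θ)).trans
    (cost_add_valueFn hAB (x t θ) (w t θ) (q t θ) (q (t + 1) θ) (u t θ) (r t θ) (z t θ)))
  rw [integral_add i1 (i2.const_mul _), integral_const_mul] at e
  rw [e, integral_add_two_mul_add i3 i4 i5 i6 i7, o1, o2]
  ring

/-- The one-step identity, weighted by `β ^ t`, telescopes. -/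
lemma sum_integral_cost (hAB : IsStabilizable (g.A i) (g.B i)) (hF : g.IsForecast i ν m z w q r)
    {x : ℕ → Θ → Vec (nx i)} {u : ℕ → Θ → Vec (nu i)} (hP : g.IsPath i m z w x u)
    (hL : ∀ t, g.β i ^ t ≠ 0 → MemLp (x t) 2 ν ∧ MemLp (u t) 2 ν) (T : ℕ) :
    ∑ t ∈ Finset.range T, g.β i ^ t * ∫ θ, g.cost i (x t θ) (u t θ) (z t θ) ∂ν
        + g.β i ^ T * ∫ θ, g.valueFn i (x T θ) (q T θ) ∂ν =
      ∫ θ, g.valueFn i (x 0 θ) (q 0 θ) ∂ν + ∑ t ∈ Finset.range T, g.β i ^ t *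
        (∫ θ, (u t θ - g.F i *ᵥ x t θ - r t θ) ⬝ᵥ
            (g.S i *ᵥ (u t θ - g.F i *ᵥ x t θ - r t θ)) ∂ν
          + ∫ θ, g.fixedCost i (z t θ) (w t θ) (q (t + 1) θ) (r t θ) ∂ν) := by
  induction T with
  | zero => simp
  | succ T ih =>
    rw [Finset.sum_range_succ, Finset.sum_range_succ, ← add_assoc, ← ih, add_assoc, add_assoc]
    congr 1
    -- For `β = 0` the weight is zero from time 1 on; square integrability may then fail, but every
    -- term carrying that weight disappears.
    rcases eq_or_ne (g.β i ^ T) 0 with h0 | h0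
    · rw [pow_succ, h0]
      simp
    · have := integral_cost_add hAB hF hP (hL T h0).1 (hL T h0).2
      rw [pow_succ]
      linear_combination g.β i ^ T * this

/-- Positive definiteness of `M` absorbs the cross term. The bound is free of `x`, so the
candidate's terminal value is controlled without a uniform bound on its state. -/
lemma exists_neg_le_valueFn (hAB : IsStabilizable (g.A i) (g.B i)) :
    ∃ c : ℝ, 0 ≤ c ∧ ∀ x p : Vec (nx i), -(c * (p ⬝ᵥ p)) ≤ g.valueFn i x p := by
  obtain ⟨ε, hε, h⟩ := exists_le_quadForm_M hAB
  refine ⟨ε⁻¹, (inv_pos.2 hε).le, fun x p => ?_⟩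
  have h1 := two_mul_dotProduct_le_weighted hε (-x) p
  rw [neg_dotProduct, neg_dotProduct_neg] at h1
  have h2 := h x
  rw [valueFn]
  linarith

lemma exists_valueFn_le :
    ∃ c : ℝ, 0 ≤ c ∧ ∀ x p : Vec (nx i), g.valueFn i x p ≤ c * (x ⬝ᵥ x) + p ⬝ᵥ p := by
  obtain ⟨c, hc, h⟩ := exists_quadForm_le (g.M i)
  refine ⟨c + 1, by linarith, fun x p => ?_⟩
  have h1 := two_mul_dotProduct_le x p
  have h2 := h x
  rw [valueFn]
  linarith

lemma exists_fixedCost_le (hAB : IsStabilizable (g.A i) (g.B i)) :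
    ∃ c : ℝ, 0 ≤ c ∧ ∀ (y : Vec ny) (v p : Vec (nx i)) (r : Vec (nu i)),
      g.fixedCost i y v p r ≤ c * (y ⬝ᵥ y + v ⬝ᵥ v + p ⬝ᵥ p) := by
  obtain ⟨c, hc, h⟩ := exists_quadForm_le (g.M i)
  obtain ⟨d, hd, h'⟩ := exists_dotProduct_mulVec_self_le (g.C i)
  refine ⟨(c + 1) * (2 * d + 2) + 1, by positivity, fun y v p r => ?_⟩
  have hβ := g.β_nonneg i
  have hβ1 := (g.β_lt_one i).le
  have h1 := quadForm_nonneg (posDef_S hAB).posSemidef r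
  have h2 := h (g.C i *ᵥ y + v)
  have h3 := two_mul_dotProduct_le (g.C i *ᵥ y + v) p
  have h4 := dotProduct_self_add_le (g.C i *ᵥ y) v
  have h5 := h' y
  have y0 := dotProduct_self_nonneg' y
  have v0 := dotProduct_self_nonneg' v
  have p0 := dotProduct_self_nonneg' p
  set n := (g.C i *ᵥ y + v) ⬝ᵥ (g.C i *ᵥ y + v)
  have n0 : 0 ≤ n := dotProduct_self_nonneg' _
  have h6 : n ≤ (2 * d + 2) * (y ⬝ᵥ y + v ⬝ᵥ v) := by nlinarith
  have h7 : g.β i * ((g.C i *ᵥ y + v) ⬝ᵥ (g.M i *ᵥ (g.C i *ᵥ y + v))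
      + 2 * ((g.C i *ᵥ y + v) ⬝ᵥ p)) ≤ (c + 1) * n + p ⬝ᵥ p := by
    refine (mul_le_mul_of_nonneg_left (b := _) (c := (c + 1) * n + p ⬝ᵥ p) (by linarith) hβ).trans ?_
    have : 0 ≤ (c + 1) * n + p ⬝ᵥ p := by positivity
    nlinarith
  have h8 : (c + 1) * n ≤ (c + 1) * ((2 * d + 2) * (y ⬝ᵥ y + v ⬝ᵥ v)) :=
    mul_le_mul_of_nonneg_left h6 (by linarith)
  have h9 : 0 ≤ (c + 1) * (2 * d + 2) * (p ⬝ᵥ p) := by positivity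
  rw [fixedCost]
  nlinarith

end Game

-- Cost comparison over the infinite horizon

namespace Game

variable {N n0 ny : ℕ} {nx nu : Fin N → ℕ} {g : Game N n0 ny nx nu} {i : Fin N}
  {Θ : Type*} [mΘ : MeasurableSpace Θ] {ν : Measure Θ} {m : ℕ → MeasurableSpace Θ}
  {z : ℕ → Θ → Vec ny} {w q : ℕ → Θ → Vec (nx i)} {r : ℕ → Θ → Vec (nu i)}
  {x : ℕ → Θ → Vec (nx i)} {u : ℕ → Θ → Vec (nu i)} {κ ε : ℝ}

lemma lintegral_stage (hκ : ∀ (x : Vec (nx i)) (u : Vec (nu i)) (y : Vec ny),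
      0 ≤ g.cost i x u y + κ * (y ⬝ᵥ y)) {t : ℕ} (hz : MemLp (z t) 2 ν)
    (hL : g.β i ^ t ≠ 0 → MemLp (x t) 2 ν ∧ MemLp (u t) 2 ν) :
    ∫⁻ θ, ENNReal.ofReal (g.β i ^ t *
        (g.cost i (x t θ) (u t θ) (z t θ) + κ * (z t θ ⬝ᵥ z t θ))) ∂ν =
      ENNReal.ofReal (g.β i ^ t *
        (∫ θ, g.cost i (x t θ) (u t θ) (z t θ) ∂ν + κ * ∫ θ, z t θ ⬝ᵥ z t θ ∂ν)) := by
  rcases eq_or_ne (g.β i ^ t) 0 with h0 | h0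
  · simp [h0]
  · have i1 := integrable_cost (g := g) (hL h0).1 (hL h0).2 hz
    have i2 := (integrable_dotProduct hz hz).const_mul κ
    rw [← integral_const_mul, ← integral_add i1 i2, ← integral_const_mul]
    refine (ofReal_integral_eq_lintegral_ofReal ((i1.add i2).const_mul _)
      (Filter.Eventually.of_forall fun θ => ?_)).symm
    exact mul_nonneg (pow_nonneg (g.β_nonneg i) t) (hκ _ _ _)

/-- Coercivity: a finite expected stage cost with positive weight forces second moments, so a rival
need not be assumed square integrable. -/
lemma memLp_of_lintegral_stage (hε : 0 < ε) (hκ : ∀ (x : Vec (nx i)) (u : Vec (nu i)) (y : Vec ny),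
      ε * (x ⬝ᵥ x + u ⬝ᵥ u) ≤ g.cost i x u y + κ * (y ⬝ᵥ y)) {t : ℕ}
    (hx : Measurable (x t)) (hu : Measurable (u t))
    (hfin : ∫⁻ θ, ENNReal.ofReal (g.β i ^ t *
        (g.cost i (x t θ) (u t θ) (z t θ) + κ * (z t θ ⬝ᵥ z t θ))) ∂ν ≠ ⊤)
    (h0 : g.β i ^ t ≠ 0) : MemLp (x t) 2 ν ∧ MemLp (u t) 2 ν := by
  have hβ : 0 < g.β i ^ t := lt_of_le_of_ne (pow_nonneg (g.β_nonneg i) t) h0.symm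
  have hm : Measurable fun θ => x t θ ⬝ᵥ x t θ + u t θ ⬝ᵥ u t θ :=
    (measurable_dotProduct hx hx).add (measurable_dotProduct hu hu)
  have hle : ∫⁻ θ, ENNReal.ofReal (x t θ ⬝ᵥ x t θ + u t θ ⬝ᵥ u t θ) ∂ν ≠ ⊤ := by
    have h1 : ∀ θ, ENNReal.ofReal (x t θ ⬝ᵥ x t θ + u t θ ⬝ᵥ u t θ) ≤
        ENNReal.ofReal (g.β i ^ t * ε)⁻¹ * ENNReal.ofReal (g.β i ^ t *
        (g.cost i (x t θ) (u t θ) (z t θ) + κ * (z t θ ⬝ᵥ z t θ))) := fun θ => by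
      rw [← ENNReal.ofReal_mul (by positivity)]
      refine ENNReal.ofReal_le_ofReal ?_
      rw [inv_mul_eq_div, le_div_iff₀ (by positivity)]
      have := mul_le_mul_of_nonneg_left (hκ (x t θ) (u t θ) (z t θ)) hβ.le
      linarith
    refine ne_top_of_le_ne_top ?_ (lintegral_mono h1)
    rw [lintegral_const_mul' _ _ ENNReal.ofReal_ne_top]
    exact ENNReal.mul_ne_top ENNReal.ofReal_ne_top hfin
  have hInt : Integrable (fun θ => x t θ ⬝ᵥ x t θ + u t θ ⬝ᵥ u t θ) ν :=
    (lintegral_ofReal_ne_top_iff_integrable hm.aestronglyMeasurable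
      (Filter.Eventually.of_forall fun θ => add_nonneg (dotProduct_self_nonneg' _)
        (dotProduct_self_nonneg' _))).1 hle
  constructor
  · refine memLp_two_of_integrable_dotProduct hx (hInt.mono'
      (measurable_dotProduct hx hx).aestronglyMeasurable (Filter.Eventually.of_forall fun θ => ?_))
    rw [Real.norm_of_nonneg (dotProduct_self_nonneg' _)]
    exact le_add_of_nonneg_right (dotProduct_self_nonneg' _)
  · refine memLp_two_of_integrable_dotProduct hu (hInt.mono'
      (measurable_dotProduct hu hu).aestronglyMeasurable (Filter.Eventually.of_forall fun θ => ?_))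
    rw [Real.norm_of_nonneg (dotProduct_self_nonneg' _)]
    exact le_add_of_nonneg_left (dotProduct_self_nonneg' _)

lemma IsPath.memLp_succ (hP : g.IsPath i m z w x u) {t : ℕ} (hx : MemLp (x t) 2 ν)
    (hu : MemLp (u t) 2 ν) (hz : MemLp (z t) 2 ν) (hw : MemLp (w t) 2 ν) :
    MemLp (x (t + 1)) 2 ν := by
  have : x (t + 1) = _ := funext (hP.succ t)
  rw [this]
  exact (((memLp_mulVec (g.A i) hx).add (memLp_mulVec (g.B i) hu)).add
    (memLp_mulVec (g.C i) hz)).add hw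

lemma memLp_of_feedback (hF : g.IsForecast i ν m z w q r) (hP : g.IsPath i m z w x u)
    (hx0 : MemLp (x 0) 2 ν) (hopt : ∀ t, u t =ᵐ[ν] fun θ => g.F i *ᵥ x t θ + r t θ) (t : ℕ) :
    MemLp (x t) 2 ν ∧ MemLp (u t) 2 ν := by
  have hu : ∀ t, MemLp (x t) 2 ν → MemLp (u t) 2 ν := fun t ht =>
    ((memLp_mulVec (g.F i) ht).add (hF.memLp_r t)).ae_eq (hopt t).symm
  induction t with
  | zero => exact ⟨hx0, hu 0 hx0⟩
  | succ t ih =>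
    have := hP.memLp_succ ih.1 ih.2 (hF.memLp_z t) (hF.memLp_w t)
    exact ⟨this, hu _ this⟩

lemma integral_feedback_gap (hopt : ∀ t, u t =ᵐ[ν] fun θ => g.F i *ᵥ x t θ + r t θ) (t : ℕ) :
    ∫ θ, (u t θ - g.F i *ᵥ x t θ - r t θ) ⬝ᵥ
      (g.S i *ᵥ (u t θ - g.F i *ᵥ x t θ - r t θ)) ∂ν = 0 := by
  refine integral_eq_zero_of_ae ?_
  filter_upwards [hopt t] with θ h
  rw [h, add_sub_cancel_left, sub_self, zero_dotProduct]
  rfl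

lemma sum_pow_mul_le {β : ℝ} (h0 : 0 ≤ β) (h1 : β < 1) {f : ℕ → ℝ} {c : ℝ} (hc : 0 ≤ c)
    (hf : ∀ t, f t ≤ c) (T : ℕ) : ∑ t ∈ Finset.range T, β ^ t * f t ≤ (1 - β)⁻¹ * c := by
  calc ∑ t ∈ Finset.range T, β ^ t * f t ≤ ∑ t ∈ Finset.range T, β ^ t * c :=
        Finset.sum_le_sum fun t _ => mul_le_mul_of_nonneg_left (hf t) (pow_nonneg h0 t)
    _ = (∑ t ∈ Finset.range T, β ^ t) * c := by rw [Finset.sum_mul]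
    _ ≤ (1 - β)⁻¹ * c := by
      refine mul_le_mul_of_nonneg_right ?_ hc
      rw [← tsum_geometric_of_lt_one h0 h1]
      exact (summable_geometric_of_lt_one h0 h1).sum_le_tsum _ fun t _ => pow_nonneg h0 t

variable {b : ℝ}

/-- The discounted costs under the candidate feedback have bounded partial sums. -/
lemma exists_sum_cost_le (hAB : IsStabilizable (g.A i) (g.B i)) (hF : g.IsForecast i ν m z w q r)
    (hP : g.IsPath i m z w x u) (hx0 : MemLp (x 0) 2 ν)
    (hopt : ∀ t, u t =ᵐ[ν] fun θ => g.F i *ᵥ x t θ + r t θ)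
    (hz : ∀ t, ∫ θ, z t θ ⬝ᵥ z t θ ∂ν ≤ b) (hw : ∀ t, ∫ θ, w t θ ⬝ᵥ w t θ ∂ν ≤ b)
    (hq : ∀ t, ∫ θ, q t θ ⬝ᵥ q t θ ∂ν ≤ b) :
    ∃ c : ℝ, ∀ T, ∑ t ∈ Finset.range T, g.β i ^ t * ∫ θ, g.cost i (x t θ) (u t θ) (z t θ) ∂ν
      ≤ c := by
  have hβ := g.β_nonneg i
  have hβ1 := g.β_lt_one i
  have hb : 0 ≤ b := (integral_nonneg fun θ => dotProduct_self_nonneg' _).trans (hz 0)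
  obtain ⟨c1, hc1, h1⟩ := exists_neg_le_valueFn hAB
  obtain ⟨c2, hc2, h2⟩ := exists_fixedCost_le hAB
  have hL := memLp_of_feedback hF hP hx0 hopt
  refine ⟨∫ θ, g.valueFn i (x 0 θ) (q 0 θ) ∂ν + (1 - g.β i)⁻¹ * (c2 * (b + b + b)) + c1 * b,
    fun T => ?_⟩
  have e := sum_integral_cost hAB hF hP (fun t _ => hL t) T
  simp only [integral_feedback_gap hopt, zero_add] at e
  have k1 : ∑ t ∈ Finset.range T, g.β i ^ t *
      ∫ θ, g.fixedCost i (z t θ) (w t θ) (q (t + 1) θ) (r t θ) ∂ν ≤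
      (1 - g.β i)⁻¹ * (c2 * (b + b + b)) := by
    refine sum_pow_mul_le hβ hβ1 (by positivity) (fun t => ?_) T
    have iz := integrable_dotProduct (hF.memLp_z t) (hF.memLp_z t)
    have iw := integrable_dotProduct (hF.memLp_w t) (hF.memLp_w t)
    have iq := integrable_dotProduct (hF.memLp_q (t + 1)) (hF.memLp_q (t + 1))
    have izw : Integrable (fun θ => z t θ ⬝ᵥ z t θ + w t θ ⬝ᵥ w t θ) ν := iz.add iw
    refine (integral_mono (integrable_fixedCost hF t) ((izw.add iq).const_mul c2)
      fun θ => h2 _ _ _ _).trans ?_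
    rw [integral_const_mul]
    refine mul_le_mul_of_nonneg_left ?_ hc2
    calc _ = ∫ θ, z t θ ⬝ᵥ z t θ ∂ν + ∫ θ, w t θ ⬝ᵥ w t θ ∂ν
          + ∫ θ, q (t + 1) θ ⬝ᵥ q (t + 1) θ ∂ν := by
          rw [← integral_add iz iw, ← integral_add izw iq]
          rfl
      _ ≤ _ := add_le_add (add_le_add (hz t) (hw t)) (hq (t + 1))
  have k2 : -(c1 * b) ≤ g.β i ^ T * ∫ θ, g.valueFn i (x T θ) (q T θ) ∂ν := by
    have k3 : -(c1 * b) ≤ ∫ θ, g.valueFn i (x T θ) (q T θ) ∂ν := by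
      have iq := integrable_dotProduct (hF.memLp_q T) (hF.memLp_q T)
      refine le_trans ?_ (integral_mono ((iq.const_mul c1).neg)
        (integrable_valueFn (hL T).1 (hF.memLp_q T)) fun θ => h1 (x T θ) (q T θ))
      simp only [Pi.neg_apply]
      rw [integral_neg, integral_const_mul]
      exact neg_le_neg (mul_le_mul_of_nonneg_left (hq T) hc1)
    have k4 : 0 ≤ g.β i ^ T := pow_nonneg hβ T
    have k5 : g.β i ^ T ≤ 1 := pow_le_one₀ hβ hβ1.le
    have k6 : 0 ≤ c1 * b := mul_nonneg hc1 hb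
    nlinarith
  linarith

/-- The partial sums of the discounted costs under the candidate feedback exceed those of any
other path by at most a terminal term. -/
lemma exists_sum_cost_le_sum_cost (hAB : IsStabilizable (g.A i) (g.B i))
    (hF : g.IsForecast i ν m z w q r) (hP : g.IsPath i m z w x u) (hx0 : MemLp (x 0) 2 ν)
    (hopt : ∀ t, u t =ᵐ[ν] fun θ => g.F i *ᵥ x t θ + r t θ)
    (hq : ∀ t, ∫ θ, q t θ ⬝ᵥ q t θ ∂ν ≤ b) :
    ∃ c : ℝ, 0 ≤ c ∧ ∀ (x' : ℕ → Θ → Vec (nx i)) (u' : ℕ → Θ → Vec (nu i)),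
      g.IsPath i m z w x' u' → x' 0 = x 0 →
      (∀ t, g.β i ^ t ≠ 0 → MemLp (x' t) 2 ν ∧ MemLp (u' t) 2 ν) → ∀ T,
      ∑ t ∈ Finset.range T, g.β i ^ t * ∫ θ, g.cost i (x t θ) (u t θ) (z t θ) ∂ν ≤
        ∑ t ∈ Finset.range T, g.β i ^ t * ∫ θ, g.cost i (x' t θ) (u' t θ) (z t θ) ∂ν
          + g.β i ^ T * (c * ∫ θ, x' T θ ⬝ᵥ x' T θ ∂ν + c * b) := by
  have hβ := g.β_nonneg i
  have hb : 0 ≤ b := (integral_nonneg fun θ => dotProduct_self_nonneg' _).trans (hq 0)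
  obtain ⟨c1, hc1, h1⟩ := exists_neg_le_valueFn hAB
  obtain ⟨c2, hc2, h2⟩ := exists_valueFn_le (g := g) (i := i)
  have hL := memLp_of_feedback hF hP hx0 hopt
  refine ⟨c1 + c2 + 1, by positivity, fun x' u' hP' h0 hL' T => ?_⟩
  have e := sum_integral_cost hAB hF hP (fun t _ => hL t) T
  have e' := sum_integral_cost hAB hF hP' hL' T
  simp only [integral_feedback_gap hopt, zero_add] at e
  rw [h0] at e'
  -- The candidate's gap terms vanish, the rival's are nonnegative, and the strategy-free terms are
  -- common to both.
  have k1 : ∑ t ∈ Finset.range T, g.β i ^ t *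
        ∫ θ, g.fixedCost i (z t θ) (w t θ) (q (t + 1) θ) (r t θ) ∂ν ≤
      ∑ t ∈ Finset.range T, g.β i ^ t *
        (∫ θ, (u' t θ - g.F i *ᵥ x' t θ - r t θ) ⬝ᵥ
            (g.S i *ᵥ (u' t θ - g.F i *ᵥ x' t θ - r t θ)) ∂ν
          + ∫ θ, g.fixedCost i (z t θ) (w t θ) (q (t + 1) θ) (r t θ) ∂ν) :=
    Finset.sum_le_sum fun t _ => mul_le_mul_of_nonneg_left (le_add_of_nonneg_left
      (integral_nonneg fun θ => quadForm_nonneg (posDef_S hAB).posSemidef _)) (pow_nonneg hβ t)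
  have k2 : g.β i ^ T * (∫ θ, g.valueFn i (x' T θ) (q T θ) ∂ν
      - ∫ θ, g.valueFn i (x T θ) (q T θ) ∂ν) ≤
      g.β i ^ T * ((c1 + c2 + 1) * ∫ θ, x' T θ ⬝ᵥ x' T θ ∂ν + (c1 + c2 + 1) * b) := by
    rcases eq_or_ne (g.β i ^ T) 0 with h | h
    · rw [h, zero_mul, zero_mul]
    · refine mul_le_mul_of_nonneg_left ?_ (pow_nonneg hβ T)
      have iq := integrable_dotProduct (hF.memLp_q T) (hF.memLp_q T)
      have ix := integrable_dotProduct (hL' T h).1 (hL' T h).1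
      have k3 : -(c1 * b) ≤ ∫ θ, g.valueFn i (x T θ) (q T θ) ∂ν := by
        refine le_trans ?_ (integral_mono ((iq.const_mul c1).neg)
          (integrable_valueFn (hL T).1 (hF.memLp_q T)) fun θ => h1 (x T θ) (q T θ))
        simp only [Pi.neg_apply]
        rw [integral_neg, integral_const_mul]
        exact neg_le_neg (mul_le_mul_of_nonneg_left (hq T) hc1)
      have k4 : ∫ θ, g.valueFn i (x' T θ) (q T θ) ∂ν ≤ c2 * ∫ θ, x' T θ ⬝ᵥ x' T θ ∂ν + b := by
        refine (integral_mono (integrable_valueFn (hL' T h).1 (hF.memLp_q T))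
          ((ix.const_mul c2).add iq) fun θ => h2 (x' T θ) (q T θ)).trans ?_
        simp only [Pi.add_apply]
        rw [integral_add (ix.const_mul c2) iq, integral_const_mul]
        exact add_le_add_right (hq T) _
      have k5 : 0 ≤ ∫ θ, x' T θ ⬝ᵥ x' T θ ∂ν := integral_nonneg fun θ => dotProduct_self_nonneg' _
      nlinarith [mul_nonneg hc1 k5, mul_nonneg hc2 hb]
  linarith

/-- The candidate feedback has finite discounted cost. -/
lemma tsum_lintegral_stage_ne_top (hAB : IsStabilizable (g.A i) (g.B i))
    (hF : g.IsForecast i ν m z w q r) (hP : g.IsPath i m z w x u) (hx0 : MemLp (x 0) 2 ν)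
    (hopt : ∀ t, u t =ᵐ[ν] fun θ => g.F i *ᵥ x t θ + r t θ) (hκ0 : 0 ≤ κ)
    (hκ : ∀ (x : Vec (nx i)) (u : Vec (nu i)) (y : Vec ny), 0 ≤ g.cost i x u y + κ * (y ⬝ᵥ y))
    (hz : ∀ t, ∫ θ, z t θ ⬝ᵥ z t θ ∂ν ≤ b) (hw : ∀ t, ∫ θ, w t θ ⬝ᵥ w t θ ∂ν ≤ b)
    (hq : ∀ t, ∫ θ, q t θ ⬝ᵥ q t θ ∂ν ≤ b) :
    ∑' t, ∫⁻ θ, ENNReal.ofReal (g.β i ^ t *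
      (g.cost i (x t θ) (u t θ) (z t θ) + κ * (z t θ ⬝ᵥ z t θ))) ∂ν ≠ ⊤ := by
  have hb : 0 ≤ b := (integral_nonneg fun θ => dotProduct_self_nonneg' _).trans (hz 0)
  obtain ⟨c, hc⟩ := exists_sum_cost_le hAB hF hP hx0 hopt hz hw hq
  have hL := memLp_of_feedback hF hP hx0 hopt
  refine ne_top_of_le_ne_top (ENNReal.ofReal_ne_top (r := c + (1 - g.β i)⁻¹ * (κ * b)))
    (ENNReal.tsum_le_of_sum_range_le fun T => ?_)
  simp only [fun t => lintegral_stage (x := x) (u := u) hκ (hF.memLp_z t) (fun _ => hL t)]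
  rw [← ENNReal.ofReal_sum_of_nonneg]
  · refine ENNReal.ofReal_le_ofReal ?_
    simp only [mul_add, Finset.sum_add_distrib]
    exact add_le_add (hc T) (sum_pow_mul_le (g.β_nonneg i) (g.β_lt_one i) (by positivity)
      (fun t => mul_le_mul_of_nonneg_left (hz t) hκ0) T)
  · intro t _
    refine mul_nonneg (pow_nonneg (g.β_nonneg i) t) ?_
    rw [← integral_const_mul, ← integral_add (integrable_cost (hL t).1 (hL t).2 (hF.memLp_z t))
      ((integrable_dotProduct (hF.memLp_z t) (hF.memLp_z t)).const_mul κ)]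
    exact integral_nonneg fun θ => hκ _ _ _

/-- The candidate feedback minimizes the discounted cost over all adapted paths. -/
lemma tsum_lintegral_stage_le (hAB : IsStabilizable (g.A i) (g.B i))
    (hF : g.IsForecast i ν m z w q r) (hP : g.IsPath i m z w x u) (hx0 : MemLp (x 0) 2 ν)
    (hopt : ∀ t, u t =ᵐ[ν] fun θ => g.F i *ᵥ x t θ + r t θ) (hε : 0 < ε)
    (hκ0 : 0 ≤ κ) (hκ : ∀ (x : Vec (nx i)) (u : Vec (nu i)) (y : Vec ny),
      ε * (x ⬝ᵥ x + u ⬝ᵥ u) ≤ g.cost i x u y + κ * (y ⬝ᵥ y))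
    (hz : ∀ t, ∫ θ, z t θ ⬝ᵥ z t θ ∂ν ≤ b) (hw : ∀ t, ∫ θ, w t θ ⬝ᵥ w t θ ∂ν ≤ b)
    (hq : ∀ t, ∫ θ, q t θ ⬝ᵥ q t θ ∂ν ≤ b)
    {x' : ℕ → Θ → Vec (nx i)} {u' : ℕ → Θ → Vec (nu i)} (hP' : g.IsPath i m z w x' u')
    (h0 : x' 0 = x 0) :
    ∑' t, ∫⁻ θ, ENNReal.ofReal (g.β i ^ t *
        (g.cost i (x t θ) (u t θ) (z t θ) + κ * (z t θ ⬝ᵥ z t θ))) ∂ν ≤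
      ∑' t, ∫⁻ θ, ENNReal.ofReal (g.β i ^ t *
        (g.cost i (x' t θ) (u' t θ) (z t θ) + κ * (z t θ ⬝ᵥ z t θ))) ∂ν := by
  -- A rival of infinite cost needs no argument; otherwise finiteness supplies its second moments.
  rcases eq_or_ne (∑' t, ∫⁻ θ, ENNReal.ofReal (g.β i ^ t *
    (g.cost i (x' t θ) (u' t θ) (z t θ) + κ * (z t θ ⬝ᵥ z t θ))) ∂ν) ⊤ with htop | hfin'
  · rw [htop]
    exact le_top
  have hβ := g.β_nonneg i
  have hκ' : ∀ (x : Vec (nx i)) (u : Vec (nu i)) (y : Vec ny), 0 ≤ g.cost i x u y + κ * (y ⬝ᵥ y) :=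
    fun x u y => (mul_nonneg hε.le (add_nonneg (dotProduct_self_nonneg' _)
      (dotProduct_self_nonneg' _))).trans (hκ x u y)
  have hfin := tsum_lintegral_stage_ne_top hAB hF hP hx0 hopt hκ0 hκ' hz hw hq
  have hL := memLp_of_feedback hF hP hx0 hopt
  have hL' : ∀ t, g.β i ^ t ≠ 0 → MemLp (x' t) 2 ν ∧ MemLp (u' t) 2 ν := fun t =>
    memLp_of_lintegral_stage hε hκ ((hP'.measurable_x t).mono (hF.le t) le_rfl)
      ((hP'.measurable_u t).mono (hF.le t) le_rfl) (ENNReal.ne_top_of_tsum_ne_top hfin' t)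
  obtain ⟨c, hc, hcmp⟩ := exists_sum_cost_le_sum_cost hAB hF hP hx0 hopt hq
  simp only [fun t => lintegral_stage (x := x) (u := u) hκ' (hF.memLp_z t) (fun _ => hL t),
    fun t => lintegral_stage (x := x') (u := u') hκ' (hF.memLp_z t) (hL' t)] at hfin hfin' ⊢
  set f : ℕ → ℝ := fun t => g.β i ^ t *
    (∫ θ, g.cost i (x t θ) (u t θ) (z t θ) ∂ν + κ * ∫ θ, z t θ ⬝ᵥ z t θ ∂ν) with hf
  set f' : ℕ → ℝ := fun t => g.β i ^ t *
    (∫ θ, g.cost i (x' t θ) (u' t θ) (z t θ) ∂ν + κ * ∫ θ, z t θ ⬝ᵥ z t θ ∂ν) with hf'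
  have hf0 : ∀ t, 0 ≤ f t := fun t => by
    refine mul_nonneg (pow_nonneg hβ t) ?_
    rw [← integral_const_mul, ← integral_add (integrable_cost (hL t).1 (hL t).2 (hF.memLp_z t))
      ((integrable_dotProduct (hF.memLp_z t) (hF.memLp_z t)).const_mul κ)]
    exact integral_nonneg fun θ => hκ' _ _ _
  -- Coercivity bounds the rival's discounted mean-square state by a multiple of its stage cost, the
  -- general term of a convergent series; so the terminal term tends to zero.
  have hfx : ∀ t, g.β i ^ t * ∫ θ, x' t θ ⬝ᵥ x' t θ ∂ν ≤ ε⁻¹ * f' t := fun t => by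
    rcases eq_or_ne (g.β i ^ t) 0 with h | h
    · simp [hf', h]
    · have ix := integrable_dotProduct (hL' t h).1 (hL' t h).1
      have ic := integrable_cost (g := g) (hL' t h).1 (hL' t h).2 (hF.memLp_z t)
      have iz := (integrable_dotProduct (hF.memLp_z t) (hF.memLp_z t)).const_mul κ
      simp only [hf']
      rw [mul_left_comm ε⁻¹]
      refine mul_le_mul_of_nonneg_left ?_ (pow_nonneg hβ t)
      rw [inv_mul_eq_div, le_div_iff₀ hε, mul_comm _ ε, ← integral_const_mul, ← integral_const_mul,
        ← integral_add ic iz]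
      refine integral_mono (ix.const_mul ε) (ic.add iz) fun θ => ?_
      refine le_trans ?_ (hκ (x' t θ) (u' t θ) (z t θ))
      exact mul_le_mul_of_nonneg_left (le_add_of_nonneg_right (dotProduct_self_nonneg' _)) hε.le
  have hf0' : ∀ t, 0 ≤ f' t := fun t => by
    have h1 : 0 ≤ ε⁻¹ * f' t := (mul_nonneg (pow_nonneg hβ t)
      (integral_nonneg fun θ => dotProduct_self_nonneg' _)).trans (hfx t)
    exact nonneg_of_mul_nonneg_right h1 (inv_pos.2 hε)
  have hs : Summable f := by
    exact (ENNReal.summable_toReal hfin).congr fun t => (ENNReal.toReal_ofReal (hf0 t))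
  have hs' : Summable f' := by
    exact (ENNReal.summable_toReal hfin').congr fun t => (ENNReal.toReal_ofReal (hf0' t))
  rw [← ENNReal.ofReal_tsum_of_nonneg hf0 hs, ← ENNReal.ofReal_tsum_of_nonneg hf0' hs']
  refine ENNReal.ofReal_le_ofReal ?_
  have hlim : Filter.Tendsto (fun T => ∑ t ∈ Finset.range T, f' t + (c * (ε⁻¹ * f' T)
      + g.β i ^ T * (c * b))) Filter.atTop (nhds (∑' t, f' t + (c * (ε⁻¹ * 0) + 0 * (c * b)))) :=
    hs'.hasSum.tendsto_sum_nat.add (((hs'.tendsto_atTop_zero.const_mul _).const_mul _).add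
      ((tendsto_pow_atTop_nhds_zero_of_lt_one hβ (g.β_lt_one i)).mul_const _))
  have hle := le_of_tendsto_of_tendsto' hs.hasSum.tendsto_sum_nat hlim fun T => by
    have k1 := hcmp x' u' hP' h0 hL' T
    have k2 := mul_le_mul_of_nonneg_left (hfx T) hc
    simp only [hf, hf', mul_add, Finset.sum_add_distrib] at k1 k2 ⊢
    linarith
  simpa using hle

end Game

/-! ### Orthogonality of forecast errors -/

section Orthogonality

variable {ι κ : Type*} [Fintype ι] [Fintype κ]

lemma condExp_mulVec_sub_eq_zero {Ω : Type*} {m : MeasurableSpace Ω} [mΩ : MeasurableSpace Ω]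
    {P : Measure Ω} [IsFiniteMeasure P] (hm : m ≤ mΩ) (T : Matrix ι κ ℝ) {v vh : Ω → κ → ℝ}
    (hv : Integrable v P) (h : P[v | m] =ᵐ[P] vh) :
    P[fun ω => T *ᵥ (v ω - vh ω) | m] =ᵐ[P] 0 := by
  have hvh : Integrable vh P := integrable_condExp.congr h
  have e1 := condExp_mulVec (m := m) T (hv.sub hvh)
  have e2 := condExp_sub hv hvh m
  have e3 : P[vh | m] =ᵐ[P] P[v | m] := (condExp_congr_ae h.symm).trans
    (condExp_condExp_of_le le_rfl hm)
  refine Filter.EventuallyEq.trans e1 ?_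
  filter_upwards [e2, e3] with ω w2 w3
  rw [w2, Pi.sub_apply, w3, sub_self, mulVec_zero]
  rfl

lemma integral_dotProduct_eq_zero {Ω : Type*} {m : MeasurableSpace Ω} [mΩ : MeasurableSpace Ω]
    {P : Measure Ω} [IsFiniteMeasure P] (hm : m ≤ mΩ) {φ e : Ω → ι → ℝ} (hφ : Measurable[m] φ)
    (he : Integrable e P) (hφe : ∀ k, Integrable (fun ω => φ ω k * e ω k) P)
    (h : P[e | m] =ᵐ[P] 0) : ∫ ω, φ ω ⬝ᵥ e ω ∂P = 0 := by
  simp only [dotProduct]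
  rw [integral_finsetSum _ fun k _ => hφe k]
  refine Finset.sum_eq_zero fun k _ => ?_
  have hk : P[fun ω => e ω k | m] =ᵐ[P] 0 := by
    have := (ContinuousLinearMap.proj (R := ℝ) (φ := fun _ : ι => ℝ) k).comp_condExp_comm
      (m := m) he
    refine Filter.EventuallyEq.trans this.symm ?_
    filter_upwards [h] with ω w
    simp [w]
  have hφk : StronglyMeasurable[m] fun ω => φ ω k :=
    ((measurable_pi_apply k).comp hφ).stronglyMeasurable
  have e1 := condExp_mul_of_stronglyMeasurable_left hφk (hφe k) (he.eval k)
  have e2 : ∫ ω, φ ω k * e ω k ∂P = ∫ ω, P[(fun ω => φ ω k) * (fun ω => e ω k) | m] ω ∂P :=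
    (integral_condExp hm).symm
  rw [e2]
  refine integral_eq_zero_of_ae (e1.trans ?_)
  filter_upwards [hk] with ω w
  simp [w]

variable {Ω' Ω : Type*} {m' : MeasurableSpace Ω'} {m : MeasurableSpace Ω}
  [mΩ' : MeasurableSpace Ω'] [mΩ : MeasurableSpace Ω] {P : Measure Ω'} [IsProbabilityMeasure P]
  {μ : Measure Ω} [IsProbabilityMeasure μ]

/-- Fubini by slices: for fixed `ω` the section of `φ` is `m'`-measurable, so the ordinary pull-out
property applies on `Ω'`, with no conditional expectation on the product. -/
lemma integral_prod_dotProduct_fst_eq_zero (hm' : m' ≤ mΩ') {φ : Ω' × Ω → ι → ℝ}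
    (hφm : Measurable[m'.prod m] φ) (hφ : MemLp φ 2 (P.prod μ)) {e : Ω' → ι → ℝ}
    (he : MemLp e 2 P) (h : P[e | m'] =ᵐ[P] 0) : ∫ θ, φ θ ⬝ᵥ e θ.1 ∂(P.prod μ) = 0 := by
  have he' : MemLp (fun θ : Ω' × Ω => e θ.1) 2 (P.prod μ) := he.comp_fst μ
  rw [integral_prod_symm _ (integrable_dotProduct hφ he')]
  have hk : ∀ᵐ ω ∂μ, ∀ k, Integrable (fun ω' => φ (ω', ω) k * e ω' k) P :=
    ae_all_iff.2 fun k => ((hφ.eval k).integrable_mul (he'.eval k)).prod_left_ae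
  refine integral_eq_zero_of_ae ?_
  filter_upwards [hk] with ω w
  have hs : Measurable[m'] fun ω' => φ (ω', ω) :=
    @Measurable.comp _ _ _ m' (m'.prod m) _ _ _ hφm (@measurable_prodMk_right _ _ m' m ω)
  exact integral_dotProduct_eq_zero hm' hs (he.integrable (by norm_num)) w h

lemma integral_prod_dotProduct_snd_eq_zero (hm : m ≤ mΩ) {φ : Ω' × Ω → ι → ℝ}
    (hφm : Measurable[m'.prod m] φ) (hφ : MemLp φ 2 (P.prod μ)) {e : Ω → ι → ℝ}
    (he : MemLp e 2 μ) (h : μ[e | m] =ᵐ[μ] 0) : ∫ θ, φ θ ⬝ᵥ e θ.2 ∂(P.prod μ) = 0 := by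
  have he' : MemLp (fun θ : Ω' × Ω => e θ.2) 2 (P.prod μ) := he.comp_snd P
  rw [integral_prod _ (integrable_dotProduct hφ he')]
  have hk : ∀ᵐ ω' ∂P, ∀ k, Integrable (fun ω => φ (ω', ω) k * e ω k) μ :=
    ae_all_iff.2 fun k => ((hφ.eval k).integrable_mul (he'.eval k)).prod_right_ae
  refine integral_eq_zero_of_ae ?_
  filter_upwards [hk] with ω' w
  have hs : Measurable[m] fun ω => φ (ω', ω) :=
    @Measurable.comp _ _ _ m (m'.prod m) _ _ _ hφm (@measurable_prodMk_left _ _ m' m ω')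
  exact integral_dotProduct_eq_zero hm hs (he.integrable (by norm_num)) w h

end Orthogonality

/-! ### Mean-square bounds -/

section MeanSquare

variable {ι Ω : Type*} [Fintype ι] [MeasurableSpace Ω] {P : Measure Ω}

/-- `‖v‖` is the sup norm, while costs and moments use the dot product; the reverse comparison costs
a factor equal to the dimension. -/
lemma norm_sq_le_dotProduct_self (v : ι → ℝ) : ‖v‖ ^ 2 ≤ v ⬝ᵥ v := by
  have h : ‖v‖ ≤ √(v ⬝ᵥ v) := (pi_norm_le_iff_of_nonneg (Real.sqrt_nonneg _)).2 fun i =>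
    Real.abs_le_sqrt (sq_le_dotProduct_self v i)
  calc ‖v‖ ^ 2 ≤ √(v ⬝ᵥ v) ^ 2 := pow_le_pow_left₀ (norm_nonneg _) h 2
    _ = v ⬝ᵥ v := Real.sq_sqrt (dotProduct_self_nonneg' v)

lemma dotProduct_self_le_norm_sq (v : ι → ℝ) : v ⬝ᵥ v ≤ Fintype.card ι * ‖v‖ ^ 2 := by
  have h : ∀ i ∈ Finset.univ, v i * v i ≤ ‖v‖ ^ 2 := fun i _ => by
    rw [← sq, ← sq_abs]
    exact pow_le_pow_left₀ (abs_nonneg _) (norm_le_pi_norm v i) 2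
  simpa [dotProduct] using Finset.sum_le_card_nsmul Finset.univ _ _ h

lemma eLpNorm_two_sq (f : Ω → ι → ℝ) : eLpNorm f 2 P ^ (2 : ℝ) = ∫⁻ ω, ‖f ω‖ₑ ^ (2 : ℝ) ∂P := by
  have := eLpNorm_nnreal_pow_eq_lintegral (μ := P) (f := f) (p := 2) (by norm_num)
  simpa using this

lemma enorm_rpow_two (v : ι → ℝ) : ‖v‖ₑ ^ (2 : ℝ) = ENNReal.ofReal (‖v‖ ^ 2) := by
  rw [ENNReal.ofReal_pow (norm_nonneg _), ofReal_norm, ← ENNReal.rpow_natCast]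
  norm_num

lemma eLpNorm_two_sq_le (f : Ω → ι → ℝ) :
    eLpNorm f 2 P ^ (2 : ℝ) ≤ ∫⁻ ω, ENNReal.ofReal (f ω ⬝ᵥ f ω) ∂P := by
  rw [eLpNorm_two_sq]
  refine lintegral_mono fun ω => ?_
  rw [enorm_rpow_two]
  exact ENNReal.ofReal_le_ofReal (norm_sq_le_dotProduct_self _)

lemma integral_dotProduct_self_le {f : Ω → ι → ℝ} (hf : MemLp f 2 P) {d : ℝ≥0∞} (hd : d ≠ ⊤)
    (h : eLpNorm f 2 P ≤ d) :
    ∫ ω, f ω ⬝ᵥ f ω ∂P ≤ Fintype.card ι * (d ^ (2 : ℝ)).toReal := by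
  have hd2 : d ^ (2 : ℝ) ≠ ⊤ := ENNReal.rpow_ne_top_of_nonneg (by norm_num) hd
  have hle : ∫⁻ ω, ENNReal.ofReal (f ω ⬝ᵥ f ω) ∂P ≤ Fintype.card ι * d ^ (2 : ℝ) := by
    calc _ ≤ ∫⁻ ω, Fintype.card ι * ‖f ω‖ₑ ^ (2 : ℝ) ∂P := lintegral_mono fun ω => by
            rw [enorm_rpow_two, ← ENNReal.ofReal_natCast, ← ENNReal.ofReal_mul (by positivity)]
            exact ENNReal.ofReal_le_ofReal (dotProduct_self_le_norm_sq _)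
      _ = Fintype.card ι * eLpNorm f 2 P ^ (2 : ℝ) := by
            rw [lintegral_const_mul' _ _ (ENNReal.natCast_ne_top _), eLpNorm_two_sq]
      _ ≤ _ := by gcongr
  rw [integral_eq_lintegral_of_nonneg_ae
    (Filter.Eventually.of_forall fun ω => dotProduct_self_nonneg' _)
    (integrable_dotProduct hf hf).aestronglyMeasurable]
  refine (ENNReal.toReal_mono (ENNReal.mul_ne_top (ENNReal.natCast_ne_top _) hd2) hle).trans ?_
  rw [ENNReal.toReal_mul, ENNReal.toReal_natCast]

end MeanSquare

lemma memLp_mulVec_sub {ι κ : Type*} [Fintype ι] [Fintype κ] {Ω : Type*} {m : MeasurableSpace Ω}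
    [mΩ : MeasurableSpace Ω] {P : Measure Ω} [IsFiniteMeasure P] (T : Matrix ι κ ℝ)
    {v vh : Ω → κ → ℝ} (hv : MemLp v 2 P) (h : P[v | m] =ᵐ[P] vh) :
    MemLp (fun ω => T *ᵥ (v ω - vh ω)) 2 P := by
  have h1 : MemLp vh 2 P := (hv.condExp (by norm_num)).ae_eq h
  have h2 : MemLp (fun ω => v ω - vh ω) 2 P := hv.sub h1
  exact memLp_mulVec T h2

/-- The component of player `i` as a continuous linear map. -/
def ownCLM {N n0 : ℕ} {nx : Fin N → ℕ} (i : Fin N) : StateVec n0 nx →L[ℝ] Vec (nx i) :=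
  ContinuousLinearMap.pi fun r => ContinuousLinearMap.proj (Sum.inr ⟨i, r⟩)

lemma memLp_own {N n0 : ℕ} {nx : Fin N → ℕ} (i : Fin N) {Ω : Type*} [MeasurableSpace Ω]
    {μ : Measure Ω} {X : Ω → StateVec n0 nx} (hX : MemLp X 2 μ) :
    MemLp (fun ω => own i (X ω)) 2 μ :=
  (ownCLM i).comp_memLp' hX

-- Forecast errors on the product of replica and player

namespace Game

variable {N n0 ny : ℕ} {nx nu : Fin N → ℕ} {g : Game N n0 ny nx nu}
  {Ω' Ω : Type*} [mΩ' : MeasurableSpace Ω'] [mΩ : MeasurableSpace Ω]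
  {P : Measure Ω'} [IsProbabilityMeasure P] {μ : Measure Ω} [IsProbabilityMeasure μ]
  {X0 : Ω → StateVec n0 nx} {W : ℕ → Ω → StateVec n0 nx} {ξ : ℕ → Ω → Vec ny}
  {X0' : Ω' → StateVec n0 nx} {W' : ℕ → Ω' → StateVec n0 nx} {ξ' : ℕ → Ω' → Vec ny}
  {what : StateVec n0 nx} {ξhat : Vec ny}

variable (g P X0 W ξ X0' W' ξ' what ξhat) in
/-- Information at time `t` when the environment variables are those of an independent replica. -/
@[reducible] def info (t : ℕ) : MeasurableSpace (Ω' × Ω) :=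
  (g.repAlg P what ξhat X0' W' ξ' t).prod (past X0 W ξ t)

/-- The errors in the environment variable and in the next estimate live on the replica factor, the
error in the own disturbance on the other. Each has zero conditional mean given the information of
its own factor. -/
lemma integral_forecast_error (h : Primitives μ X0 W ξ) (h' : Primitives P X0' W' ξ')
    (hW : what = ∫ ω, W 0 ω ∂μ) (hW' : what = ∫ ω, W' 0 ω ∂P) (hξ' : ξhat = ∫ ω, ξ' 0 ω ∂P)
    {κ : Type*} [Fintype κ] (i : Fin N) (T₁ : Matrix κ (Fin ny) ℝ)
    (T₂ : Matrix κ (StateIdx n0 nx) ℝ) (T₃ : Matrix κ (Fin (nx i)) ℝ) (t : ℕ)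
    {φ : Ω' × Ω → κ → ℝ} (hφm : Measurable[g.info P X0 W ξ X0' W' ξ' what ξhat t] φ)
    (hφ : MemLp φ 2 (P.prod μ)) :
    ∫ θ, φ θ ⬝ᵥ (T₁ *ᵥ (g.replicaEnv P what ξhat X0' W' ξ' t θ.1
          - g.meanEnv what ξhat (g.repEst P what ξhat X0' W' ξ' t θ.1))
        + T₂ *ᵥ (g.repEst P what ξhat X0' W' ξ' (t + 1) θ.1
          - g.meanNext what ξhat (g.repEst P what ξhat X0' W' ξ' t θ.1))
        + T₃ *ᵥ (own i (W t θ.2) - own i what)) ∂(P.prod μ) = 0 := by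
  have hm' := repAlg_le (g := g) (what := what) (ξhat := ξhat) h' t
  have ly := memLp_replicaEnv (g := g) (what := what) (ξhat := ξhat) h' t
  have le := memLp_repEst (g := g) (what := what) (ξhat := ξhat) h' (t + 1)
  have lw := memLp_own i (h.memLp_W t)
  have cy := condExp_replicaEnv (g := g) (what := what) h' hξ' t
  have ce := condExp_repEst_succ (g := g) h' hW' hξ' t
  have cw : μ[fun ω => own i (W t ω) | past X0 W ξ t] =ᵐ[μ] fun _ => own i what := by
    have h1 := (ownCLM i).comp_condExp_comm (m := past X0 W ξ t)
      ((h.memLp_W t).integrable (by norm_num))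
    refine Filter.EventuallyEq.trans h1.symm ?_
    filter_upwards [h.condExp_W t le_rfl] with ω w
    rw [Function.comp_apply, w, ← hW]
    rfl
  have o1 := integral_prod_dotProduct_fst_eq_zero hm' hφm hφ (memLp_mulVec_sub T₁ ly cy)
    (condExp_mulVec_sub_eq_zero hm' T₁ (ly.integrable (by norm_num)) cy)
  have o2 := integral_prod_dotProduct_fst_eq_zero hm' hφm hφ (memLp_mulVec_sub T₂ le ce)
    (condExp_mulVec_sub_eq_zero hm' T₂ (le.integrable (by norm_num)) ce)
  have o3 := integral_prod_dotProduct_snd_eq_zero (h.past_le t) hφm hφ (memLp_mulVec_sub T₃ lw cw)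
    (condExp_mulVec_sub_eq_zero (h.past_le t) T₃ (lw.integrable (by norm_num)) cw)
  have i1 := integrable_dotProduct hφ ((memLp_mulVec_sub T₁ ly cy).comp_fst μ)
  have i2 := integrable_dotProduct hφ ((memLp_mulVec_sub T₂ le ce).comp_fst μ)
  have i3 := integrable_dotProduct hφ ((memLp_mulVec_sub T₃ lw cw).comp_snd P)
  simp only [dotProduct_add]
  have e1 := integral_add (i1.add i2) i3
  have e2 := integral_add i1 i2
  simp only [Pi.add_apply] at e1 e2
  rw [e1, e2, o1, o2, o3]
  simp

/-- By `costate_eq` the residual vanishes when realizations equal forecasts. The costate is affine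
in the estimate, so the residual is linear in the three forecast errors; the same holds for
`inputResid_eq`. -/
lemma MeanSolvable.stateResid_eq (hs : g.MeanSolvable what ξhat)
    (hAB : ∀ i, IsStabilizable (g.A i) (g.B i)) (i : Fin N) (y : Vec ny) (v : Vec (nx i))
    (x x' : StateVec n0 nx) :
    g.stateResid i y v (g.costate what ξhat i x) (g.costate what ξhat i x') =
      g.envWeight i *ᵥ (y - g.meanEnv what ξhat x)
      + (g.Φ i * ∑' n, g.Φ i ^ n * g.envWeight i * g.a what ξhat n) *ᵥ
        (x' - g.meanNext what ξhat x)
      + (g.Φ i * g.M i) *ᵥ (v - own i what) := by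
  rw [hs.costate_eq hAB i x, hs.costate_eq_affine (hAB i) x',
    hs.costate_eq_affine (hAB i) (g.meanNext what ξhat x), stateResid]
  simp only [envWeight, mulVec_add, mulVec_sub, add_mulVec, ← mulVec_mulVec]
  abel

lemma MeanSolvable.inputResid_eq (hs : g.MeanSolvable what ξhat)
    (hAB : ∀ i, IsStabilizable (g.A i) (g.B i)) (i : Fin N) (y : Vec ny) (v : Vec (nx i))
    (x x' : StateVec n0 nx) :
    g.inputResid i y v (g.costate what ξhat i x')
        (g.G what ξhat i *ᵥ x + g.checkH what ξhat i) =
      ((g.K i)ᵀ + g.β i • ((g.B i)ᵀ * (g.M i * g.C i))) *ᵥ (y - g.meanEnv what ξhat x)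
      + (g.β i • ((g.B i)ᵀ * ∑' n, g.Φ i ^ n * g.envWeight i * g.a what ξhat n)) *ᵥ
        (x' - g.meanNext what ξhat x)
      + (g.β i • ((g.B i)ᵀ * g.M i)) *ᵥ (v - own i what) := by
  rw [inputResid, hs.S_mulVec_input hAB, hs.costate_eq_affine (hAB i) x',
    hs.costate_eq_affine (hAB i) (g.meanNext what ξhat x)]
  simp only [mulVec_add, mulVec_sub, add_mulVec, smul_mulVec, ← mulVec_mulVec, smul_add]
  abel

omit mΩ in
lemma memLp_costate (h' : Primitives P X0' W' ξ') (hs : g.MeanSolvable what ξhat)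
    (hAB : ∀ i, IsStabilizable (g.A i) (g.B i)) (i : Fin N) (t : ℕ) :
    MemLp (fun ω => g.costate what ξhat i (g.repEst P what ξhat X0' W' ξ' t ω)) 2 P := by
  have h1 := (memLp_mulVec (∑' n, g.Φ i ^ n * g.envWeight i * g.a what ξhat n)
    (memLp_repEst (g := g) (what := what) (ξhat := ξhat) h' t)).add
      (memLp_const (g.costate what ξhat i 0))
  refine h1.ae_eq (Filter.Eventually.of_forall fun ω => ?_)
  exact (hs.costate_eq_affine (hAB i) _).symm

/-- Along the replica process the costate and the feedforward part of the candidate strategy are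
consistent with the forecasts. -/
lemma isForecast_replica (h : Primitives μ X0 W ξ) (h' : Primitives P X0' W' ξ')
    (hW : what = ∫ ω, W 0 ω ∂μ) (hW' : what = ∫ ω, W' 0 ω ∂P) (hξ' : ξhat = ∫ ω, ξ' 0 ω ∂P)
    (hs : g.MeanSolvable what ξhat) (hAB : ∀ i, IsStabilizable (g.A i) (g.B i)) (i : Fin N) :
    g.IsForecast i (P.prod μ) (g.info P X0 W ξ X0' W' ξ' what ξhat)
      (fun t θ => g.replicaEnv P what ξhat X0' W' ξ' t θ.1) (fun t θ => own i (W t θ.2))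
      (fun t θ => g.costate what ξhat i (g.repEst P what ξhat X0' W' ξ' t θ.1))
      (fun t θ => g.G what ξhat i *ᵥ g.repEst P what ξhat X0' W' ξ' t θ.1
        + g.checkH what ξhat i) where
  le t := sup_le_sup (MeasurableSpace.comap_mono (repAlg_le h' t))
    (MeasurableSpace.comap_mono (h.past_le t))
  memLp_z t := (memLp_replicaEnv h' t).comp_fst μ
  memLp_w t := (memLp_own i (h.memLp_W t)).comp_snd P
  memLp_q t := by
    have h1 : MemLp (fun ω => g.costate what ξhat i (g.repEst P what ξhat X0' W' ξ' t ω)) 2 P :=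
      memLp_costate h' hs hAB i t
    exact h1.comp_fst μ
  memLp_r t := (memLp_mulVec (g.G what ξhat i) ((memLp_repEst h' t).comp_fst μ)).add
    (memLp_const (g.checkH what ξhat i))
  state_orth t φ hφm hφ := by
    simp only [hs.stateResid_eq hAB]
    exact integral_forecast_error h h' hW hW' hξ' i _ _ _ t hφm hφ
  input_orth t φ hφm hφ := by
    simp only [hs.inputResid_eq hAB]
    exact integral_forecast_error h h' hW hW' hξ' i _ _ _ t hφm hφ

omit [IsProbabilityMeasure P] mΩ in
/-- Any strategy generates an adapted path. -/
lemma isPath_strategy (i : Fin N) (s : Strategy (nx i) (nu i) ny) :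
    g.IsPath i (g.info P X0 W ξ X0' W' ξ' what ξhat)
      (fun t (θ : Ω' × Ω) => g.replicaEnv P what ξhat X0' W' ξ' t θ.1)
      (fun t θ => own i (W t θ.2))
      (fun t θ => g.plState i s (own i (X0 θ.2)) (fun k => own i (W k θ.2))
        (fun k => g.replicaEnv P what ξhat X0' W' ξ' k θ.1) t)
      (fun t θ => g.plInput i s (own i (X0 θ.2)) (fun k => own i (W k θ.2))
        (fun k => g.replicaEnv P what ξhat X0' W' ξ' k θ.1) t) := by
  -- The past of all primitives exceeds what the player observes, so the comparison covers even more
  -- paths than those of pure strategies.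
  have hfst : ∀ t, Measurable[g.info P X0 W ξ X0' W' ξ' what ξhat t,
      g.repAlg P what ξhat X0' W' ξ' t] (Prod.fst : Ω' × Ω → Ω') := fun t =>
    @measurable_fst _ _ (g.repAlg P what ξhat X0' W' ξ' t) (past X0 W ξ t)
  have hsnd : ∀ t, Measurable[g.info P X0 W ξ X0' W' ξ' what ξhat t,
      past X0 W ξ t] (Prod.snd : Ω' × Ω → Ω) := fun t =>
    @measurable_snd _ _ (g.repAlg P what ξhat X0' W' ξ' t) (past X0 W ξ t)
  have hx0 : ∀ t, Measurable[g.info P X0 W ξ X0' W' ξ' what ξhat t]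
      fun θ : Ω' × Ω => own i (X0 θ.2) := fun t =>
    (measurable_own i).comp ((measurable_past_X0 t).comp (hsnd t))
  have hw : ∀ t, ∀ k < t, Measurable[g.info P X0 W ξ X0' W' ξ' what ξhat t]
      fun θ : Ω' × Ω => own i (W k θ.2) := fun t k hk =>
    (measurable_own i).comp ((measurable_past_W hk).comp (hsnd t))
  have hz : ∀ t, ∀ k < t, Measurable[g.info P X0 W ξ X0' W' ξ' what ξhat t]
      fun θ : Ω' × Ω => g.replicaEnv P what ξhat X0' W' ξ' k θ.1 := fun t k hk =>
    (measurable_replicaEnv_repAlg hk).comp (hfst t)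
  exact ⟨fun t => measurable_plState (hx0 t) t (hw t) (hz t),
    fun t => measurable_plInput (hx0 t) t (hw t) (hz t), fun t θ => plState_succ ..⟩

end Game

-- Optimality against the law of the replica

namespace Game

variable {N n0 ny : ℕ} {nx nu : Fin N → ℕ} {g : Game N n0 ny nx nu}
  {Ω' Ω : Type*} [mΩ' : MeasurableSpace Ω'] [mΩ : MeasurableSpace Ω]
  {P : Measure Ω'} [IsProbabilityMeasure P] {μ : Measure Ω} [IsProbabilityMeasure μ]
  {X0 : Ω → StateVec n0 nx} {W : ℕ → Ω → StateVec n0 nx} {ξ : ℕ → Ω → Vec ny}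
  {X0' : Ω' → StateVec n0 nx} {W' : ℕ → Ω' → StateVec n0 nx} {ξ' : ℕ → Ω' → Vec ny}
  {what : StateVec n0 nx} {ξhat : Vec ny}

-- Doob–Dynkin: a map measurable with respect to the observations factors measurably through them.
omit [IsProbabilityMeasure P] in
lemma exists_isEstimator : ∃ est : ∀ t : ℕ, (Fin t → Vec ny) → StateVec n0 nx,
    g.IsEstimator P what ξhat X0' W' ξ' est := by
  have h : ∀ t, ∃ e : (Fin t → Vec ny) → StateVec n0 nx, Measurable e ∧
      g.repEst P what ξhat X0' W' ξ' t = e ∘ (g.replica P what ξhat X0' W' ξ' t).2 := fun t =>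
    Measurable.exists_eq_measurable_comp
      (stronglyMeasurable_condExp (m := g.repAlg P what ξhat X0' W' ξ' t)).measurable
  choose est hm he using h
  exact ⟨est, hm, fun t => Filter.Eventually.of_forall fun ω => (congrFun (he t) ω).symm⟩

omit [IsProbabilityMeasure P] in
lemma measurable_replicaEnv (h' : Primitives P X0' W' ξ') (t : ℕ) :
    Measurable (g.replicaEnv P what ξhat X0' W' ξ' t) :=
  (measurable_replicaEnv_repAlg t.lt_succ_self).mono (repAlg_le h' (t + 1)) le_rfl

omit [IsProbabilityMeasure μ] in
/-- The mean squares of the environment variables, of the disturbances and of the costate are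
uniformly bounded. -/
lemma exists_meanSquare_le (h : Primitives μ X0 W ξ) (h' : Primitives P X0' W' ξ')
    (hW' : what = ∫ ω, W' 0 ω ∂P) (hξ' : ξhat = ∫ ω, ξ' 0 ω ∂P)
    (hs : g.MeanSolvable what ξhat) (hAB : ∀ i, IsStabilizable (g.A i) (g.B i)) (i : Fin N)
    (hmom : (⨆ t, ∫⁻ ω', ENNReal.ofReal (g.replicaEnv P what ξhat X0' W' ξ' t ω' ⬝ᵥ
      g.replicaEnv P what ξhat X0' W' ξ' t ω') ∂P) < ⊤) :
    ∃ b : ℝ, (∀ t, ∫ ω, g.replicaEnv P what ξhat X0' W' ξ' t ω ⬝ᵥ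
        g.replicaEnv P what ξhat X0' W' ξ' t ω ∂P ≤ b) ∧
      (∀ t, ∫ ω, own i (W t ω) ⬝ᵥ own i (W t ω) ∂μ ≤ b) ∧
      ∀ t, ∫ ω, g.costate what ξhat i (g.repEst P what ξhat X0' W' ξ' t ω) ⬝ᵥ
        g.costate what ξhat i (g.repEst P what ξhat X0' W' ξ' t ω) ∂P ≤ b := by
  -- `hmom` concerns squared norms, so its square root bounds the `L²` norms.
  set c := (⨆ t, ∫⁻ ω', ENNReal.ofReal (g.replicaEnv P what ξhat X0' W' ξ' t ω' ⬝ᵥ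
      g.replicaEnv P what ξhat X0' W' ξ' t ω') ∂P) ^ (2⁻¹ : ℝ)
  have hc : c ≠ ⊤ := ENNReal.rpow_ne_top_of_nonneg (by norm_num) hmom.ne
  have hy : ∀ t, eLpNorm (g.replicaEnv P what ξhat X0' W' ξ' t) 2 P ≤ c := fun t => by
    have h1 := (eLpNorm_two_sq_le (P := P) (g.replicaEnv P what ξhat X0' W' ξ' t)).trans
      (le_iSup (fun t => ∫⁻ ω', ENNReal.ofReal (g.replicaEnv P what ξhat X0' W' ξ' t ω' ⬝ᵥ
      g.replicaEnv P what ξhat X0' W' ξ' t ω') ∂P) t)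
    exact (ENNReal.le_rpow_inv_iff (by norm_num)).2 h1
  obtain ⟨d, hd, hq⟩ := exists_eLpNorm_costate_le h' hW' hξ' hAB hs hc hy i
  have lw : ∀ t, ∫ ω, own i (W t ω) ⬝ᵥ own i (W t ω) ∂μ
      = ∫ ω, own i (W 0 ω) ⬝ᵥ own i (W 0 ω) ∂μ := fun t => by
    have hm : Measurable fun X : StateVec n0 nx => own i X ⬝ᵥ own i X :=
      measurable_dotProduct (measurable_own i) (measurable_own i)
    exact ((h.ident_W t).comp hm).integral_eq
  refine ⟨max (Fintype.card (Fin ny) * (c ^ (2 : ℝ)).toReal)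
    (max (∫ ω, own i (W 0 ω) ⬝ᵥ own i (W 0 ω) ∂μ)
      (Fintype.card (Fin (nx i)) * (d ^ (2 : ℝ)).toReal)), fun t => ?_, fun t => ?_, fun t => ?_⟩
  · exact (integral_dotProduct_self_le (memLp_replicaEnv h' t) hc (hy t)).trans (le_max_left _ _)
  · exact (lw t).le.trans ((le_max_left _ _).trans (le_max_right _ _))
  · exact (integral_dotProduct_self_le (memLp_costate h' hs hAB i t) hd (hq t)).trans
      ((le_max_right _ _).trans (le_max_right _ _))

/-- Against the law of the replica environment variables, the candidate strategy has finite cost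
and is optimal. -/
lemma beliefCost_affineProfile (h : Primitives μ X0 W ξ) (h' : Primitives P X0' W' ξ')
    (hW : what = ∫ ω, W 0 ω ∂μ) (hW' : what = ∫ ω, W' 0 ω ∂P) (hξ' : ξhat = ∫ ω, ξ' 0 ω ∂P)
    (hs : g.MeanSolvable what ξhat) (hAB : ∀ i, IsStabilizable (g.A i) (g.B i)) (i : Fin N)
    (hmom : (⨆ t, ∫⁻ ω', ENNReal.ofReal (g.replicaEnv P what ξhat X0' W' ξ' t ω' ⬝ᵥ
      g.replicaEnv P what ξhat X0' W' ξ' t ω') ∂P) < ⊤)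
    {est : ∀ t : ℕ, (Fin t → Vec ny) → StateVec n0 nx}
    (he : g.IsEstimator P what ξhat X0' W' ξ' est) :
    (∃ c : ℝ, g.beliefCost μ X0 W i (P.map fun ω t => g.replicaEnv P what ξhat X0' W' ξ' t ω)
        (g.affineProfile what ξhat est he.measurable_est i) = (c : EReal)) ∧
      ∀ s : Strategy (nx i) (nu i) ny,
        g.beliefCost μ X0 W i (P.map fun ω t => g.replicaEnv P what ξhat X0' W' ξ' t ω)
          (g.affineProfile what ξhat est he.measurable_est i) ≤
        g.beliefCost μ X0 W i (P.map fun ω t => g.replicaEnv P what ξhat X0' W' ξ' t ω) s := by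
  have hβ := g.β_nonneg i
  obtain ⟨ε, κ, hε, hκ0, hκ⟩ := g.exists_le_cost i
  have hκ' : ∀ (x : Vec (nx i)) (u : Vec (nu i)) (y : Vec ny), 0 ≤ g.cost i x u y + κ * (y ⬝ᵥ y) :=
    fun x u y => (mul_nonneg hε.le (add_nonneg (dotProduct_self_nonneg' _)
      (dotProduct_self_nonneg' _))).trans (hκ x u y)
  obtain ⟨b, hbz, hbw, hbq⟩ := exists_meanSquare_le h h' hW' hξ' hs hAB i hmom
  have hb : 0 ≤ b := (integral_nonneg fun θ => dotProduct_self_nonneg' _).trans (hbz 0)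
  have hF := isForecast_replica h h' hW hW' hξ' hs hAB i
  have hP := fun s => isPath_strategy (g := g) (P := P) (X0 := X0) (W := W) (ξ := ξ) (X0' := X0')
    (W' := W') (ξ' := ξ') (what := what) (ξhat := ξhat) i s
  have hx0 : MemLp (fun θ : Ω' × Ω => own i (X0 θ.2)) 2 (P.prod μ) :=
    (memLp_own i h.memLp_X0).comp_snd P
  have hopt : ∀ t, (fun θ : Ω' × Ω => g.plInput i (g.affineProfile what ξhat est he.measurable_est i)
        (own i (X0 θ.2)) (fun k => own i (W k θ.2))
        (fun k => g.replicaEnv P what ξhat X0' W' ξ' k θ.1) t) =ᵐ[P.prod μ]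
      fun θ => g.F i *ᵥ g.plState i (g.affineProfile what ξhat est he.measurable_est i)
        (own i (X0 θ.2)) (fun k => own i (W k θ.2))
        (fun k => g.replicaEnv P what ξhat X0' W' ξ' k θ.1) t
        + (g.G what ξhat i *ᵥ g.repEst P what ξhat X0' W' ξ' t θ.1 + g.checkH what ξhat i) := by
    intro t
    -- The estimator agrees with the conditional expectation only almost everywhere on `Ω'`; the
    -- projection pulls the null set back to a null set of the product.
    have h1 := Measure.quasiMeasurePreserving_fst (μ := P) (ν := μ) |>.ae_eq_comp (he.ae_eq t)
    filter_upwards [h1] with θ w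
    rw [plInput_affineProfile]
    congr 3
    have e : (fun k : Fin t => g.replicaEnv P what ξhat X0' W' ξ' k θ.1) =
        (g.replica P what ξhat X0' W' ξ' t).2 θ.1 :=
      funext fun k => (replica_snd_apply g P what ξhat X0' W' ξ' t θ.1 k).symm
    rw [e]
    exact w
  have bz : ∀ t, ∫ θ : Ω' × Ω, g.replicaEnv P what ξhat X0' W' ξ' t θ.1 ⬝ᵥ
      g.replicaEnv P what ξhat X0' W' ξ' t θ.1 ∂(P.prod μ) ≤ b := fun t => by
    rw [integral_fun_fst (fun ω => g.replicaEnv P what ξhat X0' W' ξ' t ω ⬝ᵥ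
      g.replicaEnv P what ξhat X0' W' ξ' t ω)]
    simpa using hbz t
  have bw : ∀ t, ∫ θ : Ω' × Ω, own i (W t θ.2) ⬝ᵥ own i (W t θ.2) ∂(P.prod μ) ≤ b := fun t => by
    rw [integral_fun_snd (fun ω => own i (W t ω) ⬝ᵥ own i (W t ω))]
    simpa using hbw t
  have bq : ∀ t, ∫ θ : Ω' × Ω, g.costate what ξhat i (g.repEst P what ξhat X0' W' ξ' t θ.1) ⬝ᵥ
      g.costate what ξhat i (g.repEst P what ξhat X0' W' ξ' t θ.1) ∂(P.prod μ) ≤ b := fun t => by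
    rw [integral_fun_fst (fun ω => g.costate what ξhat i (g.repEst P what ξhat X0' W' ξ' t ω) ⬝ᵥ
      g.costate what ξhat i (g.repEst P what ξhat X0' W' ξ' t ω))]
    simpa using hbq t
  have hfin : ∑' t, ∫⁻ ω', ENNReal.ofReal (g.β i ^ t *
      (κ * (g.replicaEnv P what ξhat X0' W' ξ' t ω' ⬝ᵥ
        g.replicaEnv P what ξhat X0' W' ξ' t ω'))) ∂P ≠ ⊤ := by
    refine ne_top_of_le_ne_top (ENNReal.ofReal_ne_top (r := (1 - g.β i)⁻¹ * (κ * b)))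
      (ENNReal.tsum_le_of_sum_range_le fun T => ?_)
    have e : ∀ t, ∫⁻ ω', ENNReal.ofReal (g.β i ^ t *
        (κ * (g.replicaEnv P what ξhat X0' W' ξ' t ω' ⬝ᵥ
          g.replicaEnv P what ξhat X0' W' ξ' t ω'))) ∂P = ENNReal.ofReal (g.β i ^ t *
        (κ * ∫ ω', g.replicaEnv P what ξhat X0' W' ξ' t ω' ⬝ᵥ
          g.replicaEnv P what ξhat X0' W' ξ' t ω' ∂P)) := fun t => by
      have hi := integrable_dotProduct (memLp_replicaEnv (g := g) (what := what) (ξhat := ξhat) h' t)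
        (memLp_replicaEnv (g := g) (what := what) (ξhat := ξhat) h' t)
      rw [← integral_const_mul, ← integral_const_mul]
      refine (ofReal_integral_eq_lintegral_ofReal ((hi.const_mul _).const_mul _)
        (Filter.Eventually.of_forall fun ω => ?_)).symm
      exact mul_nonneg (pow_nonneg hβ t) (mul_nonneg hκ0 (dotProduct_self_nonneg' _))
    simp only [e]
    rw [← ENNReal.ofReal_sum_of_nonneg fun t _ => mul_nonneg (pow_nonneg hβ t)
      (mul_nonneg hκ0 (integral_nonneg fun ω => dotProduct_self_nonneg' _))]
    exact ENNReal.ofReal_le_ofReal (sum_pow_mul_le hβ (g.β_lt_one i) (by positivity)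
      (fun t => mul_le_mul_of_nonneg_left (hbz t) hκ0) T)
  have hcost := beliefCost_eq (μ := μ) (P := P) h.measurable_X0 h.measurable_W
    (measurable_replicaEnv (g := g) (what := what) (ξhat := ξhat) h') hκ0 hκ' hfin
  constructor
  · have h1 := tsum_lintegral_stage_ne_top (hAB i) hF (hP _) hx0 hopt hκ0 hκ' bz bw bq
    rw [hcost]
    lift (∑' t, ∫⁻ ω', ENNReal.ofReal (g.β i ^ t *
      (κ * (g.replicaEnv P what ξhat X0' W' ξ' t ω' ⬝ᵥ
        g.replicaEnv P what ξhat X0' W' ξ' t ω'))) ∂P) to NNReal using hfin with d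
    generalize (∑' t, ∫⁻ θ : Ω' × Ω, _ ∂(P.prod μ)) = p at h1 ⊢
    lift p to NNReal using h1
    exact ⟨p - d, by simp only [EReal.coe_nnreal_eq_coe_real, EReal.coe_sub]⟩
  · intro s
    rw [hcost, hcost]
    -- The subtracted term is the same for every strategy, so only the nonnegative series are
    -- compared.
    refine EReal.sub_le_sub (EReal.coe_ennreal_le_coe_ennreal_iff.2 ?_) le_rfl
    exact tsum_lintegral_stage_le (hAB i) hF (hP _) hx0 hopt hε hκ0 hκ bz bw bq (hP s) rfl

end Game

end LQ

end

-- The equilibrium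

theorem theorem2 {N n0 ny : ℕ} {nx nu : Fin N → ℕ} (g : LQ.Game N n0 ny nx nu)
    {Ω : Type*} [MeasurableSpace Ω] (μ : Measure Ω) [IsProbabilityMeasure μ]
    (X0 : Ω → LQ.StateVec n0 nx) (W : ℕ → Ω → LQ.StateVec n0 nx) (ξ : ℕ → Ω → LQ.Vec ny)
    (hA0 : LQ.IsStable g.A0) (hAB : ∀ i, LQ.IsStabilizable (g.A i) (g.B i))
    (hprim : LQ.Primitives μ X0 W ξ)
    (what : LQ.StateVec n0 nx) (hwhat : what = ∫ ω, W 0 ω ∂μ)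
    (ξhat : LQ.Vec ny) (hξhat : ξhat = ∫ ω, ξ 0 ω ∂μ)
    (hsolv : ∀ Xhat0 : LQ.StateVec n0 nx,
      ∃! y : ℕ → LQ.Vec ny, g.IsBoundedMeanSolution what ξhat Xhat0 y)
    {Ω' : Type*} [MeasurableSpace Ω'] (P : Measure Ω') [IsProbabilityMeasure P]
    (Xbar0 : Ω' → LQ.StateVec n0 nx) (Wbar : ℕ → Ω' → LQ.StateVec n0 nx)
    (ξbar : ℕ → Ω' → LQ.Vec ny)
    (hXbar0 : Measurable Xbar0) (hWbar : ∀ t, Measurable (Wbar t))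
    (hξbar : ∀ t, Measurable (ξbar t))
    (hident : IdentDistrib (fun ω' => (Xbar0 ω', fun t => ξbar t ω', fun t => Wbar t ω'))
      (fun ω => (X0 ω, fun t => ξ t ω, fun t => W t ω)) P μ)
    (hmom : (⨆ t, ∫⁻ ω', ENNReal.ofReal
        (g.replicaEnv P what ξhat Xbar0 Wbar ξbar t ω' ⬝ᵥ
          g.replicaEnv P what ξhat Xbar0 Wbar ξbar t ω') ∂P) < ⊤) :
    (∃ est : ∀ t : ℕ, (Fin t → LQ.Vec ny) → LQ.StateVec n0 nx,
      g.IsEstimator P what ξhat Xbar0 Wbar ξbar est) ∧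
    ∀ (est : ∀ t : ℕ, (Fin t → LQ.Vec ny) → LQ.StateVec n0 nx)
      (hest : g.IsEstimator P what ξhat Xbar0 Wbar ξbar est),
      g.IsSEBEU μ X0 W ξ (g.affineProfile what ξhat est hest.measurable_est) ∧
      ∀ i, ∃ c : ℝ, g.beliefCost μ X0 W i
        (g.envLaw μ X0 W ξ (g.affineProfile what ξhat est hest.measurable_est))
        (g.affineProfile what ξhat est hest.measurable_est i) = (c : EReal) := by
  have hprim' := hprim.of_identDistrib hXbar0 hWbar hξbar hident
  have hs : g.MeanSolvable what ξhat := hsolv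
  have hW' : what = ∫ ω, Wbar 0 ω ∂P := by
    have iW : IdentDistrib (Wbar 0) (W 0) P μ :=
      hident.comp ((measurable_pi_apply 0).comp (measurable_snd.comp measurable_snd))
    rw [hwhat, iW.integral_eq]
  have hξ' : ξhat = ∫ ω, ξbar 0 ω ∂P := by
    have iξ : IdentDistrib (ξbar 0) (ξ 0) P μ :=
      hident.comp ((measurable_pi_apply 0).comp (measurable_fst.comp measurable_snd))
    rw [hξhat, iξ.integral_eq]
  refine ⟨LQ.Game.exists_isEstimator, fun est hest => ?_⟩
  have hlaw := LQ.Game.envLaw_affineProfile (hest := hest.measurable_est) hs hAB hident hest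
  have hkey := fun i =>
    LQ.Game.beliefCost_affineProfile hprim hprim' hwhat hW' hξ' hs hAB i hmom hest
  -- The generated law itself serves as every player's belief, so consistency holds by definition;
  -- optimality is checked after rewriting it as the law of the replica.
  refine ⟨⟨fun _ => g.envLaw μ X0 W ξ (g.affineProfile what ξhat est hest.measurable_est),
    fun _ => ?_, fun i s => ?_, fun _ => rfl⟩, fun i => ?_⟩
  · rw [hlaw]
    exact Measure.isProbabilityMeasure_map (measurable_pi_lambda _ fun t =>
      LQ.Game.measurable_replicaEnv hprim' t).aemeasurable
  · rw [hlaw]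
    exact (hkey i).2 s
  · rw [hlaw]
    exact (hkey i).1
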